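/- Let $0<\varepsilon<\hslash\omega_D$ and $N_0>0$, put $I=[\varepsilon,\hslash\omega_D]$, and let $U$ be an arbitrary positive continuous function on $I^2$. Let $u_0$ be the solution of the BCS-Bogoliubov gap equation $$u_0(T,x)=\int_{\varepsilon}^{\hslash\omega_D}\frac{U(x,\xi)\,u_0(T,\xi)}{\sqrt{\xi^2+u_0(T,\xi)^2}}\tanh\frac{\sqrt{\xi^2+u_0(T,\xi)^2}}{2T}\,d\xi,\qquad T\ge 0,\ x\in I$$ (the $\tanh$ is replaced by $1$ at $T=0$), i.e. for each $T\ge0$ the function $u_0(T,\cdot)$ is a nonnegative continuous solution on $I$, and it is not identically zero whenever such a solution exists. Assume that $u_0(0,\cdot)$ is not identically zero, and let $T_c=\inf\{T>0:\ u_0(T,x)=0 \text{ for all } x\in I\}$. Put $$\Omega(T)=-2N_0\int_I\sqrt{x^2+u_0(T,x)^2}\,dx+N_0\int_I\frac{u_0(T,x)^2}{\sqrt{x^2+u_0(T,x)^2}}\tanh\frac{\sqrt{x^2+u_0(T,x)^2}}{2T}\,dx-4N_0T\int_I\ln\left(1+e^{-\sqrt{x^2+u_0(T,x)^2}/T}\right)dx,$$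 let $\Omega_N$ be the same expression with $u_0$ replaced by $0$ (the normal state), and let $S=-\Omega'$, $C_V=-T\,\Omega''$, $C_V^N=-T\,\Omega_N''$, $H_c=\sqrt{8\pi(\Omega_N-\Omega)}$. Derivatives at $T=0$ are one-sided. Write $E(\xi)=\sqrt{\xi^2+u_0(0,\xi)^2}$ and $E_g=\min_I E$. (1) $T_c>0$, and $\Omega$ is twice differentiable at every $T\in[0,T_c)$; so the entropy $S$ and the specific heat $C_V$ exist there. (2) $S(0)=C_V(0)=0$, and for $T>0$ the quantities $S$, $C_V$ and $u_0$ are approximated by $$\widetilde S(T)=\frac{4N_0}{T}\int_I E(\xi)e^{-E(\xi)/T}d\xi,\qquad \widetilde C(T)=\frac{4N_0}{T^2}\int_I E(\xi)^2e^{-E(\xi)/T}d\xi,$$ $$\widetilde u(T,x)=u_0(0,x)-2\int_I U(x,\xi)e^{-E(\xi)/T}d\xi$$ up to quantities of the form $(X/T)^n/\cosh(X/T)$: $E_g>0$, and for every $T_0\in(0,T_c)$ there is a constant $C$ such that for all $T\in(0,T_0]$ and $x\in I$ $$|S(T)-\widetilde S(T)|\le C\,\frac{(E_g/T)^2}{\cosh(E_g/T)},\qquad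 |C_V(T)-\widetilde C(T)|\le C\,\frac{(E_g/T)^3}{\cosh(E_g/T)},\qquad |u_0(T,x)-\widetilde u(T,x)|\le \frac{C}{\cosh(E_g/T)}.$$ If moreover $U(x,\xi)=U(\xi,x)$ on $I^2$, then $S(T)/\widetilde S(T)\to1$ and $C_V(T)/\widetilde C(T)\to1$ as $T\downarrow0$. (3) $\Omega_N$ is twice differentiable at $T_c$, $C_V^N(T_c)>0$, and $$\frac{H_c(0)^2}{T_c\,C_V^N(T_c)}=\frac{4\pi}{\displaystyle\int_{\varepsilon/(2T_c)}^{\hslash\omega_D/(2T_c)}\frac{\eta^2}{\cosh^2\eta}\,d\eta}\int_{\varepsilon/(2T_c)}^{\hslash\omega_D/(2T_c)}\frac{\left\{\sqrt{\eta^2+(2T_c)^{-2}u_0(0,2T_c\eta)^2}-\eta\right\}^2}{\sqrt{\eta^2+(2T_c)^{-2}u_0(0,2T_c\eta)^2}}\,d\eta .$$ -/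

import Mathlib

open Real Set Filter Topology Asymptotics
open scoped Interval

noncomputable section

/-- The quasi-particle energy `√(x² + Δ²)` at energy `x` with gap value `Δ`. -/
def qpEnergy (x Δ : ℝ) : ℝ := √(x ^ 2 + Δ ^ 2)

/-- The factor `tanh (E / (2T))`; at `T = 0` it is its limit `1` (for `E > 0`). -/
def thermalFactor (T E : ℝ) : ℝ := if T = 0 then 1 else tanh (E / (2 * T))

/-- `v` is a nonnegative continuous solution on `[ε, ω]` of the BCS-Bogoliubov gap equation with
potential `U` at the fixed temperature `T`, in the unit `k_B = 1`; `ω` stands for `ħω_D`. -/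
def IsGapSolutionAt (ε ω : ℝ) (U : ℝ → ℝ → ℝ) (T : ℝ) (v : ℝ → ℝ) : Prop :=
  ContinuousOn v (Icc ε ω) ∧ (∀ x ∈ Icc ε ω, 0 ≤ v x) ∧
    ∀ x ∈ Icc ε ω, v x = ∫ ξ in ε..ω,
      U x ξ * v ξ / qpEnergy ξ (v ξ) * thermalFactor T (qpEnergy ξ (v ξ))

/-- `u` is the solution of the BCS-Bogoliubov gap equation: at each temperature `T ≥ 0` it is a
nonnegative continuous solution, and it is the trivial solution `0` only if no other one exists. -/
def IsBCSSolution (ε ω : ℝ) (U : ℝ → ℝ → ℝ) (u : ℝ → ℝ → ℝ) : Prop :=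
  ∀ T, 0 ≤ T → IsGapSolutionAt ε ω U T (u T) ∧
    ((∃ v, IsGapSolutionAt ε ω U T v ∧ ∃ x ∈ Icc ε ω, v x ≠ 0) → ∃ x ∈ Icc ε ω, u T x ≠ 0)

/-- The transition temperature: the infimum of the temperatures at which the gap vanishes. -/
def transitionTemp (ε ω : ℝ) (u : ℝ → ℝ → ℝ) : ℝ :=
  sInf {T | 0 < T ∧ ∀ x ∈ Icc ε ω, u T x = 0}

/-- The thermodynamic potential `Ω` of the gap function `u`. -/
def thermoPotential (N₀ ε ω : ℝ) (u : ℝ → ℝ → ℝ) (T : ℝ) : ℝ :=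
  -2 * N₀ * (∫ x in ε..ω, qpEnergy x (u T x))
    + N₀ * (∫ x in ε..ω, u T x ^ 2 / qpEnergy x (u T x) * thermalFactor T (qpEnergy x (u T x)))
    - 4 * N₀ * T * (∫ x in ε..ω, log (1 + exp (-(qpEnergy x (u T x)) / T)))

/-- The thermodynamic potential of the normal conducting state, where the gap is `0`. -/
def normalPotential (N₀ ε ω : ℝ) (T : ℝ) : ℝ := thermoPotential N₀ ε ω (fun _ _ => 0) T

/-- The entropy `S = -∂Ω/∂T` (a one-sided derivative at `T = 0`). -/
def entropy (Ω : ℝ → ℝ) (T : ℝ) : ℝ := -derivWithin Ω (Ici 0) T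

/-- The specific heat `C_V = -T ∂²Ω/∂T²` at constant volume. -/
def specificHeat (Ω : ℝ → ℝ) (T : ℝ) : ℝ :=
  -T * derivWithin (derivWithin Ω (Ici 0)) (Ici 0) T

/-- `Ω` is twice differentiable at the temperature `T`, within `[0, ∞)`. -/
def TwiceDiffAt (Ω : ℝ → ℝ) (T : ℝ) : Prop :=
  (∀ᶠ t in 𝓝[Ici 0] T, DifferentiableWithinAt ℝ Ω (Ici 0) t) ∧
    DifferentiableWithinAt ℝ (derivWithin Ω (Ici 0)) (Ici 0) T

/-- The critical magnetic field: `H_c² / (8π)` is the excess of the normal potential. -/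
def criticalField (N₀ ε ω : ℝ) (u : ℝ → ℝ → ℝ) (T : ℝ) : ℝ :=
  √(8 * π * (normalPotential N₀ ε ω T - thermoPotential N₀ ε ω u T))

/-- The least quasi-particle energy at absolute zero temperature. -/
def energyGap (ε ω : ℝ) (u : ℝ → ℝ → ℝ) : ℝ :=
  sInf ((fun ξ => qpEnergy ξ (u 0 ξ)) '' Icc ε ω)

/-- The low temperature expression for the entropy. -/
def entropyApprox (N₀ ε ω : ℝ) (u : ℝ → ℝ → ℝ) (T : ℝ) : ℝ :=
  4 * N₀ / T * ∫ ξ in ε..ω, qpEnergy ξ (u 0 ξ) * exp (-(qpEnergy ξ (u 0 ξ)) / T)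

/-- The low temperature expression for the specific heat. -/
def specificHeatApprox (N₀ ε ω : ℝ) (u : ℝ → ℝ → ℝ) (T : ℝ) : ℝ :=
  4 * N₀ / T ^ 2 * ∫ ξ in ε..ω, (ξ ^ 2 + u 0 ξ ^ 2) * exp (-(qpEnergy ξ (u 0 ξ)) / T)

/-- The low temperature expression for the solution. -/
def solutionApprox (ε ω : ℝ) (U u : ℝ → ℝ → ℝ) (T x : ℝ) : ℝ :=
  u 0 x - 2 * ∫ ξ in ε..ω, U x ξ * exp (-(qpEnergy ξ (u 0 ξ)) / T)

/-- The quantity `(X / T)ⁿ / cosh (X / T)`, negligible at low temperature. -/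
def negligible (X : ℝ) (n : ℕ) (T : ℝ) : ℝ := (X / T) ^ n / cosh (X / T)

end

/-! Write b = 1/T and regard the gap equation as a fixed point problem v = L(g_b(v)) in C(I), where
L is the integral operator with the positive kernel U and g_b(v) is the superposition operator of y
↦ (y/E) tanh(bE/2), E = √(x² + y²). The decisive fact is strict sublinearity (`gapSlope_mul_le`): y
∂g_b/∂y ≤ (1 - δ) g_b, with one δ > 0 for all b ≥ 1/T₀, zero temperature included by a limit, as
long as y stays in a compact part of (0, ∞).

This is used in two ways. Nonlinearly, it gives a comparison of sub- and supersolutions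
(`ContinuousMap.comparison`): solutions decrease in T, depend continuously on T, and u(0) - u(T) is
controlled by 1 - tanh. Monotone iteration from y/2 and y, where y = u(0), also yields positive
solutions at small T, hence T_c > 0. Linearly, the solution u is itself a positive function with
L(slope · u) ≤ (1 - δ) u, so the linearised operator is a contraction in the sup norm weighted by
1/u. Hence it can be inverted with bounds uniform in b; by the implicit function theorem b ↦ u(1/b)
is smooth below T_c, and its derivatives are bounded by the inhomogeneities of the linearised
equations.

All these inhomogeneities carry a factor 1 - tanh²(bE/2) ≤ 4 exp(-bE). A first crude estimate with
rate ε shows that b(E(0) - E(T)) stays bounded, so exp(-bE(T)) may be replaced by a constant times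
exp(-bE_g) (`GapKernel.IsFamily.exists_bounds`).

For any smooth curve w of gap functions, with g = g_b(w), the potential density P satisfies b² dP/db
= b²(w g' - w' g) + 4 s(bE), where s is the entropy of a fermionic mode. The bounds then give S =
O(b² exp(-bE_g)) and C_V = O(b³ exp(-bE_g)), hence the two derivatives at T = 0. They also give the
error estimates, since each approximating expression is itself within the allowed error. If U is
symmetric, w = Lg makes the integral of w g' - w' g vanish, and s(bE(T)) is squeezed between
multiples of bE(0) exp(-bE(0)) with factors tending to 1; the specific heat is treated alike. The
critical field formula is the pointwise identity 2E - 2x - u²/E = (E - x)²/E followed by x = 2T_c η.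
-/

/-! ### Smoothness of superposition operators on C(K, ℝ). -/

section Superposition

open scoped ContDiff

variable {K : Type*} [TopologicalSpace K] [CompactSpace K]

/-- Composition with a continuously differentiable function is differentiable on `C(K, ℝ)`. -/
theorem ContinuousMap.hasFDerivAt_postcomp (g g' : C(ℝ, ℝ)) (hg : ∀ x, HasDerivAt g (g' x) x)
    (v : C(K, ℝ)) :
    HasFDerivAt (fun w : C(K, ℝ) => g.comp w) (ContinuousLinearMap.mul ℝ C(K, ℝ) (g'.comp v)) v := by
  rw [hasFDerivAt_iff_isLittleO_nhds_zero, isLittleO_iff]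
  intro η hη
  have hcont : Continuous (fun w : C(K, ℝ) => g'.comp w) := ContinuousMap.continuous_postcomp g'
  obtain ⟨ρ, hρ, h⟩ := Metric.continuous_iff.1 hcont v η hη
  filter_upwards [Metric.ball_mem_nhds (0 : C(K, ℝ)) hρ] with d hd
  have hd' : ‖d‖ < ρ := by simpa using hd
  refine (ContinuousMap.norm_le _ (by positivity)).2 fun k => ?_
  have hk := d.norm_coe_le_norm k
  have key := (convex_uIcc (v k) (v k + d k)).norm_image_sub_le_of_norm_hasDerivWithin_le
    (f := fun z => g z - g' (v k) * z) (f' := fun z => g' z - g' (v k)) (C := η)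
    (fun z _ => by simpa using ((hg z).fun_sub ((hasDerivAt_id' z).const_mul (g' (v k)))).hasDerivWithinAt)
    (fun z hz => by
      have hz' : |z - v k| ≤ |d k| := by
        have := abs_sub_left_of_mem_uIcc hz
        simpa using this
      -- Shifting `v` by the constant z - v k gives a uniformly close continuous map with value z at
      -- k, so continuity of w ↦ `g'.comp w` bounds |g' z - g' (v k)|, uniformly in k.
      have h1 := h (v + ContinuousMap.const K (z - v k)) (by
        rw [dist_eq_norm, add_sub_cancel_left]
        refine lt_of_le_of_lt ((ContinuousMap.norm_le _ (norm_nonneg d)).2 fun k' => ?_) hd'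
        exact hz'.trans hk)
      rw [dist_eq_norm] at h1
      have h2 := (ContinuousMap.norm_coe_le_norm _ k).trans h1.le
      simpa using h2)
    left_mem_uIcc right_mem_uIcc
  simp only [ContinuousMap.sub_apply, ContinuousMap.comp_apply, ContinuousMap.add_apply,
    ContinuousLinearMap.mul_apply', ContinuousMap.mul_apply]
  refine le_trans (le_of_eq ?_) (key.trans ?_)
  · congr 1; ring
  · simpa using mul_le_mul_of_nonneg_left hk hη.le

/-- Composition with a smooth function is smooth on `C(K, ℝ)`. -/
theorem ContinuousMap.contDiff_postcomp (g : C(ℝ, ℝ)) (hg : ContDiff ℝ ∞ g) :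
    ContDiff ℝ ∞ (fun w : C(K, ℝ) => g.comp w) := by
  rw [contDiff_infty]
  intro n
  induction n generalizing g with
  | zero => exact contDiff_zero.2 (ContinuousMap.continuous_postcomp g)
  | succ n ih =>
    have hg1 : ContDiff ℝ ∞ (deriv g) := (contDiff_infty_iff_deriv.1 hg).2
    let g' : C(ℝ, ℝ) := ⟨deriv g, hg1.continuous⟩
    have hd : ∀ x, HasDerivAt g (g' x) x := fun x =>
      ((hg.differentiable (by simp)) x).hasDerivAt
    refine contDiff_succ_iff_hasFDerivAt.2 ⟨fun v => ContinuousLinearMap.mul ℝ C(K, ℝ) (g'.comp v), ?_,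
      fun v => ContinuousMap.hasFDerivAt_postcomp g g' hd v⟩
    have hm : ContDiff ℝ n (fun w : C(K, ℝ) => ContinuousLinearMap.mul ℝ C(K, ℝ) w) :=
      ContinuousLinearMap.contDiff (E := C(K, ℝ)) (F := C(K, ℝ) →L[ℝ] C(K, ℝ)) _
    exact hm.comp (ih g' hg1)

end Superposition

/-! ### Concavity and exponential estimates for tanh. -/

section Tanh

theorem hasDerivAt_tanh' (x : ℝ) : HasDerivAt tanh (1 - tanh x ^ 2) x := by
  have h := (Real.hasDerivAt_sinh x).div (Real.hasDerivAt_cosh x) (cosh_pos x).ne'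
  have he : tanh = sinh / cosh := by ext y; simp [tanh_eq_sinh_div_cosh]
  rw [← he] at h
  refine h.congr_deriv ?_
  have := (cosh_pos x).ne'
  rw [tanh_eq_sinh_div_cosh]
  field_simp

theorem tanh_mono : Monotone tanh :=
  monotone_of_hasDerivAt_nonneg hasDerivAt_tanh' fun x => by
    have := tanh_sq_lt_one x
    simp only [Pi.zero_apply]; linarith

theorem tanh_nonneg_of_nonneg {x : ℝ} (hx : 0 ≤ x) : 0 ≤ tanh x := by
  simpa using tanh_mono hx

theorem tanh_pos_of_pos {x : ℝ} (hx : 0 < x) : 0 < tanh x := by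
  rw [tanh_eq_sinh_div_cosh]; exact div_pos (sinh_pos_iff.2 hx) (cosh_pos x)

theorem contDiff_tanh' {n : WithTop ℕ∞} : ContDiff ℝ n tanh := by
  have he : tanh = fun y => sinh y / cosh y := by ext y; simp [tanh_eq_sinh_div_cosh]
  rw [he]
  exact contDiff_sinh.div contDiff_cosh fun x => (cosh_pos x).ne'

theorem one_sub_tanh_sq (x : ℝ) : 1 - tanh x ^ 2 = 1 / cosh x ^ 2 := by
  have := (cosh_pos x).ne'
  have h2 := cosh_sq' x
  rw [tanh_eq_sinh_div_cosh]
  field_simp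
  linarith

/-- A quantitative form of concavity: x ≤ sinh x gives x / cosh² x ≤ tanh x / cosh x. The factor 1 /
cosh x₀, below 1 for x₀ > 0, is one source of the strictness in the sublinearity of the gap
equation. -/
theorem mul_one_sub_tanh_sq_le {x₀ x : ℝ} (h0 : 0 ≤ x₀) (hx : x₀ ≤ x) :
    x * (1 - tanh x ^ 2) ≤ tanh x * (1 / cosh x₀) := by
  have hc := cosh_pos x
  have hc0 := cosh_pos x₀
  have h1 : x ≤ sinh x := self_le_sinh_iff.2 (h0.trans hx)
  have h2 : cosh x₀ ≤ cosh x := cosh_le_cosh.2 (by rw [abs_of_nonneg h0, abs_of_nonneg (h0.trans hx)]; exact hx)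
  rw [one_sub_tanh_sq, tanh_eq_sinh_div_cosh, div_mul_div_comm, mul_one, mul_one_div,
    div_le_div_iff₀ (by positivity) (by positivity)]
  have : 0 ≤ sinh x := (h0.trans hx).trans h1
  calc x * (cosh x * cosh x₀) ≤ sinh x * (cosh x * cosh x) := by gcongr
    _ = _ := by ring

theorem mul_one_sub_tanh_sq_le_tanh {x : ℝ} (hx : 0 ≤ x) : x * (1 - tanh x ^ 2) ≤ tanh x := by
  simpa using mul_one_sub_tanh_sq_le le_rfl hx

theorem tanh_le_self {x : ℝ} (hx : 0 ≤ x) : tanh x ≤ x := by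
  have h : Monotone fun x => x - tanh x :=
    monotone_of_hasDerivAt_nonneg (fun y => (hasDerivAt_id' y).sub (hasDerivAt_tanh' y))
      fun y => by simp only [Pi.zero_apply]; nlinarith [sq_nonneg (tanh y)]
  simpa using h hx

/-- The difference of the two sides is increasing in l, by x tanh' x ≤ tanh x. With l a ratio of
temperatures it bounds the change of the thermal factor. -/
theorem tanh_mul_le {l x : ℝ} (hl : 1 ≤ l) (hx : 0 ≤ x) : tanh (l * x) ≤ l * tanh x := by
  have hd : ∀ y, HasDerivAt (fun l => l * tanh x - tanh (l * x))
      (tanh x - (1 - tanh (y * x) ^ 2) * x) y := fun y => by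
    have h1 := ((hasDerivAt_id' y).mul_const (tanh x))
    have h2 := (hasDerivAt_tanh' (y * x)).comp y ((hasDerivAt_id' y).mul_const x)
    simpa [Function.comp_def] using h1.fun_sub h2
  have hm : MonotoneOn (fun l => l * tanh x - tanh (l * x)) (Ici 1) := by
    refine monotoneOn_of_deriv_nonneg (convex_Ici 1)
      (fun y _ => (hd y).continuousAt.continuousWithinAt)
      (fun y _ => (hd y).differentiableAt.differentiableWithinAt) fun y hy => ?_
    rw [(hd y).deriv]
    rw [interior_Ici] at hy
    have hy : 1 ≤ y := le_of_lt hy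
    have h1 : tanh x ≤ tanh (y * x) := tanh_mono (by nlinarith)
    have h0 := tanh_nonneg_of_nonneg hx
    have := mul_one_sub_tanh_sq_le_tanh hx
    nlinarith [mul_le_mul h1 h1 h0 (h0.trans h1)]
  have := hm (mem_Ici.2 le_rfl) (mem_Ici.2 hl) hl
  simp at this
  linarith

theorem tanh_eq_exp (x : ℝ) : tanh x = (1 - exp (-2 * x)) / (1 + exp (-2 * x)) := by
  rw [tanh_eq]
  have h : exp (-2 * x) = exp (-x) * exp (-x) := by rw [← exp_add]; ring_nf
  have h2 : exp x * exp (-x) = 1 := by rw [← exp_add]; simp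
  have := exp_pos x
  have := exp_pos (-x)
  rw [h, div_eq_div_iff (by positivity) (by positivity)]
  linear_combination (2 * exp (-x)) * h2

theorem one_sub_tanh_sq_le_exp (x : ℝ) : 1 - tanh x ^ 2 ≤ 4 * exp (-2 * x) := by
  have := exp_pos (-2 * x)
  rw [tanh_eq_exp, div_pow, one_sub_div (by positivity), div_le_iff₀ (by positivity)]
  nlinarith [sq_nonneg (exp (-2 * x))]

theorem one_sub_tanh_sq_nonneg (x : ℝ) : 0 ≤ 1 - tanh x ^ 2 := by
  have := tanh_sq_lt_one x; linarith

/-- With z = exp(-2x) one has 1 / tanh x = 1 + 2z / (1 - z), and 1 - z is bounded below by its value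
at x₀. This compares zero temperature with low temperature. -/
theorem one_le_mul_tanh {x₀ x : ℝ} (h0 : 0 < x₀) (hx : x₀ ≤ x) :
    1 ≤ (1 + 2 / (1 - exp (-2 * x₀)) * exp (-2 * x)) * tanh x := by
  have h1 : exp (-2 * x) ≤ exp (-2 * x₀) := exp_le_exp.2 (by linarith)
  have h2 : exp (-2 * x₀) < 1 := Real.exp_lt_one_iff.2 (by linarith)
  have h3 := exp_pos (-2 * x)
  have h4 : 0 < 1 - exp (-2 * x) := by linarith
  have h5 : 1 + 2 / (1 - exp (-2 * x)) * exp (-2 * x) ≤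
      1 + 2 / (1 - exp (-2 * x₀)) * exp (-2 * x) := by
    have : 0 < 1 - exp (-2 * x₀) := by linarith
    gcongr
  have h6 : 0 ≤ tanh x := tanh_nonneg_of_nonneg (by linarith)
  refine le_trans (le_of_eq ?_) (mul_le_mul_of_nonneg_right h5 h6)
  rw [tanh_eq_exp]
  generalize exp (-2 * x) = z at h3 h4
  have := h4.ne'
  field_simp
  ring

end Tanh

/-! ### The scalar nonlinearity of the gap equation and its derivatives. -/

section Scalar

theorem qpEnergy_pos {x : ℝ} (hx : 0 < x) (y : ℝ) : 0 < qpEnergy x y :=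
  Real.sqrt_pos.2 (by positivity)

theorem qpEnergy_sq (x y : ℝ) : qpEnergy x y ^ 2 = x ^ 2 + y ^ 2 := Real.sq_sqrt (by positivity)

theorem le_qpEnergy (x y : ℝ) : x ≤ qpEnergy x y :=
  Real.le_sqrt_of_sq_le (by nlinarith [sq_nonneg y])

theorem le_qpEnergy_right (x y : ℝ) : y ≤ qpEnergy x y :=
  Real.le_sqrt_of_sq_le (by nlinarith [sq_nonneg x])

theorem qpEnergy_mono (x : ℝ) {y z : ℝ} (hy : 0 ≤ y) (h : y ≤ z) : qpEnergy x y ≤ qpEnergy x z :=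
  Real.sqrt_le_sqrt (by gcongr)

theorem qpEnergy_sub_le (x : ℝ) {y z : ℝ} (hx : 0 < x) (hy : 0 ≤ y) (h : y ≤ z) :
    qpEnergy x z - qpEnergy x y ≤ z - y := by
  have h1 := qpEnergy_sq x y
  have h2 := qpEnergy_sq x z
  have h3 := le_qpEnergy_right x y
  have h4 := le_qpEnergy_right x z
  have h5 := qpEnergy_pos hx y
  have h6 := qpEnergy_mono x hy h
  by_contra! hlt
  nlinarith

theorem qpEnergy_zero {x : ℝ} (hx : 0 ≤ x) : qpEnergy x 0 = x := by
  simp [qpEnergy, Real.sqrt_sq hx]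

theorem thermalFactor_of_pos {T : ℝ} (hT : 0 < T) (E : ℝ) :
    thermalFactor T E = tanh (T⁻¹ * E / 2) := by
  rw [thermalFactor, if_neg hT.ne']; congr 1; field_simp

theorem thermalFactor_pos {T E : ℝ} (hT : 0 ≤ T) (hE : 0 < E) : 0 < thermalFactor T E := by
  rw [thermalFactor]; split_ifs with h
  · exact one_pos
  · exact tanh_pos_of_pos (by have := lt_of_le_of_ne hT (Ne.symm h); positivity)

theorem thermalFactor_le_one (T E : ℝ) : thermalFactor T E ≤ 1 := by
  rw [thermalFactor]; split_ifs with h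
  · exact le_rfl
  · exact (tanh_lt_one _).le

theorem thermalFactor_anti {s t E : ℝ} (hs : 0 ≤ s) (hst : s ≤ t) (hE : 0 ≤ E) :
    thermalFactor t E ≤ thermalFactor s E := by
  rcases hs.eq_or_lt with rfl | hs'
  · simpa [thermalFactor] using thermalFactor_le_one t E
  · rw [thermalFactor, thermalFactor, if_neg hs'.ne', if_neg (hs'.trans_le hst).ne']
    exact tanh_mono (by gcongr)

theorem thermalFactor_le_mul {s t E : ℝ} (hs : 0 < s) (hst : s ≤ t) (hE : 0 ≤ E) :
    thermalFactor s E ≤ (1 + (t / s - 1)) * thermalFactor t E := by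
  have ht := hs.trans_le hst
  rw [thermalFactor, thermalFactor, if_neg hs.ne', if_neg ht.ne', add_sub_cancel]
  have := tanh_mul_le (l := t / s) (x := E / (2 * t)) (by rwa [le_div_iff₀ hs, one_mul])
    (by positivity)
  convert this using 2
  field_simp

theorem hasDerivAt_qpEnergy {x : ℝ} (hx : 0 < x) {y : ℝ → ℝ} {y' t : ℝ} (hy : HasDerivAt y y' t) :
    HasDerivAt (fun s => qpEnergy x (y s)) (y t / qpEnergy x (y t) * y') t := by
  have h := ((hy.fun_pow 2).const_add (x ^ 2)).sqrt (by positivity)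
  refine h.congr_deriv ?_
  have := (qpEnergy_pos hx (y t)).ne'
  simp only [qpEnergy] at *
  simp
  field_simp

theorem hasDerivAt_div_qpEnergy {x : ℝ} (hx : 0 < x) {y : ℝ → ℝ} {y' t : ℝ}
    (hy : HasDerivAt y y' t) :
    HasDerivAt (fun s => y s / qpEnergy x (y s)) (x ^ 2 / qpEnergy x (y t) ^ 3 * y') t := by
  have h0 := (qpEnergy_pos hx (y t)).ne'
  have h := hy.div (hasDerivAt_qpEnergy hx hy) h0
  refine h.congr_deriv ?_
  have h2 := qpEnergy_sq x (y t)
  field_simp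
  rw [h2]; ring

theorem hasDerivAt_tanh_qpEnergy {x : ℝ} (hx : 0 < x) {b y : ℝ → ℝ} {b' y' t : ℝ}
    (hb : HasDerivAt b b' t) (hy : HasDerivAt y y' t) :
    HasDerivAt (fun s => tanh (b s * qpEnergy x (y s) / 2))
      ((1 - tanh (b t * qpEnergy x (y t) / 2) ^ 2) *
        (b' * qpEnergy x (y t) + b t * (y t / qpEnergy x (y t) * y')) / 2) t := by
  have h := (hasDerivAt_tanh' (b t * qpEnergy x (y t) / 2)).comp t
    ((hb.mul (hasDerivAt_qpEnergy hx hy)).div_const 2)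
  exact h.congr_deriv (by ring)

/-- The integrand of the gap equation at inverse temperature `b`, without the potential. -/
noncomputable def gapFun (b x y : ℝ) : ℝ := y / qpEnergy x y * tanh (b * qpEnergy x y / 2)

/-- The derivative of `gapFun` along a curve with velocity `(b', y')`. -/
noncomputable def gapFunDeriv (b x y b' y' : ℝ) : ℝ :=
  x ^ 2 / qpEnergy x y ^ 3 * y' * tanh (b * qpEnergy x y / 2) +
    y / qpEnergy x y * ((1 - tanh (b * qpEnergy x y / 2) ^ 2) *
        (b' * qpEnergy x y + b * (y / qpEnergy x y * y')) / 2)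

/-- The derivative of `gapFun` with respect to the gap value. -/
noncomputable def gapSlope (b x y : ℝ) : ℝ :=
  x ^ 2 / qpEnergy x y ^ 3 * tanh (b * qpEnergy x y / 2) +
    y / qpEnergy x y * ((1 - tanh (b * qpEnergy x y / 2) ^ 2) * (b * (y / qpEnergy x y)) / 2)

/-- The part of the second derivative of `gapFun` along `b ↦ (b, y b)` without second derivatives
of `y`. -/
noncomputable def gapFunRem (b x y y' : ℝ) : ℝ :=
  -(3 * x ^ 2 / qpEnergy x y ^ 4 * (y / qpEnergy x y * y') * y' * tanh (b * qpEnergy x y / 2)) +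
    2 * (x ^ 2 / qpEnergy x y ^ 3 * y') * ((1 - tanh (b * qpEnergy x y / 2) ^ 2) *
        (qpEnergy x y + b * (y / qpEnergy x y * y')) / 2) +
    y / qpEnergy x y * ((1 - tanh (b * qpEnergy x y / 2) ^ 2) *
      (2 * (y / qpEnergy x y * y') + b * (x ^ 2 / qpEnergy x y ^ 3 * y' * y')) / 2 -
      tanh (b * qpEnergy x y / 2) * (1 - tanh (b * qpEnergy x y / 2) ^ 2) *
        (qpEnergy x y + b * (y / qpEnergy x y * y')) ^ 2 / 2)

theorem hasDerivAt_gapFun {x : ℝ} (hx : 0 < x) {b y : ℝ → ℝ} {b' y' t : ℝ}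
    (hb : HasDerivAt b b' t) (hy : HasDerivAt y y' t) :
    HasDerivAt (fun s => gapFun (b s) x (y s)) (gapFunDeriv (b t) x (y t) b' y') t :=
  (hasDerivAt_div_qpEnergy hx hy).mul (hasDerivAt_tanh_qpEnergy hx hb hy)

theorem gapFunDeriv_eq (b x y b' y' : ℝ) : gapFunDeriv b x y b' y' =
    gapSlope b x y * y' +
      y / qpEnergy x y * ((1 - tanh (b * qpEnergy x y / 2) ^ 2) * (b' * qpEnergy x y) / 2) := by
  unfold gapFunDeriv gapSlope; ring

/-- The coefficient of y₂ is the same slope as that of y' in `gapFunDeriv_eq`; thus first and second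
derivatives of the solution obey one and the same linearised equation, with different
inhomogeneities. -/
theorem hasDerivAt_gapFunDeriv {x : ℝ} (hx : 0 < x) {y y₁ : ℝ → ℝ} {y₂ t : ℝ}
    (hy : HasDerivAt y (y₁ t) t) (hy₁ : HasDerivAt y₁ y₂ t) :
    HasDerivAt (fun s => gapFunDeriv s x (y s) 1 (y₁ s))
      (gapSlope t x (y t) * y₂ + gapFunRem t x (y t) (y₁ t)) t := by
  have h0 := (qpEnergy_pos hx (y t)).ne'
  have hE := hasDerivAt_qpEnergy hx hy
  have hρ := hasDerivAt_div_qpEnergy hx hy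
  have hτ := hasDerivAt_tanh_qpEnergy hx (hasDerivAt_id' t) hy
  have hρ₁ := (((hasDerivAt_const t (x ^ 2)).fun_div (hE.fun_pow 3) (pow_ne_zero 3 h0)).fun_mul hy₁)
  have h := (hρ₁.fun_mul hτ).fun_add (hρ.fun_mul ((((hτ.fun_pow 2).const_sub 1).fun_mul
    ((hE.const_mul 1).fun_add ((hasDerivAt_id' t).fun_mul (hρ.fun_mul hy₁)))).div_const 2))
  refine h.congr_deriv ?_
  unfold gapSlope gapFunRem
  field_simp
  ring

end Scalar

/-! ### Monotonicity and strict sublinearity of the nonlinearity. -/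

section Sublinear

/-- The integrand of the gap equation at temperature `T ≥ 0`, without the potential. -/
noncomputable def gapFunT (T x y : ℝ) : ℝ := y / qpEnergy x y * thermalFactor T (qpEnergy x y)

theorem gapFunT_of_pos {T : ℝ} (hT : 0 < T) (x y : ℝ) : gapFunT T x y = gapFun T⁻¹ x y := by
  rw [gapFunT, gapFun, thermalFactor_of_pos hT]

theorem gapFunT_zero (x y : ℝ) : gapFunT 0 x y = y / qpEnergy x y := by
  simp [gapFunT, thermalFactor]

theorem tendsto_tanh_atTop : Tendsto tanh atTop (𝓝 1) := by
  have h : Tendsto (fun x : ℝ => exp (-2 * x)) atTop (𝓝 0) :=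
    tendsto_exp_atBot.comp (tendsto_id.const_mul_atTop_of_neg (by norm_num))
  have h2 := (h.const_sub 1).div (h.const_add 1) (by norm_num)
  simp only [sub_zero, add_zero, div_one] at h2
  exact h2.congr fun x => (tanh_eq_exp x).symm

theorem div_qpEnergy_mono {x : ℝ} (hx : 0 < x) : Monotone fun y => y / qpEnergy x y :=
  monotone_of_hasDerivAt_nonneg (fun y => hasDerivAt_div_qpEnergy hx (hasDerivAt_id' y)) fun y => by
    have := qpEnergy_pos hx y
    simp only [Pi.zero_apply]; positivity

theorem div_qpEnergy_le_one {x : ℝ} (hx : 0 < x) (y : ℝ) : y / qpEnergy x y ≤ 1 :=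
  (div_le_one (qpEnergy_pos hx y)).2 (le_qpEnergy_right x y)

theorem thermalFactor_mono {T : ℝ} (hT : 0 ≤ T) : Monotone (thermalFactor T) := fun a b hab => by
  rw [thermalFactor, thermalFactor]
  split_ifs
  · exact le_rfl
  · exact tanh_mono (by gcongr)

theorem gapFunT_mono {T x y z : ℝ} (hT : 0 ≤ T) (hx : 0 < x) (hy : 0 ≤ y) (h : y ≤ z) :
    gapFunT T x y ≤ gapFunT T x z :=
  mul_le_mul (div_qpEnergy_mono hx h) (thermalFactor_mono hT (qpEnergy_mono x hy h))
    (thermalFactor_pos hT (qpEnergy_pos hx y)).le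
    (div_nonneg (hy.trans h) (qpEnergy_pos hx z).le)

theorem gapFunT_nonneg {T x y : ℝ} (hT : 0 ≤ T) (hx : 0 < x) (hy : 0 ≤ y) : 0 ≤ gapFunT T x y :=
  mul_nonneg (div_nonneg hy (qpEnergy_pos hx y).le) (thermalFactor_pos hT (qpEnergy_pos hx y)).le

theorem gapFunT_pos {T x y : ℝ} (hT : 0 ≤ T) (hx : 0 < x) (hy : 0 < y) : 0 < gapFunT T x y :=
  mul_pos (div_pos hy (qpEnergy_pos hx y)) (thermalFactor_pos hT (qpEnergy_pos hx y))

theorem gapFunT_anti {s t x y : ℝ} (hs : 0 ≤ s) (hst : s ≤ t) (hx : 0 < x) (hy : 0 ≤ y) :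
    gapFunT t x y ≤ gapFunT s x y :=
  mul_le_mul_of_nonneg_left (thermalFactor_anti hs hst (qpEnergy_pos hx y).le)
    (div_nonneg hy (qpEnergy_pos hx y).le)

theorem gapSlope_nonneg {b x y : ℝ} (hb : 0 ≤ b) (hx : 0 < x) (hy : 0 ≤ y) :
    0 ≤ gapSlope b x y := by
  have h1 := qpEnergy_pos hx y
  have h2 : 0 ≤ tanh (b * qpEnergy x y / 2) := tanh_nonneg_of_nonneg (by positivity)
  have h3 := one_sub_tanh_sq_nonneg (b * qpEnergy x y / 2)
  unfold gapSlope
  positivity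

/-- The constant measuring the strict sublinearity of `gapFun`. -/
noncomputable def sublinConst (ε ω c M b₀ : ℝ) : ℝ :=
  c ^ 2 / (ω ^ 2 + M ^ 2) * (1 - 1 / cosh (b₀ * ε / 2))

section

variable {ε ω c M b₀ : ℝ} (hε : 0 < ε) (hω : ε ≤ ω) (hc : 0 < c) (hM : c ≤ M) (hb₀ : 0 < b₀)
include hε hω hc hM hb₀

theorem sublinConst_pos : 0 < sublinConst ε ω c M b₀ := by
  have h1 : 1 < cosh (b₀ * ε / 2) := one_lt_cosh.2 (by positivity)
  have h2 : 1 / cosh (b₀ * ε / 2) < 1 := (div_lt_one (by linarith)).2 h1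
  have h3 : 0 < ω := hε.trans_le hω
  exact mul_pos (by positivity) (by linarith)

theorem sublinConst_lt_one : sublinConst ε ω c M b₀ < 1 := by
  have h1 := cosh_pos (b₀ * ε / 2)
  have h3 : 0 < ω := hε.trans_le hω
  have h4 : c ^ 2 / (ω ^ 2 + M ^ 2) < 1 := (div_lt_one (by positivity)).2 (by nlinarith)
  have h5 : 0 < 1 / cosh (b₀ * ε / 2) := by positivity
  have h6 : 0 < c ^ 2 / (ω ^ 2 + M ^ 2) := by positivity
  have := sublinConst_pos hε hω hc hM hb₀
  unfold sublinConst at *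
  nlinarith

/-- With ρ = y/e, τ = tanh(be/2), κ = 1/cosh(b₀ε/2), the left side is ρ((1 - ρ²)τ + ρ²(be/2)(1 -
τ²)), and (be/2)(1 - τ²) ≤ κτ. Hence it is at most (1 - ρ²(1 - κ)) ρτ, and ρ² ≥ c²/(ω² + M²) gives
`sublinConst`. -/
theorem gapSlope_mul_le {b x y : ℝ} (hb : b₀ ≤ b) (hεx : ε ≤ x) (hxω : x ≤ ω) (hcy : c ≤ y)
    (hyM : y ≤ M) :
    gapSlope b x y * y ≤ (1 - sublinConst ε ω c M b₀) * gapFun b x y := by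
  have hx : 0 < x := hε.trans_le hεx
  have hy : 0 < y := hc.trans_le hcy
  have he := qpEnergy_pos hx y
  have he2 := qpEnergy_sq x y
  have hxe := le_qpEnergy x y
  unfold gapSlope gapFun sublinConst
  set e := qpEnergy x y
  have hκ := mul_one_sub_tanh_sq_le (x₀ := b₀ * ε / 2) (x := b * e / 2) (by positivity)
    (by have : ε ≤ e := hεx.trans hxe
        have := hb₀.le.trans hb
        gcongr)
  have hτ : 0 ≤ tanh (b * e / 2) := tanh_nonneg_of_nonneg (by
    have := hb₀.trans_le hb; positivity)
  set τ := tanh (b * e / 2)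
  have hκ1 : 1 / cosh (b₀ * ε / 2) ≤ 1 := (div_le_one (cosh_pos _)).2 (one_le_cosh _)
  set κ := 1 / cosh (b₀ * ε / 2)
  have hρ : c ^ 2 / (ω ^ 2 + M ^ 2) ≤ (y / e) ^ 2 := by
    rw [div_pow, he2]
    have : 0 < ω := hx.trans_le hxω
    gcongr
  set q := c ^ 2 / (ω ^ 2 + M ^ 2)
  have hx2 : x ^ 2 / e ^ 2 = 1 - (y / e) ^ 2 := by
    field_simp; linarith
  have hρ0 : 0 < y / e := div_pos hy he
  calc _ = (y / e) * (x ^ 2 / e ^ 2 * τ + (y / e) ^ 2 * (b * e / 2 * (1 - τ ^ 2))) := by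
        field_simp
    _ ≤ (y / e) * (x ^ 2 / e ^ 2 * τ + (y / e) ^ 2 * (τ * κ)) := by gcongr
    _ = (1 - (y / e) ^ 2 * (1 - κ)) * (y / e * τ) := by rw [hx2]; ring
    _ ≤ _ := by
        have : q * (1 - κ) ≤ (y / e) ^ 2 * (1 - κ) := mul_le_mul_of_nonneg_right hρ (by linarith)
        gcongr

/-- Integration of the slope bound along the ray s ↦ s y: dividing by 1 + (1 - d)(s - 1), which is
at most s, yields an antitone function on [1, r]. -/
theorem gapFun_mul_le {b x y r : ℝ} (hb : b₀ ≤ b) (hεx : ε ≤ x) (hxω : x ≤ ω) (hcy : c ≤ y)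
    (hr : 1 ≤ r) (hyM : r * y ≤ M) :
    gapFun b x (r * y) ≤ (1 + (1 - sublinConst ε ω c M b₀) * (r - 1)) * gapFun b x y := by
  have hx : 0 < x := hε.trans_le hεx
  have hy : 0 < y := hc.trans_le hcy
  have hd0 := sublinConst_pos hε hω hc hM hb₀
  have hd1 := sublinConst_lt_one hε hω hc hM hb₀
  have hm : ∀ s ∈ Icc 1 r, gapSlope b x (s * y) * (s * y) ≤
      (1 - sublinConst ε ω c M b₀) * gapFun b x (s * y) := fun s hs =>
    gapSlope_mul_le hε hω hc hM hb₀ hb hεx hxω (by nlinarith [hs.1]) (by nlinarith [hs.2])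
  set d := sublinConst ε ω c M b₀
  have hpos : ∀ s ∈ Icc 1 r, 0 < 1 + (1 - d) * (s - 1) := fun s hs => by nlinarith [hs.1]
  have hder : ∀ s ∈ Icc 1 r, HasDerivAt (fun s => gapFun b x (s * y) / (1 + (1 - d) * (s - 1)))
      ((gapSlope b x (s * y) * y * (1 + (1 - d) * (s - 1)) - gapFun b x (s * y) * (1 - d)) /
        (1 + (1 - d) * (s - 1)) ^ 2) s := fun s hs => by
    have h1 := hasDerivAt_gapFun hx (hasDerivAt_const s b) ((hasDerivAt_id' s).mul_const y)
    rw [gapFunDeriv_eq] at h1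
    have h2 := (((hasDerivAt_id' s).sub_const 1).const_mul (1 - d)).const_add 1
    refine (h1.fun_div h2 (hpos s hs).ne').congr_deriv ?_
    simp
  have hanti : AntitoneOn (fun s => gapFun b x (s * y) / (1 + (1 - d) * (s - 1))) (Icc 1 r) := by
    refine antitoneOn_of_deriv_nonpos (convex_Icc 1 r)
      (fun s hs => (hder s hs).continuousAt.continuousWithinAt)
      (fun s hs => (hder s (interior_subset hs)).differentiableAt.differentiableWithinAt)
      fun s hs => ?_
    have hs := interior_subset hs
    rw [(hder s hs).deriv]
    refine div_nonpos_of_nonpos_of_nonneg ?_ (sq_nonneg _)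
    have h1 := hm s hs
    have hs0 : 0 < s := by linarith [hs.1]
    have h3 : 0 ≤ gapSlope b x (s * y) := gapSlope_nonneg (hb₀.le.trans hb) hx (by positivity)
    have h4 : 1 + (1 - d) * (s - 1) ≤ s := by nlinarith [hs.1]
    have h5 : gapSlope b x (s * y) * y * (1 + (1 - d) * (s - 1)) ≤ gapSlope b x (s * y) * y * s := by
      gcongr
    linarith
  have := hanti (left_mem_Icc.2 hr) (right_mem_Icc.2 hr) hr
  simp only [one_mul, sub_self, mul_zero, add_zero, div_one] at this
  rw [div_le_iff₀ (hpos r (right_mem_Icc.2 hr))] at this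
  linarith

end

/-- The constant depends only on the lower bound 1/T₀ for b, so T = 0 follows by letting b → ∞. -/
theorem gapFunT_mul_le {ε ω c M T₀ T x y r : ℝ} (hε : 0 < ε) (hω : ε ≤ ω) (hc : 0 < c) (hM : c ≤ M)
    (hT₀ : 0 < T₀) (hT : 0 ≤ T) (hTT₀ : T ≤ T₀) (hεx : ε ≤ x) (hxω : x ≤ ω) (hcy : c ≤ y)
    (hr : 1 ≤ r) (hyM : r * y ≤ M) :
    gapFunT T x (r * y) ≤ (1 + (1 - sublinConst ε ω c M T₀⁻¹) * (r - 1)) * gapFunT T x y := by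
  have hx : 0 < x := hε.trans_le hεx
  have hb₀ := inv_pos.2 hT₀
  rcases hT.eq_or_lt with rfl | hT'
  · have hlim : ∀ z, Tendsto (fun b => gapFun b x z) atTop (𝓝 (gapFunT 0 x z)) := fun z => by
      rw [gapFunT_zero]
      have h1 : Tendsto (fun b => b * qpEnergy x z / 2) atTop atTop :=
        (tendsto_id.atTop_mul_const (qpEnergy_pos hx z)).atTop_div_const (by norm_num)
      simpa [gapFun] using (tendsto_tanh_atTop.comp h1).const_mul (z / qpEnergy x z)
    refine le_of_tendsto_of_tendsto (hlim _) ((hlim _).const_mul _) ?_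
    filter_upwards [eventually_ge_atTop T₀⁻¹] with b hb
    exact gapFun_mul_le hε hω hc hM hb₀ hb hεx hxω hcy hr hyM
  · rw [gapFunT_of_pos hT', gapFunT_of_pos hT']
    exact gapFun_mul_le hε hω hc hM hb₀ (by gcongr) hεx hxω hcy hr hyM

end Sublinear

/-! ### Comparison principle and weighted contraction for positive operators on C(K, ℝ). -/

section Comparison

variable {K : Type*} [TopologicalSpace K] [CompactSpace K]

omit [CompactSpace K] in
theorem ContinuousMap.map_mono_of_nonneg {L : C(K, ℝ) →L[ℝ] C(K, ℝ)} (hL : ∀ g, 0 ≤ g → 0 ≤ L g)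
    {a b : C(K, ℝ)} (h : a ≤ b) : L a ≤ L b := by
  have := hL (b - a) (sub_nonneg.2 h)
  rwa [map_sub, sub_nonneg] at this

/-- Comparison of a subsolution `v` and a supersolution `w` of a sublinear positive equation. -/
theorem ContinuousMap.comparison {L : C(K, ℝ) →L[ℝ] C(K, ℝ)} (hL : ∀ g, 0 ≤ g → 0 ≤ L g)
    {v w a b : C(K, ℝ)} {δ η R : ℝ} (hv : v ≤ L a) (hw : L b ≤ w) (hw0 : 0 ≤ w)
    (hδ : 0 < δ) (hδ1 : δ < 1) (hη : 0 ≤ η) (hR : 1 ≤ R) (hvR : v ≤ R • w)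
    (h : ∀ r, 1 ≤ r → r ≤ R → v ≤ r • w → a ≤ ((1 + (1 - δ) * (r - 1)) * (1 + η)) • b) :
    v ≤ (1 + η * R / δ) • w := by
  -- Take the least r ≥ 1 with v ≤ r w. The hypothesis improves r to (1 + (1 - δ)(r - 1))(1 + η), so
  -- minimality gives r ≤ this value; solving for r bounds it by 1 + η R / δ.
  set S : Set ℝ := {r | 1 ≤ r ∧ v ≤ r • w} with hS
  have hclosed : IsClosed S := by
    have : S = Ici 1 ∩ ⋂ k, {r | v k ≤ r * w k} := by
      ext r; simp [hS, ContinuousMap.le_def]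
    rw [this]
    exact isClosed_Ici.inter (isClosed_iInter fun k =>
      isClosed_le continuous_const (continuous_id.mul continuous_const))
  have hbdd : BddBelow S := ⟨1, fun r hr => hr.1⟩
  have hmem : sInf S ∈ S := hclosed.csInf_mem ⟨R, hR, hvR⟩ hbdd
  set r := sInf S with hr
  have hrR : r ≤ R := csInf_le hbdd ⟨hR, hvR⟩
  have hr1 : 1 ≤ r := hmem.1
  have hd : 0 ≤ 1 + (1 - δ) * (r - 1) := by nlinarith
  have hle : v ≤ ((1 + (1 - δ) * (r - 1)) * (1 + η)) • w := by
    have h1 := ContinuousMap.map_mono_of_nonneg hL (h r hr1 hrR hmem.2)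
    rw [map_smul] at h1
    refine hv.trans (h1.trans ?_)
    rw [ContinuousMap.le_def]
    intro k
    exact mul_le_mul_of_nonneg_left (hw k) (by positivity)
  have hr2 : r ≤ (1 + (1 - δ) * (r - 1)) * (1 + η) := csInf_le hbdd ⟨by nlinarith, hle⟩
  have hr3 : r ≤ 1 + η * R / δ := by
    have : η * (1 + (1 - δ) * (r - 1)) ≤ η * R := by gcongr; nlinarith
    have : δ * (r - 1) ≤ η * R := by linarith
    have : r - 1 ≤ η * R / δ := by rw [le_div_iff₀ hδ]; linarith
    linarith
  refine hmem.2.trans fun k => ?_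
  exact mul_le_mul_of_nonneg_right hr3 (hw0 k)

theorem ContinuousMap.abs_map_mul_le {L : C(K, ℝ) →L[ℝ] C(K, ℝ)} (hL : ∀ g, 0 ≤ g → 0 ≤ L g)
    {m p w : C(K, ℝ)} {q N : ℝ} (hm : 0 ≤ m) (hN : 0 ≤ N) (hLp : L (m * p) ≤ q • p)
    (hw : ∀ k, |w k| ≤ N * p k) (k : K) : |L (m * w) k| ≤ N * q * p k := by
  have hm' : ∀ i, 0 ≤ m i := hm
  have ha : m * w ≤ N • (m * p) := ContinuousMap.le_def.2 fun i => by
    have := mul_le_mul_of_nonneg_left ((le_abs_self _).trans (hw i)) (hm' i)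
    simp only [ContinuousMap.mul_apply, ContinuousMap.smul_apply, smul_eq_mul]
    linarith
  have hb : -(N • (m * p)) ≤ m * w := ContinuousMap.le_def.2 fun i => by
    have := mul_le_mul_of_nonneg_left ((neg_le_abs _).trans (hw i)) (hm' i)
    simp only [ContinuousMap.mul_apply, ContinuousMap.smul_apply, smul_eq_mul,
      ContinuousMap.neg_apply]
    linarith
  have ha' := ContinuousMap.le_def.1 (ContinuousMap.map_mono_of_nonneg hL ha) k
  have hb' := ContinuousMap.le_def.1 (ContinuousMap.map_mono_of_nonneg hL hb) k
  have hc' := mul_le_mul_of_nonneg_left (ContinuousMap.le_def.1 hLp k) hN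
  simp only [map_neg, map_smul, ContinuousMap.smul_apply, ContinuousMap.neg_apply,
    smul_eq_mul] at ha' hb' hc'
  rw [abs_le]; constructor <;> linarith

variable {L : C(K, ℝ) →L[ℝ] C(K, ℝ)} (hL : ∀ g, 0 ≤ g → 0 ≤ L g) {m p : C(K, ℝ)} {q c M : ℝ}
  (hm : 0 ≤ m) (hq : q < 1) (hc : 0 < c) (hcp : ∀ k, c ≤ p k) (hp : ∀ k, p k ≤ M)
  (hLp : L (m * p) ≤ q • p)
include hL hm hq hc hcp hp hLp

/-- In the norm sup |w|/p the operator w ↦ L(m w) contracts by q, so w is bounded by h / (1 - q);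
the factor M / c is the price of returning to the sup norm. -/
theorem ContinuousMap.norm_le_of_eq_add {w h : C(K, ℝ)} (hw : w = L (m * w) + h) :
    ‖w‖ ≤ M / (c * (1 - q)) * ‖h‖ := by
  rcases isEmpty_or_nonempty K with hK | ⟨⟨k₀⟩⟩
  · have : ∀ g : C(K, ℝ), ‖g‖ = 0 := fun g => by
      have : g = 0 := by ext k; exact hK.elim k
      simp [this]
    simp [this]
  have hM : 0 < M := hc.trans_le ((hcp k₀).trans (hp k₀))
  let pi : C(K, ℝ) := ⟨fun k => (p k)⁻¹, p.continuous.inv₀ fun k => (hc.trans_le (hcp k)).ne'⟩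
  have hpk : ∀ k, 0 < p k := fun k => hc.trans_le (hcp k)
  set N := ‖w * pi‖
  have hN : ∀ k, |w k| ≤ N * p k := fun k => by
    have := (w * pi).norm_coe_le_norm k
    simp only [ContinuousMap.mul_apply, ContinuousMap.coe_mk, norm_mul, norm_inv, Real.norm_eq_abs,
      abs_of_pos (hpk k), pi] at this
    rwa [← div_eq_mul_inv, div_le_iff₀ (hpk k)] at this
  have hN0 : 0 ≤ N := norm_nonneg _
  have h1 : ∀ k, |L (m * w) k| ≤ N * q * p k :=
    ContinuousMap.abs_map_mul_le hL hm hN0 hLp hN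
  have h2 : N ≤ N * q + ‖h‖ / c := by
    have hnn : 0 ≤ N * q + ‖h‖ / c := by
      have := (abs_nonneg _).trans (h1 k₀)
      have : 0 ≤ N * q := nonneg_of_mul_nonneg_left this (hpk k₀)
      positivity
    refine (ContinuousMap.norm_le _ hnn).2 fun k => ?_
    have hwk : |w k| ≤ N * q * p k + ‖h‖ := by
      conv_lhs => rw [hw]
      exact (abs_add_le _ _).trans (add_le_add (h1 k) (h.norm_coe_le_norm k))
    simp only [ContinuousMap.mul_apply, ContinuousMap.coe_mk, norm_mul, norm_inv, Real.norm_eq_abs,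
      abs_of_pos (hpk k), pi]
    rw [← div_eq_mul_inv, div_le_iff₀ (hpk k)]
    have : ‖h‖ ≤ ‖h‖ / c * p k := by
      rw [div_mul_eq_mul_div, le_div_iff₀ hc]
      exact mul_le_mul_of_nonneg_left (hcp k) (norm_nonneg _)
    linarith
  have hq' : 0 < 1 - q := by linarith
  have h3 : N ≤ ‖h‖ / (c * (1 - q)) := by
    rw [le_div_iff₀ (by positivity)]
    have : N * (1 - q) ≤ ‖h‖ / c := by linarith
    rw [le_div_iff₀ hc] at this
    linarith
  refine (ContinuousMap.norm_le _ (by positivity)).2 fun k => ?_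
  calc ‖w k‖ ≤ N * p k := hN k
    _ ≤ ‖h‖ / (c * (1 - q)) * M := by gcongr; exacts [(hpk k).le, hp k]
    _ = _ := by ring

/-- Conjugation with multiplication by p turns the weighted contraction into an operator of norm at
most q < 1, to which the Neumann series applies. -/
theorem ContinuousMap.isInvertible_id_sub :
    (ContinuousLinearMap.id ℝ C(K, ℝ) - L.comp (ContinuousLinearMap.mul ℝ C(K, ℝ) m)).IsInvertible := by
  have hpk : ∀ k, 0 < p k := fun k => hc.trans_le (hcp k)
  let pi : C(K, ℝ) := ⟨fun k => (p k)⁻¹, p.continuous.inv₀ fun k => (hpk k).ne'⟩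
  have hpi : pi * p = 1 := by
    ext k; simp [pi, (hpk k).ne']
  rcases isEmpty_or_nonempty K with hK | ⟨⟨k₀⟩⟩
  · refine ⟨ContinuousLinearEquiv.refl ℝ _, ?_⟩
    ext g k; exact hK.elim k
  have hq0 : 0 ≤ q := by
    have h := hL (m * p) (mul_nonneg hm fun k => (hpk k).le) k₀
    have h2 := h.trans (hLp k₀)
    exact nonneg_of_mul_nonneg_left h2 (hpk k₀)
  let A : C(K, ℝ) →L[ℝ] C(K, ℝ) := ContinuousLinearMap.mul ℝ C(K, ℝ) pi
  let B : C(K, ℝ) →L[ℝ] C(K, ℝ) := ContinuousLinearMap.mul ℝ C(K, ℝ) p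
  let k : C(K, ℝ) →L[ℝ] C(K, ℝ) := L * ContinuousLinearMap.mul ℝ C(K, ℝ) m
  have hAB : A * B = 1 := by
    ext1 g
    show pi * (p * g) = g
    rw [← mul_assoc, hpi, one_mul]
  have hBA : B * A = 1 := by
    ext1 g
    show p * (pi * g) = g
    rw [← mul_assoc, mul_comm p, hpi, one_mul]
  have hnorm : ‖A * k * B‖ ≤ q := by
    refine ContinuousLinearMap.opNorm_le_bound _ hq0 fun g => ?_
    refine (ContinuousMap.norm_le _ (by positivity)).2 fun j => ?_
    show ‖(p j)⁻¹ * L (m * (p * g)) j‖ ≤ _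
    have := ContinuousMap.abs_map_mul_le hL hm (norm_nonneg g) hLp (w := p * g) (fun i => by
      rw [ContinuousMap.mul_apply, abs_mul, abs_of_pos (hpk i), mul_comm]
      exact mul_le_mul_of_nonneg_right (g.norm_coe_le_norm i) (hpk i).le) j
    rw [norm_mul, norm_inv, Real.norm_eq_abs, abs_of_pos (hpk j), inv_mul_le_iff₀ (hpk j),
      Real.norm_eq_abs]
    linarith
  let uA : (C(K, ℝ) →L[ℝ] C(K, ℝ))ˣ := ⟨A, B, hAB, hBA⟩
  let uk : (C(K, ℝ) →L[ℝ] C(K, ℝ))ˣ := Units.oneSub (A * k * B) (hnorm.trans_lt hq)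
  have heq : ((uA⁻¹ * uk * uA : (C(K, ℝ) →L[ℝ] C(K, ℝ))ˣ) : C(K, ℝ) →L[ℝ] C(K, ℝ)) = 1 - k := by
    show B * (1 - A * k * B) * A = 1 - k
    rw [mul_sub, sub_mul, mul_one, hBA]
    congr 1
    calc B * (A * k * B) * A = (B * A) * k * (B * A) := by simp only [mul_assoc]
      _ = k := by rw [hBA, one_mul, mul_one]
  refine ⟨ContinuousLinearEquiv.unitsEquiv ℝ _ (uA⁻¹ * uk * uA), ?_⟩
  ext1 g
  exact congrArg (fun f : C(K, ℝ) →L[ℝ] C(K, ℝ) => f g) heq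

end Comparison

/-! ### The gap equation on C(K, ℝ) and smooth dependence of its solutions. -/

section Kernel

variable {K : Type*} [TopologicalSpace K] [CompactSpace K]

/-- An energy variable `ξ` on a compact space together with a positive integral operator `L`. -/
structure GapKernel (K : Type*) [TopologicalSpace K] [CompactSpace K] where
  ξ : C(K, ℝ)
  ζ : C(K, ℝ)
  lo : ℝ
  hi : ℝ
  lo_pos : 0 < lo
  lo_le : ∀ k, lo ≤ ξ k
  le_hi : ∀ k, ξ k ≤ hi
  lo_le_hi : lo ≤ hi
  ζ_eq : ∀ k, ζ k = (ξ k)⁻¹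
  L : C(K, ℝ) →L[ℝ] C(K, ℝ)
  L_nonneg : ∀ g, 0 ≤ g → 0 ≤ L g

/-- `z ↦ √(1 + z²)` as a continuous map. -/
noncomputable def sqrtOneAddSq : C(ℝ, ℝ) := ⟨fun z => √(1 + z ^ 2), by fun_prop⟩

/-- `z ↦ z / √(1 + z²)` as a continuous map. -/
noncomputable def divSqrtOneAddSq : C(ℝ, ℝ) :=
  ⟨fun z => z / √(1 + z ^ 2), continuous_id.div (by fun_prop) fun z => by positivity⟩

/-- The hyperbolic tangent as a continuous map. -/
noncomputable def tanhC : C(ℝ, ℝ) := ⟨tanh, (contDiff_tanh' (n := 0)).continuous⟩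

theorem continuous_thermalFactor (T : ℝ) : Continuous (thermalFactor T) := by
  unfold thermalFactor
  split_ifs
  · exact continuous_const
  · exact (contDiff_tanh' (n := 0)).continuous.comp (by fun_prop)

namespace GapKernel

variable (D : GapKernel K)

theorem ξ_pos (k : K) : 0 < D.ξ k := D.lo_pos.trans_le (D.lo_le k)

/-- The quasi-particle energy of the gap function `v`. -/
noncomputable def energy (v : C(K, ℝ)) : C(K, ℝ) := D.ξ * sqrtOneAddSq.comp (D.ζ * v)

/-- The quotient of the gap function `v` and its quasi-particle energy. -/
noncomputable def ratio (v : C(K, ℝ)) : C(K, ℝ) := divSqrtOneAddSq.comp (D.ζ * v)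

/-- The nonlinearity of the gap equation at inverse temperature `b`. -/
noncomputable def gapB (b : ℝ) (v : C(K, ℝ)) : C(K, ℝ) :=
  D.ratio v * tanhC.comp ((b / 2) • D.energy v)

/-- The nonlinearity of the gap equation at temperature `T`. -/
noncomputable def gap (T : ℝ) (v : C(K, ℝ)) : C(K, ℝ) :=
  D.ratio v * (⟨_, continuous_thermalFactor T⟩ : C(ℝ, ℝ)).comp (D.energy v)

/-- Rescaling by the energy variable leaves a function of one real variable independent of the
point, which is what makes the superposition results applicable; hence the field `ζ` for the
reciprocal of `ξ`. -/
theorem mul_sqrt_eq {x : ℝ} (hx : 0 < x) (y : ℝ) : x * √(1 + (x⁻¹ * y) ^ 2) = qpEnergy x y := by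
  rw [qpEnergy, ← Real.sqrt_sq hx.le, ← Real.sqrt_mul (sq_nonneg x), Real.sqrt_sq hx.le]
  congr 1
  field_simp

@[simp] theorem energy_apply (v : C(K, ℝ)) (k : K) : D.energy v k = qpEnergy (D.ξ k) (v k) := by
  rw [← mul_sqrt_eq (D.ξ_pos k), ← D.ζ_eq]; rfl

@[simp] theorem ratio_apply (v : C(K, ℝ)) (k : K) :
    D.ratio v k = v k / qpEnergy (D.ξ k) (v k) := by
  have h := D.ξ_pos k
  rw [← mul_sqrt_eq h, ← D.ζ_eq]
  show D.ζ k * v k / √(1 + (D.ζ k * v k) ^ 2) = _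
  have h2 : 0 < √(1 + (D.ζ k * v k) ^ 2) := by positivity
  have h3 : D.ζ k = (D.ξ k)⁻¹ := D.ζ_eq k
  generalize √(1 + (D.ζ k * v k) ^ 2) = s at h2
  rw [h3]
  field_simp

@[simp] theorem gapB_apply (b : ℝ) (v : C(K, ℝ)) (k : K) :
    D.gapB b v k = gapFun b (D.ξ k) (v k) := by
  have : b / 2 * qpEnergy (D.ξ k) (v k) = b * qpEnergy (D.ξ k) (v k) / 2 := by ring
  simp [gapB, gapFun, tanhC, this]

@[simp] theorem gap_apply (T : ℝ) (v : C(K, ℝ)) (k : K) :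
    D.gap T v k = gapFunT T (D.ξ k) (v k) := by
  simp [gap, gapFunT]

theorem gap_of_pos {T : ℝ} (hT : 0 < T) (v : C(K, ℝ)) : D.gap T v = D.gapB T⁻¹ v := by
  ext k; simp [gapFunT_of_pos hT]

/-- The derivative of the nonlinearity with respect to the gap function. -/
noncomputable def slope (b : ℝ) (v : C(K, ℝ)) : C(K, ℝ) where
  toFun k := gapSlope b (D.ξ k) (v k)
  continuous_toFun := by
    have h1 : Continuous fun k => qpEnergy (D.ξ k) (v k) :=
      (D.energy v).continuous.congr fun k => D.energy_apply v k
    have h2 : ∀ k, qpEnergy (D.ξ k) (v k) ≠ 0 := fun k => (qpEnergy_pos (D.ξ_pos k) _).ne'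
    have h3 : Continuous fun k => tanh (b * qpEnergy (D.ξ k) (v k) / 2) :=
      (contDiff_tanh' (n := 0)).continuous.comp (by fun_prop)
    have h4 : Continuous fun k => v k / qpEnergy (D.ξ k) (v k) := v.continuous.div h1 h2
    have h5 : Continuous fun k => D.ξ k ^ 2 / qpEnergy (D.ξ k) (v k) ^ 3 :=
      (D.ξ.continuous.pow 2).div (h1.pow 3) fun k => pow_ne_zero 3 (h2 k)
    unfold gapSlope
    fun_prop

@[simp] theorem slope_apply (b : ℝ) (v : C(K, ℝ)) (k : K) :
    D.slope b v k = gapSlope b (D.ξ k) (v k) := rfl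

section Smooth

open scoped ContDiff

theorem contDiff_energy : ContDiff ℝ ∞ D.energy := by
  have h : ContDiff ℝ ∞ sqrtOneAddSq := by
    show ContDiff ℝ ∞ fun z : ℝ => √(1 + z ^ 2)
    exact ContDiff.sqrt (by fun_prop) fun z => by positivity
  unfold energy
  exact contDiff_const.mul ((ContinuousMap.contDiff_postcomp _ h).comp
    (contDiff_const.mul contDiff_id))

theorem contDiff_ratio : ContDiff ℝ ∞ D.ratio := by
  have h : ContDiff ℝ ∞ divSqrtOneAddSq := by
    show ContDiff ℝ ∞ fun z : ℝ => z / √(1 + z ^ 2)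
    exact contDiff_id.div (ContDiff.sqrt (by fun_prop) fun z => by positivity)
      fun z => by positivity
  unfold ratio
  exact (ContinuousMap.contDiff_postcomp _ h).comp (contDiff_const.mul contDiff_id)

theorem contDiff_gapB : ContDiff ℝ ∞ fun p : ℝ × C(K, ℝ) => D.gapB p.1 p.2 := by
  have h : ContDiff ℝ ∞ tanhC := contDiff_tanh'
  unfold gapB
  exact (D.contDiff_ratio.comp contDiff_snd).mul ((ContinuousMap.contDiff_postcomp _ h).comp
    ((contDiff_fst.div_const 2).smul (D.contDiff_energy.comp contDiff_snd)))

/-- As differentiability is known, the partial derivative can be read off pointwise along the line t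
↦ (b, v + t h). -/
theorem fderiv_gapB_inr (b : ℝ) (v h : C(K, ℝ)) :
    fderiv ℝ (fun p : ℝ × C(K, ℝ) => D.gapB p.1 p.2) (b, v) (0, h) = D.slope b v * h := by
  have hd : HasFDerivAt (fun p : ℝ × C(K, ℝ) => D.gapB p.1 p.2)
      (fderiv ℝ (fun p : ℝ × C(K, ℝ) => D.gapB p.1 p.2) (b, v)) ((fun t : ℝ => (b, v + t • h)) 0) := by
    simpa using ((D.contDiff_gapB.differentiable (by simp)) (b, v)).hasFDerivAt
  have hline : HasDerivAt (fun t : ℝ => (b, v + t • h)) (0, h) 0 := by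
    have := ((hasDerivAt_id' (0 : ℝ)).smul_const h).const_add v
    rw [one_smul] at this
    exact (hasDerivAt_const 0 b).prodMk this
  have hc := hd.comp_hasDerivAt (0 : ℝ) hline
  ext k
  have h1 := (ContinuousMap.evalCLM ℝ k).hasFDerivAt.comp_hasDerivAt (0 : ℝ) hc
  have h2 : HasDerivAt (fun t : ℝ => v k + t * h k) (h k) 0 := by
    simpa using ((hasDerivAt_id' (0 : ℝ)).mul_const (h k)).const_add (v k)
  have h3 := hasDerivAt_gapFun (D.ξ_pos k) (hasDerivAt_const 0 b) h2
  have h4 := h1.unique (h3.congr_of_eventuallyEq (Eventually.of_forall fun t => by simp))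
  simp only [ContinuousMap.evalCLM_apply] at h4
  rw [h4, gapFunDeriv_eq]
  simp

/-- Continuous families of nondegenerate solutions of the gap equation are smooth. -/
theorem contDiffAt_solution {w : ℝ → C(K, ℝ)} {b : ℝ}
    (hsol : ∀ᶠ s in 𝓝 b, w s = D.L (D.gapB s (w s))) (hcont : ContinuousAt w b)
    (hinv : (ContinuousLinearMap.id ℝ C(K, ℝ) -
      D.L.comp (ContinuousLinearMap.mul ℝ C(K, ℝ) (D.slope b (w b)))).IsInvertible) :
    ContDiffAt ℝ ∞ w b := by
  set f : ℝ × C(K, ℝ) → C(K, ℝ) := fun p => p.2 - D.L (D.gapB p.1 p.2) with hf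
  have hg : ContDiff ℝ ∞ f := contDiff_snd.sub (D.L.contDiff.comp D.contDiff_gapB)
  have cdf : ContDiffAt ℝ ∞ f (b, w b) := hg.contDiffAt
  have hder : fderiv ℝ f (b, w b) ∘L .inr ℝ ℝ C(K, ℝ) = ContinuousLinearMap.id ℝ C(K, ℝ) -
      D.L.comp (ContinuousLinearMap.mul ℝ C(K, ℝ) (D.slope b (w b))) := by
    have h1 := hasFDerivAt_snd (𝕜 := ℝ) (p := (b, w b)) |>.sub (D.L.hasFDerivAt.comp (b, w b)
      ((D.contDiff_gapB.differentiable (by simp)) (b, w b)).hasFDerivAt)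
    have h2 : fderiv ℝ f (b, w b) = _ := h1.fderiv
    rw [h2]
    ext1 h
    simp [fderiv_gapB_inr]
  have if₂ : (fderiv ℝ f (b, w b) ∘L .inr ℝ ℝ C(K, ℝ)).IsInvertible := by rw [hder]; exact hinv
  have h0 : f (b, w b) = 0 := sub_eq_zero.2 hsol.self_of_nhds
  -- Near (b, w b) the zeros of `f` are exactly the graph of the implicit function; continuity of
  -- `w` places (s, w s) in that neighbourhood, so `w` coincides with a smooth function.
  have hev := cdf.eventually_apply_eq_iff_implicitFunction (by simp) if₂
  have htend : Tendsto (fun s => (s, w s)) (𝓝 b) (𝓝 (b, w b)) :=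
    (continuousAt_id.prodMk hcont).tendsto
  refine (cdf.contDiffAt_implicitFunction (by simp) if₂).congr_of_eventuallyEq ?_
  filter_upwards [htend.eventually hev, hsol] with s hs1 hs2
  exact (hs1.1 (by rw [h0]; exact sub_eq_zero.2 hs2)).symm

end Smooth

end GapKernel

end Kernel

/-! ### Families of positive solutions below the transition temperature. -/

section Family

variable {K : Type*} [TopologicalSpace K] [CompactSpace K]

namespace GapKernel

/-- `u` is a family of solutions of the gap equation at the temperatures `[0, T₀]` with values in
`[c, M]`, where `0 < c`. -/
structure IsFamily (D : GapKernel K) (u : ℝ → C(K, ℝ)) (T₀ c M : ℝ) : Prop where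
  T₀_pos : 0 < T₀
  c_pos : 0 < c
  c_le_M : c ≤ M
  eq : ∀ T, 0 ≤ T → T ≤ T₀ → u T = D.L (D.gap T (u T))
  lower : ∀ T, 0 ≤ T → T ≤ T₀ → ∀ k, c ≤ u T k
  upper : ∀ T, 0 ≤ T → T ≤ T₀ → ∀ k, u T k ≤ M

/-- Comparison of a subsolution at temperature `s` with a supersolution at temperature `t`. -/
theorem le_mul_of_sub_super (D : GapKernel K) {T₀ c M s t η : ℝ} {v w : C(K, ℝ)} (hT₀ : 0 < T₀)
    (hc : 0 < c) (hcM : c ≤ M) (hs0 : 0 ≤ s) (hs : s ≤ T₀) (hη : 0 ≤ η) (hv0 : 0 ≤ v)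
    (hvM : ∀ k, v k ≤ M) (hcw : ∀ k, c ≤ w k) (hwM : ∀ k, w k ≤ M) (hv : v ≤ D.L (D.gap s v))
    (hw : D.L (D.gap t w) ≤ w)
    (h : ∀ k, gapFunT s (D.ξ k) (w k) ≤ (1 + η) * gapFunT t (D.ξ k) (w k)) (k : K) :
    v k ≤ (1 + η * (M / c) / sublinConst D.lo D.hi c (M / c * M) T₀⁻¹) * w k := by
  have hM : 0 < M := hc.trans_le hcM
  have hR : 1 ≤ M / c := by rwa [le_div_iff₀ hc, one_mul]
  -- The comparison starts from R = M / c, because v ≤ M = R c ≤ R w. Multiples r w with r ≤ R reach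
  -- M / c * M, which is therefore the upper bound entering the sublinearity constant.
  have hcM' : c ≤ M / c * M := by nlinarith
  have hd0 := sublinConst_pos D.lo_pos D.lo_le_hi hc hcM' (inv_pos.2 hT₀)
  have hd1 := sublinConst_lt_one D.lo_pos D.lo_le_hi hc hcM' (inv_pos.2 hT₀)
  refine ContinuousMap.comparison D.L_nonneg hv hw
    (ContinuousMap.le_def.2 fun k => (hc.trans_le (hcw k)).le) hd0 hd1 hη hR
    (ContinuousMap.le_def.2 fun k => ?_) (fun r hr hrR hvr => ContinuousMap.le_def.2 fun k => ?_) k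
  · calc v k ≤ M / c * c := by rw [div_mul_cancel₀ _ hc.ne']; exact hvM k
      _ ≤ M / c * w k := mul_le_mul_of_nonneg_left (hcw k) (by positivity)
  · have hx := D.ξ_pos k
    have hvr' : v k ≤ r * w k := ContinuousMap.le_def.1 hvr k
    have hv0' : 0 ≤ v k := ContinuousMap.le_def.1 hv0 k
    rw [ContinuousMap.smul_apply, smul_eq_mul, gap_apply, gap_apply]
    calc gapFunT s (D.ξ k) (v k) ≤ gapFunT s (D.ξ k) (r * w k) := gapFunT_mono hs0 hx hv0' hvr'
      _ ≤ _ := gapFunT_mul_le D.lo_pos D.lo_le_hi hc hcM' hT₀ hs0 hs (D.lo_le k) (D.le_hi k)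
          (hcw k) hr (mul_le_mul hrR (hwM k) (hc.trans_le (hcw k)).le (by positivity))
      _ ≤ _ := by
          rw [mul_assoc]
          exact mul_le_mul_of_nonneg_left (h k) (by nlinarith)

namespace IsFamily

variable {D : GapKernel K} {u : ℝ → C(K, ℝ)} {T₀ c M : ℝ} (F : D.IsFamily u T₀ c M)
include F

theorem M_pos : 0 < M := F.c_pos.trans_le F.c_le_M

theorem pos {T : ℝ} (h0 : 0 ≤ T) (h : T ≤ T₀) (k : K) : 0 < u T k :=
  F.c_pos.trans_le (F.lower T h0 h k)

theorem c_le : c ≤ M / c * M := by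
  have hR : 1 ≤ M / c := by rw [le_div_iff₀ F.c_pos, one_mul]; exact F.c_le_M
  nlinarith [F.M_pos, F.c_le_M]

theorem M_le : M ≤ M / c * M := by
  have hR : 1 ≤ M / c := by rw [le_div_iff₀ F.c_pos, one_mul]; exact F.c_le_M
  nlinarith [F.M_pos, F.c_le_M]

theorem le_mul {s t η : ℝ} (hs0 : 0 ≤ s) (hs : s ≤ T₀) (ht0 : 0 ≤ t) (ht : t ≤ T₀) (hη : 0 ≤ η)
    (h : ∀ k, gapFunT s (D.ξ k) (u t k) ≤ (1 + η) * gapFunT t (D.ξ k) (u t k)) (k : K) :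
    u s k ≤ (1 + η * (M / c) / sublinConst D.lo D.hi c (M / c * M) T₀⁻¹) * u t k :=
  D.le_mul_of_sub_super F.T₀_pos F.c_pos F.c_le_M hs0 hs hη
    (ContinuousMap.le_def.2 fun k => (F.pos hs0 hs k).le) (F.upper s hs0 hs) (F.lower t ht0 ht)
    (F.upper t ht0 ht) (F.eq s hs0 hs).le (F.eq t ht0 ht).ge h k

theorem anti {s t : ℝ} (hs0 : 0 ≤ s) (hst : s ≤ t) (ht : t ≤ T₀) (k : K) : u t k ≤ u s k := by
  have := F.le_mul (hs0.trans hst) ht hs0 (hst.trans ht) le_rfl (fun k => by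
    rw [add_zero, one_mul]
    exact gapFunT_anti hs0 hst (D.ξ_pos k) (F.pos hs0 (hst.trans ht) k).le) k
  simpa using this

theorem sub_le {s t η : ℝ} (hs0 : 0 ≤ s) (hs : s ≤ T₀) (ht0 : 0 ≤ t) (ht : t ≤ T₀) (hη : 0 ≤ η)
    (h : ∀ k, thermalFactor s (qpEnergy (D.ξ k) (u t k)) ≤
      (1 + η) * thermalFactor t (qpEnergy (D.ξ k) (u t k))) (k : K) :
    u s k - u t k ≤ η * ((M / c) / sublinConst D.lo D.hi c (M / c * M) T₀⁻¹ * M) := by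
  have h1 := F.le_mul hs0 hs ht0 ht hη (fun k => by
    have := mul_le_mul_of_nonneg_left (h k)
      (div_nonneg (F.pos ht0 ht k).le (qpEnergy_pos (D.ξ_pos k) (u t k)).le)
    unfold gapFunT
    linarith) k
  have hd0 := sublinConst_pos D.lo_pos D.lo_le_hi F.c_pos F.c_le (inv_pos.2 F.T₀_pos)
  have hM := F.M_pos
  have hc := F.c_pos
  have h2 : η * (M / c) / sublinConst D.lo D.hi c (M / c * M) T₀⁻¹ * u t k ≤
      η * (M / c) / sublinConst D.lo D.hi c (M / c * M) T₀⁻¹ * M :=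
    mul_le_mul_of_nonneg_left (F.upper t ht0 ht k) (by positivity)
  calc u s k - u t k ≤ η * (M / c) / sublinConst D.lo D.hi c (M / c * M) T₀⁻¹ * u t k := by linarith
    _ ≤ _ := h2
    _ = _ := by ring

/-- Lowering the temperature from t to s multiplies the thermal factor by at most t/s, so the
comparison principle applies with η = t/s - 1. This is the continuity that the implicit function
argument needs. -/
theorem norm_sub_le {s t : ℝ} (hs0 : 0 < s) (hst : s ≤ t) (ht : t ≤ T₀) :
    ‖u s - u t‖ ≤ (t / s - 1) * ((M / c) / sublinConst D.lo D.hi c (M / c * M) T₀⁻¹ * M) := by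
  have hd0 := sublinConst_pos D.lo_pos D.lo_le_hi F.c_pos F.c_le (inv_pos.2 F.T₀_pos)
  have hM := F.M_pos
  have hc := F.c_pos
  have hη : 0 ≤ t / s - 1 := by rwa [sub_nonneg, le_div_iff₀ hs0, one_mul]
  refine (ContinuousMap.norm_le _ (by positivity)).2 fun k => ?_
  rw [ContinuousMap.sub_apply, Real.norm_eq_abs,
    abs_of_nonneg (sub_nonneg.2 (F.anti hs0.le hst ht k))]
  exact F.sub_le hs0.le (hst.trans ht) (hs0.le.trans hst) ht hη
    (fun k => thermalFactor_le_mul hs0 hst (qpEnergy_pos (D.ξ_pos k) _).le) k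

theorem continuousAt {t : ℝ} (ht0 : 0 < t) (ht : t < T₀) : ContinuousAt u t := by
  set C := (M / c) / sublinConst D.lo D.hi c (M / c * M) T₀⁻¹ * M with hC
  have hC0 : 0 ≤ C := by
    have hd0 := sublinConst_pos D.lo_pos D.lo_le_hi F.c_pos F.c_le (inv_pos.2 F.T₀_pos)
    have hM := F.M_pos
    have hc := F.c_pos
    positivity
  rw [ContinuousAt, tendsto_iff_norm_sub_tendsto_zero]
  have h1 : Tendsto (fun s => (|t / s - 1| + |s / t - 1|) * C) (𝓝 t) (𝓝 0) := by
    have ha : ContinuousAt (fun s => (|t / s - 1| + |s / t - 1|) * C) t := by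
      have := ht0.ne'
      fun_prop (disch := assumption)
    have := ha.tendsto
    simpa [div_self ht0.ne'] using this
  refine squeeze_zero' (Eventually.of_forall fun _ => norm_nonneg _) ?_ h1
  filter_upwards [Ioo_mem_nhds ht0 ht] with s hs
  rcases le_total s t with hst | hst
  · refine (F.norm_sub_le hs.1 hst ht.le).trans (mul_le_mul_of_nonneg_right ?_ hC0)
    exact (le_abs_self _).trans (le_add_of_nonneg_right (abs_nonneg _))
  · rw [norm_sub_rev]
    refine (F.norm_sub_le ht0 hst hs.2.le).trans (mul_le_mul_of_nonneg_right ?_ hC0)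
    exact (le_abs_self _).trans (le_add_of_nonneg_left (abs_nonneg _))

/-- Solutions at low temperature are exponentially close to the solution at zero temperature. -/
theorem zero_sub_le {t a : ℝ} (ht0 : 0 < t) (ht : t ≤ T₀)
    (ha : ∀ k, a ≤ qpEnergy (D.ξ k) (u t k)) (k : K) :
    u 0 k - u t k ≤ 2 / (1 - exp (-(T₀⁻¹ * D.lo))) * exp (-(t⁻¹ * a)) *
      ((M / c) / sublinConst D.lo D.hi c (M / c * M) T₀⁻¹ * M) := by
  have hlo := D.lo_pos
  have hT₀ := F.T₀_pos
  have h1 : exp (-(T₀⁻¹ * D.lo)) < 1 := exp_lt_one_iff.2 (by simp; positivity)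
  have h2 : 0 < 1 - exp (-(T₀⁻¹ * D.lo)) := by linarith
  refine F.sub_le le_rfl F.T₀_pos.le ht0.le ht (by positivity) (fun k => ?_) k
  set E := qpEnergy (D.ξ k) (u t k) with hE
  have hE0 : 0 < E := qpEnergy_pos (D.ξ_pos k) _
  have hloE : D.lo ≤ E := (D.lo_le k).trans (le_qpEnergy _ _)
  have h3 := one_le_mul_tanh (x₀ := T₀⁻¹ * D.lo / 2) (x := t⁻¹ * E / 2) (by positivity)
    (by gcongr)
  rw [thermalFactor_of_pos ht0]
  have h4 : thermalFactor 0 E = 1 := by simp [thermalFactor]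
  rw [h4]
  refine h3.trans (mul_le_mul_of_nonneg_right ?_ (tanh_nonneg_of_nonneg (by positivity)))
  have h5 : -2 * (T₀⁻¹ * D.lo / 2) = -(T₀⁻¹ * D.lo) := by ring
  have h6 : -2 * (t⁻¹ * E / 2) = -(t⁻¹ * E) := by ring
  rw [h5, h6]
  have h7 : exp (-(t⁻¹ * E)) ≤ exp (-(t⁻¹ * a)) :=
    exp_le_exp.2 (neg_le_neg (mul_le_mul_of_nonneg_left (ha k) (by positivity)))
  gcongr

/-- Sublinearity says slope · u ≤ (1 - δ) gap(u); applying L and the gap equation shows that the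
solution itself is a weight in which the linearised operator contracts. -/
theorem map_slope_mul_le {b : ℝ} (hb : T₀⁻¹ ≤ b) :
    D.L (D.slope b (u b⁻¹) * u b⁻¹) ≤
      (1 - sublinConst D.lo D.hi c (M / c * M) T₀⁻¹) • u b⁻¹ := by
  have hT₀ := F.T₀_pos
  have hb0 : 0 < b := (inv_pos.2 hT₀).trans_le hb
  have hT0 : 0 < b⁻¹ := inv_pos.2 hb0
  have hT : b⁻¹ ≤ T₀ := inv_le_of_inv_le₀ hT₀ hb
  have h1 : D.slope b (u b⁻¹) * u b⁻¹ ≤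
      (1 - sublinConst D.lo D.hi c (M / c * M) T₀⁻¹) • D.gap b⁻¹ (u b⁻¹) :=
    ContinuousMap.le_def.2 fun k => by
      have := gapSlope_mul_le D.lo_pos D.lo_le_hi F.c_pos F.c_le (inv_pos.2 hT₀) hb (D.lo_le k)
        (D.le_hi k) (F.lower _ hT0.le hT k) ((F.upper _ hT0.le hT k).trans F.M_le)
      simpa [gapFunT_of_pos hT0] using this
  have h2 := ContinuousMap.map_mono_of_nonneg D.L_nonneg h1
  rwa [map_smul, ← F.eq _ hT0.le hT] at h2

theorem slope_nonneg {b : ℝ} (hb : T₀⁻¹ ≤ b) : 0 ≤ D.slope b (u b⁻¹) := by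
  have hT₀ := F.T₀_pos
  have hb0 : 0 < b := (inv_pos.2 hT₀).trans_le hb
  have hT : b⁻¹ ≤ T₀ := inv_le_of_inv_le₀ hT₀ hb
  exact ContinuousMap.le_def.2 fun k =>
    gapSlope_nonneg hb0.le (D.ξ_pos k) (F.pos (inv_pos.2 hb0).le hT k).le

theorem eventually_eq {b : ℝ} (hb : T₀⁻¹ < b) :
    ∀ᶠ s in 𝓝 b, u s⁻¹ = D.L (D.gapB s (u s⁻¹)) := by
  have hT₀ := F.T₀_pos
  filter_upwards [Ioi_mem_nhds hb] with s hs
  have hs' : T₀⁻¹ < s := hs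
  have hs0 : 0 < s := (inv_pos.2 hT₀).trans hs'
  have hT : s⁻¹ ≤ T₀ := inv_le_of_inv_le₀ hT₀ hs'.le
  have := D.gap_of_pos (inv_pos.2 hs0) (u s⁻¹)
  rw [inv_inv] at this
  rw [← this]
  exact F.eq _ (inv_pos.2 hs0).le hT

open scoped ContDiff in
theorem contDiffAt {b : ℝ} (hb : T₀⁻¹ < b) : ContDiffAt ℝ ∞ (fun s => u s⁻¹) b := by
  have hT₀ := F.T₀_pos
  have hb0 : 0 < b := (inv_pos.2 hT₀).trans hb
  have hT0 : 0 < b⁻¹ := inv_pos.2 hb0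
  have hT : b⁻¹ < T₀ := inv_lt_of_inv_lt₀ hT₀ hb
  have hd0 := sublinConst_pos D.lo_pos D.lo_le_hi F.c_pos F.c_le (inv_pos.2 hT₀)
  refine D.contDiffAt_solution (F.eventually_eq hb)
    ((F.continuousAt hT0 hT).comp (f := fun s : ℝ => s⁻¹) (continuousAt_inv₀ hb0.ne')) ?_
  exact ContinuousMap.isInvertible_id_sub D.L_nonneg (F.slope_nonneg hb.le) (by linarith) F.c_pos
    (F.lower _ hT0.le hT.le) (F.upper _ hT0.le hT.le) (F.map_slope_mul_le hb.le)

end IsFamily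

end GapKernel

end Family

/-! ### Bounds on the linearised nonlinearity that are uniform in b. -/

section ScalarBounds

theorem mul_exp_neg_mul_le {a : ℝ} (ha : 0 < a) (b : ℝ) : b * exp (-(b * a)) ≤ 1 / a := by
  have h1 := add_one_le_exp (b * a)
  rw [exp_neg, le_div_iff₀ ha, ← div_eq_mul_inv, div_mul_eq_mul_div, div_le_one (exp_pos _)]
  linarith

theorem one_sub_tanh_sq_le_exp' (b e : ℝ) : 1 - tanh (b * e / 2) ^ 2 ≤ 4 * exp (-(b * e)) := by
  have := one_sub_tanh_sq_le_exp (b * e / 2)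
  rwa [show -2 * (b * e / 2) = -(b * e) by ring] at this

/-- The explicit factor b is harmless since it multiplies 1 - tanh², which is at most 4 exp(-be),
and b exp(-be) ≤ 1/e. -/
theorem gapSlope_le {lo b x y : ℝ} (hlo : 0 < lo) (hx : lo ≤ x) (hb : 0 ≤ b) (hy : 0 ≤ y) :
    gapSlope b x y ≤ 3 / lo := by
  have hx0 := hlo.trans_le hx
  have he := qpEnergy_pos hx0 y
  have hxe := le_qpEnergy x y
  have hρ1 := div_qpEnergy_le_one hx0 y
  have hρ0 : 0 ≤ y / qpEnergy x y := div_nonneg hy he.le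
  unfold gapSlope
  set e := qpEnergy x y
  have hτ0 : 0 ≤ tanh (b * e / 2) := tanh_nonneg_of_nonneg (by positivity)
  have hτ1 : tanh (b * e / 2) ≤ 1 := (tanh_lt_one _).le
  have hθ := one_sub_tanh_sq_le_exp' b e
  have hθ0 := one_sub_tanh_sq_nonneg (b * e / 2)
  have hloe := hx.trans hxe
  have hp : x ^ 2 / e ^ 3 ≤ 1 / lo := by
    rw [div_le_div_iff₀ (by positivity) hlo]
    calc x ^ 2 * lo ≤ e ^ 2 * e := by gcongr
      _ = 1 * e ^ 3 := by ring
  have h2 : b * (1 - tanh (b * e / 2) ^ 2) ≤ 4 * (1 / lo) := by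
    have h3 := mul_exp_neg_mul_le he b
    have h4 : 1 / e ≤ 1 / lo := one_div_le_one_div_of_le hlo hloe
    nlinarith
  set θ := 1 - tanh (b * e / 2) ^ 2
  have h5 : 0 ≤ b * θ := by positivity
  calc x ^ 2 / e ^ 3 * tanh (b * e / 2) + y / e * (θ * (b * (y / e)) / 2)
      = x ^ 2 / e ^ 3 * tanh (b * e / 2) + (y / e) * (y / e) * (b * θ) / 2 := by ring
    _ ≤ 1 / lo * 1 + 1 * 1 * (4 * (1 / lo)) / 2 := by gcongr
    _ = 3 / lo := by ring

/-- Each term contains y' or 1 - tanh², both exponentially small in the application. Outside tanh, b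
occurs only in the product b y', so bounds for |y'| and b|y'| suffice. -/
theorem abs_gapFunRem_le {lo Em B b x y y' : ℝ} (hlo : 0 < lo) (hx : lo ≤ x) (hb : 0 ≤ b)
    (hy : 0 ≤ y) (hEm : qpEnergy x y ≤ Em) (hB : |y'| ≤ B) (hbB : b * |y'| ≤ B) :
    |gapFunRem b x y y'| ≤ (3 / lo ^ 2 * B + (Em + B) / lo + 1 + B / lo + (Em + B) ^ 2) *
      (|y'| + (1 - tanh (b * qpEnergy x y / 2) ^ 2)) := by
  have hx0 := hlo.trans_le hx
  have he := qpEnergy_pos hx0 y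
  have hxe := le_qpEnergy x y
  have hρ1 := div_qpEnergy_le_one hx0 y
  have hρ0 : 0 ≤ y / qpEnergy x y := div_nonneg hy he.le
  unfold gapFunRem
  set e := qpEnergy x y
  have hτ0 : 0 ≤ tanh (b * e / 2) := tanh_nonneg_of_nonneg (by positivity)
  have hτ1 : tanh (b * e / 2) ≤ 1 := (tanh_lt_one _).le
  have hθ0 := one_sub_tanh_sq_nonneg (b * e / 2)
  have hθ1 : 1 - tanh (b * e / 2) ^ 2 ≤ 1 := by nlinarith
  have hloe := hx.trans hxe
  have hp : x ^ 2 / e ^ 3 ≤ 1 / lo := by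
    rw [div_le_div_iff₀ (by positivity) hlo]
    calc x ^ 2 * lo ≤ e ^ 2 * e := by gcongr
      _ = 1 * e ^ 3 := by ring
  have hp0 : 0 ≤ x ^ 2 / e ^ 3 := by positivity
  have hq : 3 * x ^ 2 / e ^ 4 ≤ 3 / lo ^ 2 := by
    rw [div_le_div_iff₀ (by positivity) (by positivity)]
    calc 3 * x ^ 2 * lo ^ 2 ≤ 3 * e ^ 2 * e ^ 2 := by gcongr
      _ = 3 * e ^ 4 := by ring
  have hq0 : 0 ≤ 3 * x ^ 2 / e ^ 4 := by positivity
  set θ := 1 - tanh (b * e / 2) ^ 2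
  set τ := tanh (b * e / 2)
  set ρ := y / e
  set p := x ^ 2 / e ^ 3
  set q := 3 * x ^ 2 / e ^ 4
  have hY0 := abs_nonneg y'
  have hB0 : 0 ≤ B := hY0.trans hB
  have hEm0 : 0 ≤ Em := he.le.trans hEm
  have habs : |e + b * (ρ * y')| ≤ Em + B := by
    refine (abs_add_le _ _).trans (add_le_add (by rwa [abs_of_pos he]) ?_)
    rw [abs_mul, abs_mul, abs_of_nonneg hb, abs_of_nonneg hρ0]
    calc b * (ρ * |y'|) ≤ b * (1 * |y'|) := by gcongr
      _ ≤ B := by rwa [one_mul]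
  have t1 : |q * (ρ * y') * y' * τ| ≤ 3 / lo ^ 2 * B * |y'| := by
    simp only [abs_mul, abs_of_nonneg hq0, abs_of_nonneg hρ0, abs_of_nonneg hτ0]
    calc q * (ρ * |y'|) * |y'| * τ ≤ 3 / lo ^ 2 * (1 * B) * |y'| * 1 := by gcongr
      _ = _ := by ring
  have t2 : |2 * (p * y') * (θ * (e + b * (ρ * y')) / 2)| ≤ (Em + B) / lo * |y'| := by
    rw [show 2 * (p * y') * (θ * (e + b * (ρ * y')) / 2) = p * θ * (e + b * (ρ * y')) * y' by ring]
    simp only [abs_mul, abs_of_nonneg hp0, abs_of_nonneg hθ0]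
    calc p * θ * |e + b * (ρ * y')| * |y'| ≤ 1 / lo * 1 * (Em + B) * |y'| := by gcongr
      _ = _ := by ring
  have t3 : |ρ * (θ * (2 * (ρ * y') + b * (p * y' * y')) / 2)| ≤ (1 + B / lo) * |y'| := by
    rw [show ρ * (θ * (2 * (ρ * y') + b * (p * y' * y')) / 2) =
      ρ * θ * ((ρ + p * (b * y') / 2) * y') by ring]
    have h1 : |ρ + p * (b * y') / 2| ≤ 1 + B / lo := by
      refine (abs_add_le _ _).trans (add_le_add (by rwa [abs_of_nonneg hρ0]) ?_)
      rw [abs_div, abs_mul, abs_mul, abs_of_nonneg hp0, abs_of_nonneg hb, abs_two]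
      calc p * (b * |y'|) / 2 ≤ 1 / lo * B / 2 := by gcongr
        _ = B / lo / 2 := by ring
        _ ≤ B / lo := half_le_self (by positivity)
    simp only [abs_mul, abs_of_nonneg hρ0, abs_of_nonneg hθ0]
    calc ρ * θ * (|ρ + p * (b * y') / 2| * |y'|) ≤ 1 * 1 * ((1 + B / lo) * |y'|) := by gcongr
      _ = _ := by ring
  have t4 : |ρ * (τ * θ * (e + b * (ρ * y')) ^ 2 / 2)| ≤ (Em + B) ^ 2 * θ := by
    rw [show ρ * (τ * θ * (e + b * (ρ * y')) ^ 2 / 2) =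
      ρ * (τ * θ) * ((e + b * (ρ * y')) ^ 2 / 2) by ring]
    simp only [abs_mul, abs_of_nonneg hρ0, abs_of_nonneg hθ0, abs_of_nonneg hτ0]
    have h1 : |(e + b * (ρ * y')) ^ 2 / 2| ≤ (Em + B) ^ 2 := by
      rw [abs_div, abs_pow, abs_two]
      have h2 : |e + b * (ρ * y')| ^ 2 ≤ (Em + B) ^ 2 := by gcongr
      have h3 : 0 ≤ |e + b * (ρ * y')| ^ 2 := by positivity
      linarith
    calc ρ * (τ * θ) * |(e + b * (ρ * y')) ^ 2 / 2| ≤ 1 * (1 * θ) * (Em + B) ^ 2 := by gcongr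
      _ = _ := by ring
  have hsplit : -(q * (ρ * y') * y' * τ) + 2 * (p * y') * (θ * (e + b * (ρ * y')) / 2) +
      ρ * (θ * (2 * (ρ * y') + b * (p * y' * y')) / 2 - τ * θ * (e + b * (ρ * y')) ^ 2 / 2) =
      -(q * (ρ * y') * y' * τ) + 2 * (p * y') * (θ * (e + b * (ρ * y')) / 2) +
      ρ * (θ * (2 * (ρ * y') + b * (p * y' * y')) / 2) +
      -(ρ * (τ * θ * (e + b * (ρ * y')) ^ 2 / 2)) := by ring
  rw [hsplit]
  refine (abs_add_le _ _).trans ((add_le_add_left (abs_add_three _ _ _) _).trans ?_)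
  rw [abs_neg, abs_neg]
  have c1 : 0 ≤ 3 / lo ^ 2 * B := by positivity
  have c2 : 0 ≤ (Em + B) / lo := by positivity
  have c3 : 0 ≤ B / lo := by positivity
  have c4 : 0 ≤ (Em + B) ^ 2 := by positivity
  nlinarith [mul_nonneg c1 hθ0, mul_nonneg c2 hθ0, mul_nonneg c3 hθ0, mul_nonneg c4 hY0]

end ScalarBounds

/-! ### Exponential bounds for the solution and its derivatives in b. -/

section Curves

variable {K : Type*} [TopologicalSpace K] [CompactSpace K]

namespace GapKernel

theorem hasDerivAt_eval {w : ℝ → C(K, ℝ)} {w' : C(K, ℝ)} {b : ℝ} (h : HasDerivAt w w' b) (k : K) :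
    HasDerivAt (fun s => w s k) (w' k) b :=
  (ContinuousMap.evalCLM ℝ k : C(K, ℝ) →L[ℝ] ℝ).hasFDerivAt.comp_hasDerivAt b h

variable (D : GapKernel K) {w : ℝ → C(K, ℝ)} {b₀ : ℝ}

open scoped ContDiff

theorem _root_.ContDiffOn.deriv_Ioi {E : Type*} [NormedAddCommGroup E] [NormedSpace ℝ E]
    {w : ℝ → E} {b₀ : ℝ} (hw : ContDiffOn ℝ ∞ w (Ioi b₀)) : ContDiffOn ℝ ∞ (deriv w) (Ioi b₀) :=
  hw.deriv_of_isOpen isOpen_Ioi (by simp)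

theorem _root_.ContDiffOn.hasDerivAt_Ioi {E : Type*} [NormedAddCommGroup E] [NormedSpace ℝ E]
    {w : ℝ → E} {b₀ : ℝ} (hw : ContDiffOn ℝ ∞ w (Ioi b₀)) {b : ℝ} (hb : b₀ < b) :
    HasDerivAt w (deriv w b) b :=
  ((hw.contDiffAt (Ioi_mem_nhds hb)).differentiableAt (by simp)).hasDerivAt

/-- The nonlinearity of the gap equation along a curve of gap functions. -/
noncomputable def gapCurve (w : ℝ → C(K, ℝ)) (b : ℝ) : C(K, ℝ) := D.gapB b (w b)

theorem contDiffOn_gapCurve (hw : ContDiffOn ℝ ∞ w (Ioi b₀)) :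
    ContDiffOn ℝ ∞ (D.gapCurve w) (Ioi b₀) :=
  D.contDiff_gapB.comp_contDiffOn (contDiffOn_id.prodMk hw)

theorem deriv_gapCurve_apply (hw : ContDiffOn ℝ ∞ w (Ioi b₀)) {b : ℝ} (hb : b₀ < b) (k : K) :
    deriv (D.gapCurve w) b k = gapFunDeriv b (D.ξ k) (w b k) 1 (deriv w b k) := by
  have h1 := hasDerivAt_eval ((D.contDiffOn_gapCurve hw).hasDerivAt_Ioi hb) k
  have h2 := hasDerivAt_gapFun (D.ξ_pos k) (hasDerivAt_id' b)
    (hasDerivAt_eval (hw.hasDerivAt_Ioi hb) k)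
  exact h1.unique (h2.congr_of_eventuallyEq (Eventually.of_forall fun t => by simp [gapCurve]))

theorem deriv_deriv_gapCurve_apply (hw : ContDiffOn ℝ ∞ w (Ioi b₀)) {b : ℝ} (hb : b₀ < b) (k : K) :
    deriv (deriv (D.gapCurve w)) b k = gapSlope b (D.ξ k) (w b k) * deriv (deriv w) b k +
      gapFunRem b (D.ξ k) (w b k) (deriv w b k) := by
  have h1 := hasDerivAt_eval ((D.contDiffOn_gapCurve hw).deriv_Ioi.hasDerivAt_Ioi hb) k
  have h2 := hasDerivAt_gapFunDeriv (D.ξ_pos k)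
    (hasDerivAt_eval (hw.hasDerivAt_Ioi hb) k) (hasDerivAt_eval (hw.deriv_Ioi.hasDerivAt_Ioi hb) k)
  refine h1.unique (h2.congr_of_eventuallyEq ?_)
  filter_upwards [Ioi_mem_nhds hb] with t ht
  exact D.deriv_gapCurve_apply hw ht k

namespace IsFamily

variable {D} {u : ℝ → C(K, ℝ)} {T₀ c M : ℝ} (F : D.IsFamily u T₀ c M)
include F

theorem contDiffOn : ContDiffOn ℝ ∞ (fun s => u s⁻¹) (Ioi T₀⁻¹) :=
  fun _ hb => (F.contDiffAt hb).contDiffWithinAt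

theorem eqOn_map : EqOn (fun s => u s⁻¹) (fun s => D.L (D.gapCurve (fun s => u s⁻¹) s))
    (Ioi T₀⁻¹) := fun _ hb => (F.eventually_eq hb).self_of_nhds

theorem eqOn_deriv : EqOn (deriv fun s => u s⁻¹)
    (fun s => D.L (deriv (D.gapCurve (fun s => u s⁻¹)) s)) (Ioi T₀⁻¹) := fun b hb => by
  have h := D.L.hasFDerivAt.comp_hasDerivAt b
    ((D.contDiffOn_gapCurve F.contDiffOn).hasDerivAt_Ioi hb)
  exact ((F.contDiffOn.hasDerivAt_Ioi hb).unique
    (h.congr_of_eventuallyEq (F.eqOn_map.eventuallyEq_of_mem (Ioi_mem_nhds hb))))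

theorem eqOn_deriv_deriv : EqOn (deriv (deriv fun s => u s⁻¹))
    (fun s => D.L (deriv (deriv (D.gapCurve (fun s => u s⁻¹))) s)) (Ioi T₀⁻¹) := fun b hb => by
  have h := D.L.hasFDerivAt.comp_hasDerivAt b
    ((D.contDiffOn_gapCurve F.contDiffOn).deriv_Ioi.hasDerivAt_Ioi hb)
  exact ((F.contDiffOn.deriv_Ioi.hasDerivAt_Ioi hb).unique
    (h.congr_of_eventuallyEq (F.eqOn_deriv.eventuallyEq_of_mem (Ioi_mem_nhds hb))))

/-- The quasi-particle energies at low and at zero temperature are exponentially close. -/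
theorem exists_energy_sub_le : ∃ C, 0 ≤ C ∧ ∀ b, T₀⁻¹ ≤ b → ∀ k,
    qpEnergy (D.ξ k) (u 0 k) - qpEnergy (D.ξ k) (u b⁻¹ k) ≤ C * exp (-(b * D.lo)) := by
  have hT₀ := F.T₀_pos
  have hlo := D.lo_pos
  have h1 : exp (-(T₀⁻¹ * D.lo)) < 1 := exp_lt_one_iff.2 (by simp; positivity)
  have h2 : 0 < 1 - exp (-(T₀⁻¹ * D.lo)) := by linarith
  have hd0 := sublinConst_pos D.lo_pos D.lo_le_hi F.c_pos F.c_le (inv_pos.2 F.T₀_pos)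
  have hM := F.M_pos
  have hc := F.c_pos
  refine ⟨2 / (1 - exp (-(T₀⁻¹ * D.lo))) *
    ((M / c) / sublinConst D.lo D.hi c (M / c * M) T₀⁻¹ * M), by positivity, fun b hb k => ?_⟩
  have hb0 : 0 < b := (inv_pos.2 hT₀).trans_le hb
  have hT0 : 0 < b⁻¹ := inv_pos.2 hb0
  have hT : b⁻¹ ≤ T₀ := inv_le_of_inv_le₀ hT₀ hb
  have h3 := F.zero_sub_le hT0 hT (a := D.lo)
    (fun k => (D.lo_le k).trans (le_qpEnergy _ _)) k
  have h4 := qpEnergy_sub_le (D.ξ k) (D.ξ_pos k) (F.pos hT0.le hT k).le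
    (F.anti le_rfl hT0.le hT k)
  rw [inv_inv] at h3
  linarith

/-- The crude rate `D.lo` is enough to bound b times the energy difference, hence exp(-bE(T)) ≤ e^C
exp(-bE(0)). This is the bootstrap from `D.lo` to the true gap. -/
theorem exists_mul_energy_sub_le : ∃ C, 0 ≤ C ∧ ∀ b, T₀⁻¹ ≤ b → ∀ k,
    b * qpEnergy (D.ξ k) (u 0 k) - C ≤ b * qpEnergy (D.ξ k) (u b⁻¹ k) := by
  obtain ⟨C, hC0, hC⟩ := F.exists_energy_sub_le
  have hlo := D.lo_pos
  refine ⟨C * (1 / D.lo), by positivity, fun b hb k => ?_⟩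
  have hb0 : 0 < b := (inv_pos.2 F.T₀_pos).trans_le hb
  have h1 := mul_le_mul_of_nonneg_left (hC b hb k) hb0.le
  have h2 := mul_le_mul_of_nonneg_left (mul_exp_neg_mul_le hlo b) hC0
  linarith

/-- All deviations from the state at zero temperature are exponentially small. -/
theorem exists_bounds {G : ℝ} (hG0 : 0 < G) (hG : ∀ k, G ≤ qpEnergy (D.ξ k) (u 0 k)) :
    ∃ C, 0 ≤ C ∧ ∀ b, T₀⁻¹ < b →
      (∀ k, exp (-(b * qpEnergy (D.ξ k) (u b⁻¹ k))) ≤ C * exp (-(b * G))) ∧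
      ‖u 0 - u b⁻¹‖ ≤ C * exp (-(b * G)) ∧
      ‖deriv (fun s => u s⁻¹) b‖ ≤ C * exp (-(b * G)) ∧
      ‖deriv (deriv fun s => u s⁻¹) b‖ ≤ C * exp (-(b * G)) ∧
      ‖deriv (D.gapCurve fun s => u s⁻¹) b‖ ≤ C * exp (-(b * G)) ∧
      ‖deriv (deriv (D.gapCurve fun s => u s⁻¹)) b‖ ≤ C * exp (-(b * G)) := by
  have hT₀ := F.T₀_pos
  have hlo := D.lo_pos
  have hM := F.M_pos
  have hc := F.c_pos
  have hd0 := sublinConst_pos D.lo_pos D.lo_le_hi F.c_pos F.c_le (inv_pos.2 F.T₀_pos)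
  have hd1 := sublinConst_lt_one D.lo_pos D.lo_le_hi F.c_pos F.c_le (inv_pos.2 F.T₀_pos)
  set δ := sublinConst D.lo D.hi c (M / c * M) T₀⁻¹ with hδ
  obtain ⟨A, hA0, hA⟩ := F.exists_mul_energy_sub_le
  have hexp : ∀ b, T₀⁻¹ < b → ∀ k,
      exp (-(b * qpEnergy (D.ξ k) (u b⁻¹ k))) ≤ exp A * exp (-(b * G)) := fun b hb k => by
    rw [← exp_add]
    have hb0 : 0 < b := (inv_pos.2 hT₀).trans hb
    have h1 := hA b hb.le k
    have h2 := mul_le_mul_of_nonneg_left (hG k) hb0.le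
    exact exp_le_exp.2 (by linarith)
  set Em := qpEnergy D.hi M with hEmdef
  have hhi : 0 < D.hi := hlo.trans_le D.lo_le_hi
  have hEm0 : 0 < Em := qpEnergy_pos hhi _
  have hEm : ∀ b, T₀⁻¹ < b → ∀ k, qpEnergy (D.ξ k) (u b⁻¹ k) ≤ Em := fun b hb k => by
    have hb0 : 0 < b := (inv_pos.2 hT₀).trans hb
    have hT : b⁻¹ ≤ T₀ := inv_le_of_inv_le₀ hT₀ hb.le
    have h1 := F.upper _ (inv_pos.2 hb0).le hT k
    have h2 := F.pos (inv_pos.2 hb0).le hT k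
    have h3 := D.ξ_pos k
    have h4 := D.le_hi k
    exact Real.sqrt_le_sqrt (by gcongr)
  -- the solution of a linearised equation is bounded by the inhomogeneity
  set Q := M / (c * (1 - (1 - δ))) * ‖D.L‖ with hQ
  have hQ0 : 0 ≤ Q := by
    have : 0 < 1 - (1 - δ) := by linarith
    positivity
  have hlin : ∀ b, T₀⁻¹ < b → ∀ z r : C(K, ℝ), z = D.L (D.slope b (u b⁻¹) * z + r) →
      ‖z‖ ≤ Q * ‖r‖ := fun b hb z r hz => by
    have hb0 : 0 < b := (inv_pos.2 hT₀).trans hb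
    have hT : b⁻¹ ≤ T₀ := inv_le_of_inv_le₀ hT₀ hb.le
    rw [map_add] at hz
    have h1 := ContinuousMap.norm_le_of_eq_add D.L_nonneg (F.slope_nonneg hb.le) (by linarith) hc
      (F.lower _ (inv_pos.2 hb0).le hT) (F.upper _ (inv_pos.2 hb0).le hT)
      (F.map_slope_mul_le hb.le) hz
    refine h1.trans ?_
    rw [hQ, mul_assoc]
    have : 0 < 1 - (1 - δ) := by linarith
    exact mul_le_mul_of_nonneg_left (D.L.le_opNorm r) (by positivity)
  have hslope : ∀ b, T₀⁻¹ < b → ‖D.slope b (u b⁻¹)‖ ≤ 3 / D.lo := fun b hb => by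
    have hb0 : 0 < b := (inv_pos.2 hT₀).trans hb
    have hT : b⁻¹ ≤ T₀ := inv_le_of_inv_le₀ hT₀ hb.le
    refine (ContinuousMap.norm_le _ (by positivity)).2 fun k => ?_
    have h1 := F.pos (inv_pos.2 hb0).le hT k
    rw [Real.norm_eq_abs, slope_apply, abs_of_nonneg (gapSlope_nonneg hb0.le (D.ξ_pos k) h1.le)]
    exact gapSlope_le hlo (D.lo_le k) hb0.le h1.le
  -- first derivatives
  set R₁ := 2 * Em * exp A with hR₁
  -- After subtracting slope times velocity, what remains is the explicit b-derivative (u/e)(1 -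
  -- tanh²)e/2, of size 2 Em e^A exp(-bG).
  have hr₁ : ∀ b, T₀⁻¹ < b → ‖deriv (D.gapCurve fun s => u s⁻¹) b -
      D.slope b (u b⁻¹) * deriv (fun s => u s⁻¹) b‖ ≤ R₁ * exp (-(b * G)) := fun b hb => by
    have hb0 : 0 < b := (inv_pos.2 hT₀).trans hb
    have hT : b⁻¹ ≤ T₀ := inv_le_of_inv_le₀ hT₀ hb.le
    refine (ContinuousMap.norm_le _ (by positivity)).2 fun k => ?_
    have hu := F.pos (inv_pos.2 hb0).le hT k
    have he := qpEnergy_pos (D.ξ_pos k) (u b⁻¹ k)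
    have hθ0 := one_sub_tanh_sq_nonneg (b * qpEnergy (D.ξ k) (u b⁻¹ k) / 2)
    have hθ := (one_sub_tanh_sq_le_exp' b (qpEnergy (D.ξ k) (u b⁻¹ k))).trans
      (mul_le_mul_of_nonneg_left (hexp b hb k) (by norm_num))
    have h1 := hEm b hb k
    have h2 := div_qpEnergy_le_one (D.ξ_pos k) (u b⁻¹ k)
    rw [ContinuousMap.sub_apply, ContinuousMap.mul_apply,
      D.deriv_gapCurve_apply F.contDiffOn hb, gapFunDeriv_eq, slope_apply, add_sub_cancel_left,
      Real.norm_eq_abs]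
    set e := qpEnergy (D.ξ k) (u b⁻¹ k)
    rw [abs_of_nonneg (by positivity)]
    calc u b⁻¹ k / e * ((1 - tanh (b * e / 2) ^ 2) * (1 * e) / 2)
        ≤ 1 * ((4 * (exp A * exp (-(b * G)))) * (1 * Em) / 2) := by gcongr
      _ = _ := by rw [hR₁]; ring
  have hR₁0 : 0 ≤ R₁ := by positivity
  have hw₁ : ∀ b, T₀⁻¹ < b → ‖deriv (fun s => u s⁻¹) b‖ ≤ Q * R₁ * exp (-(b * G)) := fun b hb => by
    have h1 := hlin b hb (deriv (fun s => u s⁻¹) b) _ (by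
      rw [add_sub_cancel]; exact F.eqOn_deriv hb)
    exact (h1.trans (mul_le_mul_of_nonneg_left (hr₁ b hb) hQ0)).trans_eq (by ring)
  have hG1 : ∀ b, T₀⁻¹ < b → exp (-(b * G)) ≤ 1 := fun b hb => by
    have hb0 : 0 < b := (inv_pos.2 hT₀).trans hb
    exact exp_le_one_iff.2 (by simp; positivity)
  -- One constant for both the velocity and b times it: exp(-bG) ≤ 1 and b exp(-bG) ≤ 1/G.
  set B := Q * R₁ * (1 + 1 / G) with hB
  have hB1 : ∀ b, T₀⁻¹ < b → ∀ k, |deriv (fun s => u s⁻¹) b k| ≤ B := fun b hb k => by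
    refine ((deriv (fun s => u s⁻¹) b).norm_coe_le_norm k).trans ((hw₁ b hb).trans ?_)
    have := hG1 b hb
    have h2 : 0 ≤ 1 / G := by positivity
    exact mul_le_mul_of_nonneg_left (by linarith) (by positivity)
  have hB2 : ∀ b, T₀⁻¹ < b → ∀ k, b * |deriv (fun s => u s⁻¹) b k| ≤ B := fun b hb k => by
    have hb0 : 0 < b := (inv_pos.2 hT₀).trans hb
    have h1 := ((deriv (fun s => u s⁻¹) b).norm_coe_le_norm k).trans (hw₁ b hb)
    have h2 := mul_exp_neg_mul_le hG0 b
    calc b * |deriv (fun s => u s⁻¹) b k| ≤ b * (Q * R₁ * exp (-(b * G))) :=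
          mul_le_mul_of_nonneg_left h1 hb0.le
      _ = Q * R₁ * (b * exp (-(b * G))) := by ring
      _ ≤ Q * R₁ * (1 + 1 / G) := mul_le_mul_of_nonneg_left (by linarith) (by positivity)
  have hB0 : 0 ≤ B := by positivity
  -- second derivatives
  set R₂ := (3 / D.lo ^ 2 * B + (Em + B) / D.lo + 1 + B / D.lo + (Em + B) ^ 2) *
    (Q * R₁ + 4 * exp A) with hR₂
  have hr₂ : ∀ b, T₀⁻¹ < b → ‖deriv (deriv (D.gapCurve fun s => u s⁻¹)) b -
      D.slope b (u b⁻¹) * deriv (deriv fun s => u s⁻¹) b‖ ≤ R₂ * exp (-(b * G)) := fun b hb => by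
    have hb0 : 0 < b := (inv_pos.2 hT₀).trans hb
    have hT : b⁻¹ ≤ T₀ := inv_le_of_inv_le₀ hT₀ hb.le
    refine (ContinuousMap.norm_le _ (by positivity)).2 fun k => ?_
    have hu := F.pos (inv_pos.2 hb0).le hT k
    have hθ := (one_sub_tanh_sq_le_exp' b (qpEnergy (D.ξ k) (u b⁻¹ k))).trans
      (mul_le_mul_of_nonneg_left (hexp b hb k) (by norm_num))
    rw [ContinuousMap.sub_apply, ContinuousMap.mul_apply,
      D.deriv_deriv_gapCurve_apply F.contDiffOn hb, slope_apply, add_sub_cancel_left,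
      Real.norm_eq_abs]
    refine (abs_gapFunRem_le hlo (D.lo_le k) hb0.le hu.le (hEm b hb k) (hB1 b hb k)
      (hB2 b hb k)).trans ?_
    rw [hR₂, mul_assoc]
    refine mul_le_mul_of_nonneg_left ?_ (by positivity)
    have h1 := ((deriv (fun s => u s⁻¹) b).norm_coe_le_norm k).trans (hw₁ b hb)
    rw [Real.norm_eq_abs] at h1
    linarith
  have hR₂0 : 0 ≤ R₂ := by positivity
  have hw₂ : ∀ b, T₀⁻¹ < b → ‖deriv (deriv fun s => u s⁻¹) b‖ ≤ Q * R₂ * exp (-(b * G)) :=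
    fun b hb => by
      have h1 := hlin b hb (deriv (deriv fun s => u s⁻¹) b) _ (by
        rw [add_sub_cancel]; exact F.eqOn_deriv_deriv hb)
      exact (h1.trans (mul_le_mul_of_nonneg_left (hr₂ b hb) hQ0)).trans_eq (by ring)
  have hg : ∀ b, T₀⁻¹ < b → ∀ z g : C(K, ℝ), ∀ Y R : ℝ, ‖z‖ ≤ Y * exp (-(b * G)) →
      ‖g - D.slope b (u b⁻¹) * z‖ ≤ R * exp (-(b * G)) →
      ‖g‖ ≤ (3 / D.lo * Y + R) * exp (-(b * G)) := fun b hb z g Y R hz h => by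
    calc ‖g‖ = ‖D.slope b (u b⁻¹) * z + (g - D.slope b (u b⁻¹) * z)‖ := by rw [add_sub_cancel]
      _ ≤ ‖D.slope b (u b⁻¹)‖ * ‖z‖ + ‖g - D.slope b (u b⁻¹) * z‖ :=
          (norm_add_le _ _).trans (add_le_add_left (norm_mul_le _ _) _)
      _ ≤ 3 / D.lo * (Y * exp (-(b * G))) + R * exp (-(b * G)) :=
          add_le_add (mul_le_mul (hslope b hb) hz (norm_nonneg _) (by positivity)) h
      _ = _ := by ring
  -- the difference to the state at zero temperature
  have h1 : exp (-(T₀⁻¹ * D.lo)) < 1 := exp_lt_one_iff.2 (by simp; positivity)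
  have h2 : 0 < 1 - exp (-(T₀⁻¹ * D.lo)) := by linarith
  set R₀ := 2 / (1 - exp (-(T₀⁻¹ * D.lo))) * ((M / c) / δ * M) * exp A with hR₀
  have hR₀0 : 0 ≤ R₀ := by positivity
  have hw₀ : ∀ b, T₀⁻¹ < b → ‖u 0 - u b⁻¹‖ ≤ R₀ * exp (-(b * G)) := fun b hb => by
    have hb0 : 0 < b := (inv_pos.2 hT₀).trans hb
    have hT : b⁻¹ ≤ T₀ := inv_le_of_inv_le₀ hT₀ hb.le
    refine (ContinuousMap.norm_le _ (by positivity)).2 fun k => ?_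
    -- G - A/b is a lower bound for the energies at temperature 1/b, and exp(-b(G - A/b)) = e^A
    -- exp(-bG): the loss is only a constant factor.
    have h3 := F.zero_sub_le (inv_pos.2 hb0) hT (a := G - A / b) (fun k => by
      have h4 := hA b hb.le k
      have h5 := hG k
      have h6 : G - A / b ≤ qpEnergy (D.ξ k) (u 0 k) - A / b := by linarith
      refine h6.trans ?_
      rw [← sub_nonneg] at h4 ⊢
      have h7 : qpEnergy (D.ξ k) (u b⁻¹ k) - (qpEnergy (D.ξ k) (u 0 k) - A / b) =
        (b * qpEnergy (D.ξ k) (u b⁻¹ k) - (b * qpEnergy (D.ξ k) (u 0 k) - A)) / b := by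
          field_simp
      rw [h7]
      exact div_nonneg h4 hb0.le) k
    rw [ContinuousMap.sub_apply, Real.norm_eq_abs, abs_of_nonneg (sub_nonneg.2
      (F.anti le_rfl (inv_pos.2 hb0).le hT k))]
    refine h3.trans (le_of_eq ?_)
    have h8 : -(b⁻¹⁻¹ * (G - A / b)) = A + -(b * G) := by
      rw [inv_inv]; field_simp; ring
    rw [h8, exp_add, hR₀]
    ring
  have hgoal : ∃ C, 0 ≤ C ∧ exp A ≤ C ∧ R₀ ≤ C ∧ Q * R₁ ≤ C ∧ Q * R₂ ≤ C ∧
      3 / D.lo * (Q * R₁) + R₁ ≤ C ∧ 3 / D.lo * (Q * R₂) + R₂ ≤ C := by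
    have := exp_pos A
    have : 0 ≤ Q * R₁ := by positivity
    have : 0 ≤ Q * R₂ := by positivity
    have : 0 ≤ 3 / D.lo * (Q * R₁) + R₁ := by positivity
    have : 0 ≤ 3 / D.lo * (Q * R₂) + R₂ := by positivity
    exact ⟨exp A + R₀ + Q * R₁ + Q * R₂ + (3 / D.lo * (Q * R₁) + R₁) +
      (3 / D.lo * (Q * R₂) + R₂), by linarith, by linarith, by linarith, by linarith, by linarith,
      by linarith, by linarith⟩
  obtain ⟨C, hC0, c1, c2, c3, c4, c5, c6⟩ := hgoal
  have hmono : ∀ b x y, x ≤ C → y ≤ x * exp (-(b * G)) → y ≤ C * exp (-(b * G)) :=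
    fun b x y hx hy => hy.trans (mul_le_mul_of_nonneg_right hx (exp_pos _).le)
  exact ⟨C, hC0, fun b hb => ⟨fun k => hmono b _ _ c1 (hexp b hb k), hmono b _ _ c2 (hw₀ b hb),
    hmono b _ _ c3 (hw₁ b hb), hmono b _ _ c4 (hw₂ b hb),
    hmono b _ _ c5 (hg b hb _ _ _ _ (hw₁ b hb) (hr₁ b hb)),
    hmono b _ _ c6 (hg b hb _ _ _ _ (hw₂ b hb) (hr₂ b hb))⟩⟩

end IsFamily

end GapKernel

end Curves

/-! ### The entropy of a single fermionic mode. -/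

section EntropyFunction

/-- `a ↦ log (1 + exp (-a))` as a continuous map. -/
noncomputable def logOneAddExpNeg : C(ℝ, ℝ) :=
  ⟨fun a => log (1 + exp (-a)), Continuous.log (by fun_prop) fun a => by positivity⟩

/-- The entropy of a fermionic mode, as a function of energy over temperature. -/
noncomputable def modeEntropy : C(ℝ, ℝ) :=
  ⟨fun a => log (1 + exp (-a)) + a / (exp a + 1),
    (Continuous.log (by fun_prop) fun a => by positivity).add
      (continuous_id.div (by fun_prop) fun a => by positivity)⟩

/-- The derivative of `modeEntropy`. -/
noncomputable def modeEntropyDeriv : C(ℝ, ℝ) :=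
  ⟨fun a => -(a * exp a / (exp a + 1) ^ 2),
    ((continuous_id.mul continuous_exp).div (by fun_prop) fun a => by positivity).neg⟩

theorem logOneAddExpNeg_apply (a : ℝ) : logOneAddExpNeg a = log (1 + exp (-a)) := rfl

theorem modeEntropy_apply (a : ℝ) : modeEntropy a = log (1 + exp (-a)) + a / (exp a + 1) := rfl

theorem modeEntropyDeriv_apply (a : ℝ) :
    modeEntropyDeriv a = -(a * exp a / (exp a + 1) ^ 2) := rfl

theorem hasDerivAt_logOneAddExpNeg (a : ℝ) :
    HasDerivAt logOneAddExpNeg (-(1 / (exp a + 1))) a := by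
  have h1 : HasDerivAt (fun a => log (1 + exp (-a))) _ a :=
    (((hasDerivAt_neg' a).exp).const_add 1).log (by positivity)
  refine HasDerivAt.congr_deriv h1 ?_
  have := exp_pos a
  rw [exp_neg]
  field_simp

theorem hasDerivAt_modeEntropy (a : ℝ) : HasDerivAt modeEntropy (modeEntropyDeriv a) a := by
  have h1 : HasDerivAt (fun a => log (1 + exp (-a))) _ a := hasDerivAt_logOneAddExpNeg a
  have h2 := (hasDerivAt_id' a).fun_div ((Real.hasDerivAt_exp a).add_const 1)
    (by positivity : exp a + 1 ≠ 0)
  refine HasDerivAt.congr_deriv (h1.fun_add h2) ?_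
  have := exp_pos a
  rw [modeEntropyDeriv_apply]
  field_simp
  ring

theorem modeEntropy_nonneg {a : ℝ} (ha : 0 ≤ a) : 0 ≤ modeEntropy a := by
  have := exp_pos (-a)
  have : 0 ≤ log (1 + exp (-a)) := log_nonneg (by linarith)
  rw [modeEntropy_apply]
  positivity

theorem modeEntropy_le {a : ℝ} (ha : 0 ≤ a) : modeEntropy a ≤ (1 + a) * exp (-a) := by
  have h0 := exp_pos (-a)
  have h1 := log_le_sub_one_of_pos (show 0 < 1 + exp (-a) by positivity)
  have h2 : a / (exp a + 1) ≤ a * exp (-a) := by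
    rw [exp_neg, ← div_eq_mul_inv]
    have := exp_pos a
    gcongr
    linarith
  rw [modeEntropy_apply]
  linarith

theorem abs_modeEntropyDeriv_le {a : ℝ} (ha : 0 ≤ a) : |modeEntropyDeriv a| ≤ a * exp (-a) := by
  have h0 := exp_pos a
  rw [modeEntropyDeriv_apply, abs_neg, abs_of_nonneg (by positivity), exp_neg, ← div_eq_mul_inv,
    div_le_div_iff₀ (by positivity) h0]
  have : exp a * exp a ≤ (exp a + 1) ^ 2 := by nlinarith
  nlinarith [mul_le_mul_of_nonneg_left this ha]

theorem logOneAddExpNeg_nonneg (a : ℝ) : 0 ≤ logOneAddExpNeg a := by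
  have := exp_pos (-a)
  exact log_nonneg (by linarith)

theorem logOneAddExpNeg_le_one {a : ℝ} (ha : 0 ≤ a) : logOneAddExpNeg a ≤ 1 := by
  have h0 : exp (-a) ≤ 1 := exp_le_one_iff.2 (by linarith)
  have h1 := log_le_sub_one_of_pos (show 0 < 1 + exp (-a) by positivity)
  rw [logOneAddExpNeg_apply]
  linarith

open scoped ContDiff

theorem contDiff_logOneAddExpNeg : ContDiff ℝ ∞ logOneAddExpNeg := by
  show ContDiff ℝ ∞ fun a : ℝ => log (1 + exp (-a))
  exact ContDiff.log (by fun_prop) fun a => by positivity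

theorem contDiff_modeEntropy : ContDiff ℝ ∞ modeEntropy := by
  show ContDiff ℝ ∞ fun a : ℝ => log (1 + exp (-a)) + a / (exp a + 1)
  exact contDiff_logOneAddExpNeg.add (contDiff_id.div (by fun_prop) fun a => by positivity)

end EntropyFunction

/-! ### Derivatives of the thermodynamic potential along smooth curves of gap functions. -/

section Thermodynamics

theorem eventually_pos_and_lt_inv {T b₀ : ℝ} (hT : 0 < T) (hb : b₀ < T⁻¹) :
    ∀ᶠ t in 𝓝 T, 0 < t ∧ b₀ < t⁻¹ := by
  have h1 : ∀ᶠ t in 𝓝 T, b₀ < t⁻¹ := (continuousAt_inv₀ hT.ne').eventually (Ioi_mem_nhds hb)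
  filter_upwards [Ioi_mem_nhds hT, h1] with t ht ht' using ⟨ht, ht'⟩

variable {K : Type*} [TopologicalSpace K] [CompactSpace K]

namespace GapKernel

variable (D : GapKernel K) {w : ℝ → C(K, ℝ)} {b₀ : ℝ}

/-- The density of the thermodynamic potential along a curve of gap functions. -/
noncomputable def potCurve (w : ℝ → C(K, ℝ)) (b : ℝ) : C(K, ℝ) :=
  (-2 : ℝ) • D.energy (w b) + w b * D.gapCurve w b -
    (4 / b) • logOneAddExpNeg.comp (b • D.energy (w b))

/-- The density of the entropy along a curve of gap functions. -/
noncomputable def entCurve (w : ℝ → C(K, ℝ)) (b : ℝ) : C(K, ℝ) :=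
  b ^ 2 • (w b * deriv (D.gapCurve w) b - deriv w b * D.gapCurve w b) +
    (4 : ℝ) • modeEntropy.comp (b • D.energy (w b))

/-- The derivative of `entCurve`. -/
noncomputable def entCurveDeriv (w : ℝ → C(K, ℝ)) (b : ℝ) : C(K, ℝ) :=
  (2 * b) • (w b * deriv (D.gapCurve w) b - deriv w b * D.gapCurve w b) +
    b ^ 2 • (w b * deriv (deriv (D.gapCurve w)) b - deriv (deriv w) b * D.gapCurve w b) +
    (4 : ℝ) • (modeEntropyDeriv.comp (b • D.energy (w b)) *
      (D.energy (w b) + b • (D.ratio (w b) * deriv w b)))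

open scoped ContDiff

theorem contDiffOn_energy_comp (hw : ContDiffOn ℝ ∞ w (Ioi b₀)) :
    ContDiffOn ℝ ∞ (fun b => D.energy (w b)) (Ioi b₀) :=
  D.contDiff_energy.comp_contDiffOn hw

theorem contDiffOn_postcomp_energy (hw : ContDiffOn ℝ ∞ w (Ioi b₀)) {g : C(ℝ, ℝ)}
    (hg : ContDiff ℝ ∞ g) : ContDiffOn ℝ ∞ (fun b => g.comp (b • D.energy (w b))) (Ioi b₀) :=
  (ContinuousMap.contDiff_postcomp g hg).comp_contDiffOn
    (contDiffOn_id.smul (D.contDiffOn_energy_comp hw))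

/-- The gap equation is not needed here. With ρ = w/e and tanh(be/2) = 1 - 2/(exp(be) + 1), the
terms -2ρw' and 4ρw'/(exp(be) + 1) combine to -2w'g; together with (wg)' this leaves the Wronskian w
g' - w' g, and the rest is the mode entropy over b². -/
theorem hasDerivAt_potCurve (hb₀ : 0 ≤ b₀) (hw : ContDiffOn ℝ ∞ w (Ioi b₀)) {b : ℝ} (hb : b₀ < b) :
    HasDerivAt (D.potCurve w) ((b ^ 2)⁻¹ • D.entCurve w b) b := by
  have hbpos : 0 < b := hb₀.trans_lt hb
  have hsm : ContDiffOn ℝ ∞ (D.potCurve w) (Ioi b₀) := by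
    unfold potCurve
    have h4 : ContDiffOn ℝ ∞ (fun b : ℝ => 4 / b) (Ioi b₀) :=
      contDiffOn_const.div contDiffOn_id fun x hx => (hb₀.trans_lt hx).ne'
    exact (((D.contDiffOn_energy_comp hw).const_smul (-2 : ℝ)).add
      (hw.mul (D.contDiffOn_gapCurve hw))).sub
        (h4.smul (D.contDiffOn_postcomp_energy hw contDiff_logOneAddExpNeg))
  refine (hsm.hasDerivAt_Ioi hb).congr_deriv ?_
  ext k
  have h1 := hasDerivAt_eval (hsm.hasDerivAt_Ioi hb) k
  have hx := D.ξ_pos k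
  have he := (qpEnergy_pos hx (w b k)).ne'
  have hwk := hasDerivAt_eval (hw.hasDerivAt_Ioi hb) k
  have hE := hasDerivAt_qpEnergy hx hwk
  have hg := hasDerivAt_eval ((D.contDiffOn_gapCurve hw).hasDerivAt_Ioi hb) k
  have hl := (hasDerivAt_logOneAddExpNeg (b * qpEnergy (D.ξ k) (w b k))).comp b
    ((hasDerivAt_id' b).fun_mul hE)
  have h2 := ((hE.const_mul (-2)).fun_add (hwk.fun_mul hg)).fun_sub
    (((hasDerivAt_const b (4 : ℝ)).fun_div (hasDerivAt_id' b) hbpos.ne').fun_mul hl)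
  refine (h1.unique (h2.congr_of_eventuallyEq (Eventually.of_forall fun t => ?_))).trans ?_
  · simp [potCurve]
  · have htanh : D.gapCurve w b k = w b k / qpEnergy (D.ξ k) (w b k) *
        tanh (b * qpEnergy (D.ξ k) (w b k) / 2) := by simp [gapCurve, gapFun]
    simp only [entCurve, ContinuousMap.smul_apply, ContinuousMap.add_apply,
      ContinuousMap.sub_apply, ContinuousMap.mul_apply, ContinuousMap.comp_apply, smul_eq_mul,
      energy_apply, modeEntropy_apply, Function.comp_def, logOneAddExpNeg_apply, htanh]
    generalize deriv (D.gapCurve w) b k = g'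
    generalize deriv w b k = w'
    generalize qpEnergy (D.ξ k) (w b k) = e at he
    have ht : tanh (b * e / 2) = 1 - 2 / (exp (b * e) + 1) := by
      rw [tanh_eq_exp, show -2 * (b * e / 2) = -(b * e) by ring, exp_neg]
      have := exp_pos (b * e)
      field_simp
      ring
    rw [ht]
    have := exp_pos (b * e)
    generalize log (1 + exp (-(b * e))) = l
    generalize exp (b * e) = E at this
    field_simp
    ring

theorem hasDerivAt_entCurve (hw : ContDiffOn ℝ ∞ w (Ioi b₀)) {b : ℝ} (hb : b₀ < b) :
    HasDerivAt (D.entCurve w) (D.entCurveDeriv w b) b := by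
  have hg := D.contDiffOn_gapCurve hw
  have hsm : ContDiffOn ℝ ∞ (D.entCurve w) (Ioi b₀) := by
    unfold entCurve
    exact ((contDiffOn_id.pow 2).smul ((hw.mul hg.deriv_Ioi).sub (hw.deriv_Ioi.mul hg))).add
      ((D.contDiffOn_postcomp_energy hw contDiff_modeEntropy).const_smul (4 : ℝ))
  refine (hsm.hasDerivAt_Ioi hb).congr_deriv ?_
  ext k
  have h1 := hasDerivAt_eval (hsm.hasDerivAt_Ioi hb) k
  have hx := D.ξ_pos k
  have hwk := hasDerivAt_eval (hw.hasDerivAt_Ioi hb) k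
  have hwk' := hasDerivAt_eval (hw.deriv_Ioi.hasDerivAt_Ioi hb) k
  have hE := hasDerivAt_qpEnergy hx hwk
  have hgk := hasDerivAt_eval (hg.hasDerivAt_Ioi hb) k
  have hgk' := hasDerivAt_eval (hg.deriv_Ioi.hasDerivAt_Ioi hb) k
  have hs := (hasDerivAt_modeEntropy (b * qpEnergy (D.ξ k) (w b k))).comp b
    ((hasDerivAt_id' b).fun_mul hE)
  have h2 := (((hasDerivAt_id' b).fun_pow 2).fun_mul ((hwk.fun_mul hgk').fun_sub
    (hwk'.fun_mul hgk))).fun_add (hs.const_mul 4)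
  refine (h1.unique (h2.congr_of_eventuallyEq (Eventually.of_forall fun t => ?_))).trans ?_
  · simp [entCurve]
  · simp only [entCurveDeriv, ContinuousMap.smul_apply, ContinuousMap.add_apply,
      ContinuousMap.sub_apply, ContinuousMap.mul_apply, ContinuousMap.comp_apply, smul_eq_mul,
      energy_apply, ratio_apply]
    push_cast
    ring

section Potential

variable {Ω : ℝ → ℝ} {N₀ : ℝ} {J : C(K, ℝ) →L[ℝ] ℝ} (hb₀ : 0 ≤ b₀) (hw : ContDiffOn ℝ ∞ w (Ioi b₀))
  (hΩ : ∀ T, 0 < T → b₀ < T⁻¹ → Ω T = N₀ * J (D.potCurve w T⁻¹))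
include hb₀ hw hΩ

/-- The chain rule for b = 1/T contributes -b², which cancels the factor (b²)⁻¹ of the density's
derivative. -/
theorem hasDerivAt_potential {T : ℝ} (hT : 0 < T) (hb : b₀ < T⁻¹) :
    HasDerivAt Ω (-(N₀ * J (D.entCurve w T⁻¹))) T := by
  have h1 := (D.hasDerivAt_potCurve hb₀ hw hb).scomp T (hasDerivAt_inv hT.ne')
  have h2 := (J.hasFDerivAt.comp_hasDerivAt T h1).const_mul N₀
  refine (h2.congr_of_eventuallyEq ?_).congr_deriv ?_
  · filter_upwards [eventually_pos_and_lt_inv hT hb] with t ht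
    exact hΩ t ht.1 ht.2
  · rw [map_smul, map_smul, smul_eq_mul, smul_eq_mul]
    field_simp

theorem derivWithin_potential {T : ℝ} (hT : 0 < T) (hb : b₀ < T⁻¹) :
    derivWithin Ω (Ici 0) T = -(N₀ * J (D.entCurve w T⁻¹)) := by
  rw [derivWithin_of_mem_nhds (Ici_mem_nhds hT)]
  exact (D.hasDerivAt_potential hb₀ hw hΩ hT hb).deriv

theorem hasDerivAt_derivWithin_potential {T : ℝ} (hT : 0 < T) (hb : b₀ < T⁻¹) :
    HasDerivAt (derivWithin Ω (Ici 0)) ((T ^ 2)⁻¹ * (N₀ * J (D.entCurveDeriv w T⁻¹))) T := by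
  have h1 := (D.hasDerivAt_entCurve hw hb).scomp T (hasDerivAt_inv hT.ne')
  have h2 := ((J.hasFDerivAt.comp_hasDerivAt T h1).const_mul N₀).fun_neg
  refine (h2.congr_of_eventuallyEq ?_).congr_deriv ?_
  · filter_upwards [eventually_pos_and_lt_inv hT hb] with t ht
    exact D.derivWithin_potential hb₀ hw hΩ ht.1 ht.2
  · rw [map_smul, smul_eq_mul]
    ring

theorem twiceDiffAt_potential {T : ℝ} (hT : 0 < T) (hb : b₀ < T⁻¹) : TwiceDiffAt Ω T := by
  refine ⟨?_, (D.hasDerivAt_derivWithin_potential hb₀ hw hΩ hT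
    hb).differentiableAt.differentiableWithinAt⟩
  refine nhdsWithin_le_nhds ?_
  filter_upwards [eventually_pos_and_lt_inv hT hb] with t ht
  exact (D.hasDerivAt_potential hb₀ hw hΩ ht.1 ht.2).differentiableAt.differentiableWithinAt

theorem entropy_potential {T : ℝ} (hT : 0 < T) (hb : b₀ < T⁻¹) :
    entropy Ω T = N₀ * J (D.entCurve w T⁻¹) := by
  rw [entropy, D.derivWithin_potential hb₀ hw hΩ hT hb, neg_neg]

theorem specificHeat_potential {T : ℝ} (hT : 0 < T) (hb : b₀ < T⁻¹) :
    specificHeat Ω T = -(T⁻¹ * (N₀ * J (D.entCurveDeriv w T⁻¹))) := by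
  rw [specificHeat, derivWithin_of_mem_nhds (Ici_mem_nhds hT),
    (D.hasDerivAt_derivWithin_potential hb₀ hw hΩ hT hb).deriv]
  field_simp

end Potential

end GapKernel

end Thermodynamics

/-! ### Behaviour of the potential, entropy and specific heat as T tends to 0. -/

section LowTemperature

variable {K : Type*} [TopologicalSpace K] [CompactSpace K]

theorem tendsto_pow_mul_exp_neg_mul {G : ℝ} (hG : 0 < G) (n : ℕ) :
    Tendsto (fun b => b ^ n * exp (-(b * G))) atTop (𝓝 0) := by
  have h1 : Tendsto (fun b : ℝ => b * G) atTop atTop := tendsto_id.atTop_mul_const hG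
  have h2 := ((tendsto_pow_mul_exp_neg_atTop_nhds_zero n).comp h1).const_mul ((G ^ n)⁻¹)
  rw [mul_zero] at h2
  refine h2.congr fun b => ?_
  simp only [Function.comp_apply]
  field_simp
  ring

namespace GapKernel

variable {D : GapKernel K} {u : ℝ → C(K, ℝ)} {T₀ c M : ℝ}

theorem norm_gapB_le (D : GapKernel K) {b : ℝ} (hb : 0 ≤ b) {v : C(K, ℝ)} (hv : ∀ k, 0 ≤ v k) :
    ‖D.gapB b v‖ ≤ 1 := by
  refine (ContinuousMap.norm_le _ zero_le_one).2 fun k => ?_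
  have hx := D.ξ_pos k
  have he := qpEnergy_pos hx (v k)
  have h1 := div_qpEnergy_le_one hx (v k)
  have h2 : 0 ≤ v k / qpEnergy (D.ξ k) (v k) := div_nonneg (hv k) he.le
  have h3 : 0 ≤ tanh (b * qpEnergy (D.ξ k) (v k) / 2) := tanh_nonneg_of_nonneg (by positivity)
  rw [gapB_apply, gapFun, Real.norm_eq_abs, abs_of_nonneg (by positivity)]
  exact mul_le_one₀ h1 h3 (tanh_lt_one _).le

namespace IsFamily

variable (F : D.IsFamily u T₀ c M)
include F

theorem qpEnergy_le {T : ℝ} (h0 : 0 ≤ T) (h : T ≤ T₀) (k : K) :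
    qpEnergy (D.ξ k) (u T k) ≤ qpEnergy D.hi M := by
  have h1 := F.upper _ h0 h k
  have h2 := F.pos h0 h k
  have h3 := D.ξ_pos k
  have h4 := D.le_hi k
  exact Real.sqrt_le_sqrt (by gcongr)

theorem norm_le {T : ℝ} (h0 : 0 ≤ T) (h : T ≤ T₀) : ‖u T‖ ≤ M :=
  (ContinuousMap.norm_le _ F.M_pos.le).2 fun k => by
    rw [Real.norm_eq_abs, abs_of_pos (F.pos h0 h k)]
    exact F.upper T h0 h k

theorem norm_wronskian_le {b C₁ C₂ : ℝ} (hb : T₀⁻¹ < b) {z g : C(K, ℝ)} (hg : ‖g‖ ≤ C₁)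
    (hz : ‖z‖ ≤ C₂) :
    ‖u b⁻¹ * g - z * D.gapCurve (fun s => u s⁻¹) b‖ ≤ M * C₁ + C₂ := by
  have hb0 : 0 < b := (inv_pos.2 F.T₀_pos).trans hb
  have hT : b⁻¹ ≤ T₀ := inv_le_of_inv_le₀ F.T₀_pos hb.le
  have h1 := F.norm_le (inv_pos.2 hb0).le hT
  have h2 : ‖D.gapCurve (fun s => u s⁻¹) b‖ ≤ 1 :=
    D.norm_gapB_le hb0.le fun k => (F.pos (inv_pos.2 hb0).le hT k).le
  have hM := F.M_pos
  calc _ ≤ ‖u b⁻¹‖ * ‖g‖ + ‖z‖ * ‖D.gapCurve (fun s => u s⁻¹) b‖ :=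
        (_root_.norm_sub_le _ _).trans (add_le_add (norm_mul_le _ _) (norm_mul_le _ _))
    _ ≤ M * C₁ + C₂ * 1 := by
        have := (norm_nonneg z).trans hz
        gcongr
    _ = _ := by ring

/-- The Wronskian terms inherit the decay of the derivatives, and the mode entropy and its
derivative that of exp(-bE). Lower powers of b are absorbed into b² through 1 ≤ b T₀. -/
theorem exists_entCurve_bounds {G : ℝ} (hG0 : 0 < G)
    (hG : ∀ k, G ≤ qpEnergy (D.ξ k) (u 0 k)) :
    ∃ C, 0 ≤ C ∧ ∀ b, T₀⁻¹ < b →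
      ‖D.entCurve (fun s => u s⁻¹) b‖ ≤ C * (b ^ 2 * exp (-(b * G))) ∧
      ‖D.entCurveDeriv (fun s => u s⁻¹) b‖ ≤ C * (b ^ 2 * exp (-(b * G))) := by
  obtain ⟨C, hC0, hC⟩ := F.exists_bounds hG0 hG
  have hM := F.M_pos
  have hT₀ := F.T₀_pos
  set Em := qpEnergy D.hi M with hEm
  have hEm0 : 0 < Em := qpEnergy_pos (D.lo_pos.trans_le D.lo_le_hi) _
  have main : ∀ b, T₀⁻¹ < b →
      ‖D.entCurve (fun s => u s⁻¹) b‖ ≤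
        ((M + 1) * C + 4 * C * (T₀ ^ 2 + T₀ * Em)) * (b ^ 2 * exp (-(b * G))) ∧
      ‖D.entCurveDeriv (fun s => u s⁻¹) b‖ ≤
        ((2 * T₀ + 1) * (M + 1) * C + 4 * (T₀ * Em * C) * (Em + C * (1 / G))) *
          (b ^ 2 * exp (-(b * G))) := fun b hb => by
    obtain ⟨hexp, -, hw₁, hw₂, hg₁, hg₂⟩ := hC b hb
    have hb0 : 0 < b := (inv_pos.2 hT₀).trans hb
    have hT : b⁻¹ ≤ T₀ := inv_le_of_inv_le₀ hT₀ hb.le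
    have hbT : 1 ≤ b * T₀ := by
      rw [← div_le_iff₀ hT₀, one_div]; exact hb.le
    have hW₁ := F.norm_wronskian_le hb hg₁ hw₁
    have hW₂ := F.norm_wronskian_le hb hg₂ hw₂
    have hX := exp_pos (-(b * G))
    have hbX := mul_exp_neg_mul_le hG0 b
    set X := exp (-(b * G))
    have hG' : 0 < 1 / G := by positivity
    constructor
    · refine (ContinuousMap.norm_le _ (by positivity)).2 fun k => ?_
      have he := qpEnergy_pos (D.ξ_pos k) (u b⁻¹ k)
      have heEm := F.qpEnergy_le (inv_pos.2 hb0).le hT k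
      have hm := modeEntropy_le (a := b * qpEnergy (D.ξ k) (u b⁻¹ k)) (by positivity)
      have hm0 := modeEntropy_nonneg (a := b * qpEnergy (D.ξ k) (u b⁻¹ k)) (by positivity)
      have hWk := (ContinuousMap.norm_coe_le_norm _ k).trans hW₁
      simp only [entCurve, ContinuousMap.add_apply, ContinuousMap.smul_apply,
        ContinuousMap.comp_apply, energy_apply, smul_eq_mul]
      refine (norm_add_le _ _).trans ?_
      rw [norm_mul, norm_mul, Real.norm_of_nonneg (by positivity : (0 : ℝ) ≤ b ^ 2),
        Real.norm_of_nonneg hm0, Real.norm_of_nonneg (by norm_num : (0 : ℝ) ≤ 4)]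
      have h5 : (1 + b * qpEnergy (D.ξ k) (u b⁻¹ k)) *
          exp (-(b * qpEnergy (D.ξ k) (u b⁻¹ k))) ≤ (1 + b * Em) * (C * X) := by
        gcongr
        exact hexp k
      have h6 : (1 + b * Em) ≤ b ^ 2 * (T₀ ^ 2 + T₀ * Em) := by
        have h7 : 1 ≤ (b * T₀) ^ 2 := one_le_pow₀ hbT
        have h8 : b * Em ≤ (b * Em) * (b * T₀) := le_mul_of_one_le_right (by positivity) hbT
        nlinarith
      calc _ ≤ b ^ 2 * (M * (C * X) + C * X) + 4 * (b ^ 2 * (T₀ ^ 2 + T₀ * Em) * (C * X)) := by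
            gcongr
            exact hm.trans (h5.trans (mul_le_mul_of_nonneg_right h6 (by positivity)))
        _ = _ := by ring
    · refine (ContinuousMap.norm_le _ (by positivity)).2 fun k => ?_
      have he := qpEnergy_pos (D.ξ_pos k) (u b⁻¹ k)
      have heEm := F.qpEnergy_le (inv_pos.2 hb0).le hT k
      have hm := abs_modeEntropyDeriv_le (a := b * qpEnergy (D.ξ k) (u b⁻¹ k)) (by positivity)
      have hWk₁ := (ContinuousMap.norm_coe_le_norm _ k).trans hW₁
      have hWk₂ := (ContinuousMap.norm_coe_le_norm _ k).trans hW₂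
      have hwk := (ContinuousMap.norm_coe_le_norm _ k).trans hw₁
      have hρ1 := div_qpEnergy_le_one (D.ξ_pos k) (u b⁻¹ k)
      have hu := F.pos (inv_pos.2 hb0).le hT k
      have h4 : ‖qpEnergy (D.ξ k) (u b⁻¹ k) + b * (u b⁻¹ k / qpEnergy (D.ξ k) (u b⁻¹ k) *
          deriv (fun s => u s⁻¹) b k)‖ ≤ Em + C * (1 / G) := by
        refine (norm_add_le _ _).trans ?_
        rw [norm_mul, norm_mul, Real.norm_of_nonneg he.le, Real.norm_of_nonneg hb0.le,
          Real.norm_of_nonneg (by positivity :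
            0 ≤ u b⁻¹ k / qpEnergy (D.ξ k) (u b⁻¹ k))]
        have h9 : b * (u b⁻¹ k / qpEnergy (D.ξ k) (u b⁻¹ k) * ‖deriv (fun s => u s⁻¹) b k‖) ≤
            b * (1 * (C * X)) := by gcongr
        have h10 : C * (b * X) ≤ C * (1 / G) := by gcongr
        linarith
      simp only [entCurveDeriv, ContinuousMap.add_apply, ContinuousMap.smul_apply,
        ContinuousMap.comp_apply, energy_apply, smul_eq_mul, ContinuousMap.mul_apply, ratio_apply]
      refine (norm_add_le _ _).trans ((add_le_add_left (norm_add_le _ _) _).trans ?_)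
      rw [norm_mul (2 * b), norm_mul (b ^ 2), norm_mul 4, norm_mul (modeEntropyDeriv _),
        Real.norm_of_nonneg (by positivity : (0 : ℝ) ≤ b ^ 2),
        Real.norm_of_nonneg (by positivity : (0 : ℝ) ≤ 2 * b),
        Real.norm_of_nonneg (by norm_num : (0 : ℝ) ≤ 4)]
      rw [← Real.norm_eq_abs] at hm
      have h5 : b * qpEnergy (D.ξ k) (u b⁻¹ k) *
          exp (-(b * qpEnergy (D.ξ k) (u b⁻¹ k))) ≤ b * Em * (C * X) := by
        gcongr
        exact hexp k
      have h6 : b ≤ b ^ 2 * T₀ := by nlinarith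
      calc _ ≤ 2 * b * (M * (C * X) + C * X) + b ^ 2 * (M * (C * X) + C * X) +
            4 * ((b * Em * (C * X)) * (Em + C * (1 / G))) := by
            gcongr
            exact hm.trans h5
        _ ≤ 2 * (b ^ 2 * T₀) * (M * (C * X) + C * X) + b ^ 2 * (M * (C * X) + C * X) +
            4 * (((b ^ 2 * T₀) * Em * (C * X)) * (Em + C * (1 / G))) := by
            gcongr
        _ = _ := by ring
  have hG' : 0 < 1 / G := by positivity
  have p1 : 0 ≤ (M + 1) * C + 4 * C * (T₀ ^ 2 + T₀ * Em) := by positivity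
  have p2 : 0 ≤ (2 * T₀ + 1) * (M + 1) * C + 4 * (T₀ * Em * C) * (Em + C * (1 / G)) := by positivity
  refine ⟨_, add_nonneg p1 p2, fun b hb => ⟨(main b hb).1.trans ?_, (main b hb).2.trans ?_⟩⟩
  · have hX := exp_pos (-(b * G))
    exact mul_le_mul_of_nonneg_right (by linarith) (by positivity)
  · have hX := exp_pos (-(b * G))
    exact mul_le_mul_of_nonneg_right (by linarith) (by positivity)

omit F in
theorem lo_le_energy_zero : ∀ k, D.lo ≤ qpEnergy (D.ξ k) (u 0 k) :=
  fun k => (D.lo_le k).trans (le_qpEnergy _ _)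

theorem tendsto_atTop : Tendsto (fun b => u b⁻¹) atTop (𝓝 (u 0)) := by
  obtain ⟨C, hC0, hC⟩ := F.exists_bounds D.lo_pos lo_le_energy_zero
  rw [tendsto_iff_norm_sub_tendsto_zero]
  have h1 := (tendsto_pow_mul_exp_neg_mul D.lo_pos 0).const_mul C
  rw [mul_zero] at h1
  refine squeeze_zero' (Eventually.of_forall fun _ => norm_nonneg _) ?_ h1
  filter_upwards [eventually_gt_atTop T₀⁻¹] with b hb
  rw [norm_sub_rev, pow_zero, one_mul]
  exact (hC b hb).2.1

/-- The density of the thermodynamic potential is continuous at zero temperature. -/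
theorem tendsto_potCurve : Tendsto (D.potCurve fun s => u s⁻¹) atTop
    (𝓝 ((-2 : ℝ) • D.energy (u 0) + u 0 * D.ratio (u 0))) := by
  have hM := F.M_pos
  have hlo := D.lo_pos
  have h1 := (D.contDiff_energy.continuous.tendsto (u 0)).comp F.tendsto_atTop
  have h2 := (D.contDiff_ratio.continuous.tendsto (u 0)).comp F.tendsto_atTop
  have h3 : Tendsto (fun b => u b⁻¹ * D.ratio (u b⁻¹) - u b⁻¹ * D.gapCurve (fun s => u s⁻¹) b)
      atTop (𝓝 0) := by
    rw [tendsto_zero_iff_norm_tendsto_zero]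
    have h4 := (tendsto_pow_mul_exp_neg_mul D.lo_pos 0).const_mul (M * 4)
    rw [mul_zero] at h4
    refine squeeze_zero' (Eventually.of_forall fun _ => norm_nonneg _) ?_ h4
    filter_upwards [eventually_gt_atTop T₀⁻¹] with b hb
    have hb0 : 0 < b := (inv_pos.2 F.T₀_pos).trans hb
    have hT : b⁻¹ ≤ T₀ := inv_le_of_inv_le₀ F.T₀_pos hb.le
    refine (ContinuousMap.norm_le _ (by positivity)).2 fun k => ?_
    have hu := F.pos (inv_pos.2 hb0).le hT k
    have huM := F.upper _ (inv_pos.2 hb0).le hT k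
    have he := qpEnergy_pos (D.ξ_pos k) (u b⁻¹ k)
    have hρ1 := div_qpEnergy_le_one (D.ξ_pos k) (u b⁻¹ k)
    have hle : D.lo ≤ qpEnergy (D.ξ k) (u b⁻¹ k) := (D.lo_le k).trans (le_qpEnergy _ _)
    simp only [ContinuousMap.sub_apply, ContinuousMap.mul_apply, ratio_apply, gapCurve, gapB_apply,
      gapFun]
    set e := qpEnergy (D.ξ k) (u b⁻¹ k)
    have hτ0 : 0 ≤ tanh (b * e / 2) := tanh_nonneg_of_nonneg (by positivity)
    have hτ1 := tanh_lt_one (b * e / 2)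
    have hθ := one_sub_tanh_sq_le_exp' b e
    have h5 : exp (-(b * e)) ≤ exp (-(b * D.lo)) := exp_le_exp.2 (by nlinarith)
    have h6 : 1 - tanh (b * e / 2) ≤ 4 * exp (-(b * D.lo)) := by nlinarith
    have h7 : 0 ≤ 1 - tanh (b * e / 2) := by linarith
    rw [show u b⁻¹ k * (u b⁻¹ k / e) - u b⁻¹ k * (u b⁻¹ k / e * tanh (b * e / 2)) =
      u b⁻¹ k * (u b⁻¹ k / e) * (1 - tanh (b * e / 2)) by ring,
      Real.norm_of_nonneg (by positivity)]
    calc u b⁻¹ k * (u b⁻¹ k / e) * (1 - tanh (b * e / 2)) ≤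
          M * 1 * (4 * exp (-(b * D.lo))) := by gcongr
      _ = _ := by ring
  have h8 : Tendsto (fun b => (4 / b) • logOneAddExpNeg.comp (b • D.energy (u b⁻¹)))
      atTop (𝓝 0) := by
    rw [tendsto_zero_iff_norm_tendsto_zero]
    refine squeeze_zero' (Eventually.of_forall fun _ => norm_nonneg _) ?_
      (tendsto_const_nhds (x := (4 : ℝ)).div_atTop tendsto_id)
    filter_upwards [eventually_gt_atTop 0] with b hb
    have h9 : (0 : ℝ) ≤ 4 / b := by positivity
    refine (ContinuousMap.norm_le _ h9).2 fun k => ?_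
    have he := qpEnergy_pos (D.ξ_pos k) (u b⁻¹ k)
    simp only [ContinuousMap.smul_apply, ContinuousMap.comp_apply, smul_eq_mul, energy_apply,
      norm_mul]
    rw [Real.norm_of_nonneg h9, Real.norm_of_nonneg (logOneAddExpNeg_nonneg _)]
    exact mul_le_of_le_one_right h9 (logOneAddExpNeg_le_one (by positivity))
  have h10 := (((h1.const_smul (-2 : ℝ)).add (F.tendsto_atTop.mul h2)).sub h3).sub h8
  rw [sub_zero, sub_zero] at h10
  refine h10.congr fun b => ?_
  simp only [potCurve, Function.comp_apply]
  abel

section Potential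

variable {Ω : ℝ → ℝ} {N₀ : ℝ} {J : C(K, ℝ) →L[ℝ] ℝ}
  (hΩ : ∀ T, 0 < T → T₀⁻¹ < T⁻¹ → Ω T = N₀ * J (D.potCurve (fun s => u s⁻¹) T⁻¹))

omit F in
theorem lt_inv {T : ℝ} (hT : T ∈ Ioo 0 T₀) : T₀⁻¹ < T⁻¹ := inv_strictAnti₀ hT.1 hT.2

section
include hΩ

theorem exists_abs_entropy_le {G : ℝ} (hG0 : 0 < G) (hG : ∀ k, G ≤ qpEnergy (D.ξ k) (u 0 k)) :
    ∃ C, 0 ≤ C ∧ ∀ T ∈ Ioo 0 T₀,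
      |entropy Ω T| ≤ C * (T⁻¹ ^ 2 * exp (-(T⁻¹ * G))) ∧
      |specificHeat Ω T| ≤ C * (T⁻¹ ^ 3 * exp (-(T⁻¹ * G))) := by
  obtain ⟨C, hC0, hC⟩ := F.exists_entCurve_bounds hG0 hG
  have hb₀ := (inv_pos.2 F.T₀_pos).le
  refine ⟨|N₀| * (‖J‖ * C), by positivity, fun T hT => ?_⟩
  have hb := lt_inv hT
  obtain ⟨h1, h2⟩ := hC _ hb
  have hT0 := hT.1
  rw [D.entropy_potential hb₀ F.contDiffOn hΩ hT.1 hb,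
    D.specificHeat_potential hb₀ F.contDiffOn hΩ hT.1 hb, abs_neg, abs_mul, abs_mul, abs_mul,
    abs_of_pos (inv_pos.2 hT.1)]
  have hX := exp_pos (-(T⁻¹ * G))
  constructor
  · calc |N₀| * |J (D.entCurve (fun s => u s⁻¹) T⁻¹)|
        ≤ |N₀| * (‖J‖ * (C * (T⁻¹ ^ 2 * exp (-(T⁻¹ * G))))) := by
          gcongr
          exact (J.le_opNorm _).trans (by gcongr)
      _ = _ := by ring
  · calc T⁻¹ * (|N₀| * |J (D.entCurveDeriv (fun s => u s⁻¹) T⁻¹)|)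
        ≤ T⁻¹ * (|N₀| * (‖J‖ * (C * (T⁻¹ ^ 2 * exp (-(T⁻¹ * G)))))) := by
          gcongr
          exact (J.le_opNorm _).trans (by gcongr)
      _ = _ := by ring

end

variable (hΩ0 : Ω 0 = N₀ * J ((-2 : ℝ) • D.energy (u 0) + u 0 * D.ratio (u 0)))
include hΩ hΩ0

/-- A function continuous at the endpoint whose derivative has a limit there is differentiable with
that limit; the limit is 0 by the entropy bound. -/
theorem hasDerivWithinAt_zero : HasDerivWithinAt Ω 0 (Ici 0) 0 := by
  have hb₀ := (inv_pos.2 F.T₀_pos).le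
  obtain ⟨C, hC0, hC⟩ := F.exists_abs_entropy_le hΩ D.lo_pos lo_le_energy_zero
  have hmem : Ioo 0 T₀ ∈ 𝓝[>] (0 : ℝ) := Ioo_mem_nhdsGT F.T₀_pos
  refine hasDerivWithinAt_Ici_of_tendsto_deriv (s := Ioo 0 T₀) (fun T hT =>
    (D.hasDerivAt_potential hb₀ F.contDiffOn hΩ hT.1
      (lt_inv hT)).differentiableAt.differentiableWithinAt) ?_ hmem ?_
  · have h1 : Tendsto (fun T => N₀ * J (D.potCurve (fun s => u s⁻¹) T⁻¹)) (𝓝[>] 0) (𝓝 (Ω 0)) := by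
      rw [hΩ0]
      exact ((J.continuous.tendsto _).comp
        (F.tendsto_potCurve.comp tendsto_inv_nhdsGT_zero)).const_mul N₀
    refine (h1.mono_left (nhdsWithin_mono _ fun T hT => hT.1)).congr' ?_
    filter_upwards [self_mem_nhdsWithin] with T hT
    exact (hΩ T hT.1 (lt_inv hT)).symm
  · rw [tendsto_zero_iff_abs_tendsto_zero]
    have h2 := ((tendsto_pow_mul_exp_neg_mul D.lo_pos 2).const_mul C).comp
      (tendsto_inv_nhdsGT_zero (𝕜 := ℝ))
    rw [mul_zero] at h2
    refine squeeze_zero' (Eventually.of_forall fun _ => abs_nonneg _) ?_ h2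
    filter_upwards [hmem] with T hT
    have h3 := (hC T hT).1
    rw [entropy, abs_neg, derivWithin_of_mem_nhds (Ici_mem_nhds hT.1)] at h3
    exact h3

theorem hasDerivWithinAt_derivWithin_zero :
    HasDerivWithinAt (derivWithin Ω (Ici 0)) 0 (Ici 0) 0 := by
  have hb₀ := (inv_pos.2 F.T₀_pos).le
  obtain ⟨C, hC0, hC⟩ := F.exists_abs_entropy_le hΩ D.lo_pos lo_le_energy_zero
  have hmem : Ioo 0 T₀ ∈ 𝓝[>] (0 : ℝ) := Ioo_mem_nhdsGT F.T₀_pos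
  refine hasDerivWithinAt_Ici_of_tendsto_deriv (s := Ioo 0 T₀) (fun T hT =>
    (D.hasDerivAt_derivWithin_potential hb₀ F.contDiffOn hΩ hT.1
      (lt_inv hT)).differentiableAt.differentiableWithinAt) ?_ hmem ?_
  · have h0 : derivWithin Ω (Ici 0) 0 = 0 :=
      (F.hasDerivWithinAt_zero hΩ hΩ0).derivWithin (uniqueDiffOn_Ici 0 0 self_mem_Ici)
    rw [ContinuousWithinAt, h0, tendsto_zero_iff_abs_tendsto_zero]
    have h2 := ((tendsto_pow_mul_exp_neg_mul D.lo_pos 2).const_mul C).comp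
      (tendsto_inv_nhdsGT_zero (𝕜 := ℝ))
    rw [mul_zero] at h2
    refine squeeze_zero' (Eventually.of_forall fun _ => abs_nonneg _) ?_
      (h2.mono_left (nhdsWithin_mono _ fun T hT => hT.1))
    filter_upwards [self_mem_nhdsWithin] with T hT
    have h3 := (hC T hT).1
    rwa [entropy, abs_neg] at h3
  · rw [tendsto_zero_iff_abs_tendsto_zero]
    -- The second derivative is the specific heat divided by -T, one power of 1/T beyond the cubic
    -- bound.
    have h2 := ((tendsto_pow_mul_exp_neg_mul D.lo_pos 4).const_mul C).comp
      (tendsto_inv_nhdsGT_zero (𝕜 := ℝ))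
    rw [mul_zero] at h2
    refine squeeze_zero' (Eventually.of_forall fun _ => abs_nonneg _) ?_ h2
    filter_upwards [hmem] with T hT
    have h3 := (hC T hT).2
    have hT0 := hT.1
    rw [specificHeat, abs_mul, abs_neg, abs_of_pos hT.1,
      derivWithin_of_mem_nhds (Ici_mem_nhds hT.1)] at h3
    have h4 := mul_le_mul_of_nonneg_left h3 (inv_pos.2 hT.1).le
    rw [inv_mul_cancel_left₀ hT.1.ne'] at h4
    simp only [Function.comp_apply]
    linarith

theorem twiceDiffAt_zero : TwiceDiffAt Ω 0 := by
  have hb₀ := (inv_pos.2 F.T₀_pos).le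
  refine ⟨?_, (F.hasDerivWithinAt_derivWithin_zero hΩ hΩ0).differentiableWithinAt⟩
  have hmem : Ico 0 T₀ ∈ 𝓝[Ici 0] (0 : ℝ) := Ico_mem_nhdsGE F.T₀_pos
  filter_upwards [hmem] with T hT
  rcases hT.1.eq_or_lt with rfl | hT0
  · exact (F.hasDerivWithinAt_zero hΩ hΩ0).differentiableWithinAt
  · exact (D.hasDerivAt_potential hb₀ F.contDiffOn hΩ hT0
      (lt_inv ⟨hT0, hT.2⟩)).differentiableAt.differentiableWithinAt

theorem entropy_zero : entropy Ω 0 = 0 := by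
  rw [entropy, (F.hasDerivWithinAt_zero hΩ hΩ0).derivWithin (uniqueDiffOn_Ici 0 0 self_mem_Ici),
    neg_zero]

end Potential

end IsFamily

end GapKernel

end LowTemperature

/-! ### Two-sided bounds for the mode entropy with factors close to 1. -/

section Squeeze

/-- In the application a and a₀ are bE at temperatures T and 0, d bounds their difference and m =
bε. The factors here and in the lower bound tend to 1 as d → 0 and m → ∞. -/
theorem modeEntropy_le_mul {a a₀ d m : ℝ} (hm : 0 < m) (hma : m ≤ a) (ha : a ≤ a₀)
    (hd : a₀ - a ≤ d) : modeEntropy a ≤ exp d * (1 + 1 / m) * (a₀ * exp (-a₀)) := by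
  have h1 : exp (-a) ≤ exp d * exp (-a₀) := by
    rw [← exp_add]; exact exp_le_exp.2 (by linarith)
  have h2 : 1 + a ≤ (1 + 1 / m) * a₀ := by
    have : 1 ≤ 1 / m * a₀ := by
      rw [one_div, inv_mul_eq_div, le_div_iff₀ hm]; linarith
    linarith
  have ha0 : 0 < a := hm.trans_le hma
  have hE := exp_pos (-a)
  calc modeEntropy a ≤ (1 + a) * exp (-a) := modeEntropy_le ha0.le
    _ ≤ ((1 + 1 / m) * a₀) * (exp d * exp (-a₀)) :=
        mul_le_mul h2 h1 hE.le (by linarith)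
    _ = _ := by ring

theorem mul_le_modeEntropy {a a₀ d m : ℝ} (hm : 0 < m) (hma : m ≤ a) (ha : a ≤ a₀)
    (hd : a₀ - a ≤ d) : (1 - d / m) / (1 + exp (-m)) * (a₀ * exp (-a₀)) ≤ modeEntropy a := by
  have ha0 : 0 < a := hm.trans_le hma
  have hE := exp_pos (-a)
  have h0 : 0 ≤ log (1 + exp (-a)) := log_nonneg (by linarith)
  have h1 : a / (exp a + 1) = a * exp (-a) / (1 + exp (-a)) := by
    have := exp_pos a
    rw [exp_neg]; field_simp
  have h2 : exp (-a₀) ≤ exp (-a) := exp_le_exp.2 (by linarith)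
  have h3 : exp (-a) ≤ exp (-m) := exp_le_exp.2 (by linarith)
  have h4 : a₀ * (1 - d / m) ≤ a := by
    have : d ≤ a₀ * (d / m) := by
      rw [mul_div_assoc', le_div_iff₀ hm]
      have : 0 ≤ d := by linarith
      nlinarith
    linarith
  rw [modeEntropy_apply, h1]
  have h5 := exp_pos (-a₀)
  calc (1 - d / m) / (1 + exp (-m)) * (a₀ * exp (-a₀))
      = (a₀ * (1 - d / m)) * exp (-a₀) / (1 + exp (-m)) := by ring
    _ ≤ a * exp (-a) / (1 + exp (-a)) := by gcongr
    _ ≤ _ := by linarith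

theorem neg_modeEntropyDeriv_eq (a : ℝ) :
    -modeEntropyDeriv a = a * exp (-a) / (1 + exp (-a)) ^ 2 := by
  have := exp_pos a
  rw [modeEntropyDeriv_apply, neg_neg, exp_neg]
  field_simp

/-- The summand z stands for the contribution b²(u/E)u' of the moving gap to the specific heat; it
is exponentially small. -/
theorem neg_modeEntropyDeriv_mul_le {a a₀ d e z m : ℝ} (hm : 0 < m) (hma : m ≤ a) (ha : a ≤ a₀)
    (hd : a₀ - a ≤ d) (hz : |z| ≤ e) :
    -modeEntropyDeriv a * (a + z) ≤ exp d * (1 + e / m) * (a₀ ^ 2 * exp (-a₀)) := by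
  have ha0 : 0 < a := hm.trans_le hma
  have hE := exp_pos (-a)
  have he : 0 ≤ e := (abs_nonneg z).trans hz
  have h1 : exp (-a) ≤ exp d * exp (-a₀) := by
    rw [← exp_add]; exact exp_le_exp.2 (by linarith)
  have h2 : a + e ≤ a₀ * (1 + e / m) := by
    have : e ≤ a₀ * (e / m) := by
      rw [mul_div_assoc', le_div_iff₀ hm]
      nlinarith
    linarith
  have h3 : a * exp (-a) / (1 + exp (-a)) ^ 2 ≤ a * exp (-a) :=
    div_le_self (by positivity) (one_le_pow₀ (by linarith))
  rw [neg_modeEntropyDeriv_eq]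
  have h4 : z ≤ e := (le_abs_self z).trans hz
  calc a * exp (-a) / (1 + exp (-a)) ^ 2 * (a + z)
      ≤ a * exp (-a) / (1 + exp (-a)) ^ 2 * (a + e) := by gcongr
    _ ≤ (a₀ * (exp d * exp (-a₀))) * (a₀ * (1 + e / m)) := by
        have h5 : a * exp (-a) ≤ a₀ * (exp d * exp (-a₀)) :=
          mul_le_mul ha h1 hE.le (by linarith)
        have h6 : 0 ≤ a * exp (-a) := by positivity
        exact mul_le_mul (h3.trans h5) h2 (by positivity) (h6.trans h5)
    _ = _ := by ring

theorem mul_le_neg_modeEntropyDeriv_mul {a a₀ d e z m : ℝ} (hm : 0 < m) (hma : m ≤ a) (ha : a ≤ a₀)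
    (hd : a₀ - a ≤ d) (hz : |z| ≤ e) (hde : d + e ≤ m) :
    (1 - d / m) * (1 - (d + e) / m) / (1 + exp (-m)) ^ 2 * (a₀ ^ 2 * exp (-a₀)) ≤
      -modeEntropyDeriv a * (a + z) := by
  have ha0 : 0 < a := hm.trans_le hma
  have hE := exp_pos (-a)
  have he : 0 ≤ e := (abs_nonneg z).trans hz
  have hd0 : 0 ≤ d := by linarith
  have h2 : exp (-a₀) ≤ exp (-a) := exp_le_exp.2 (by linarith)
  have h3 : exp (-a) ≤ exp (-m) := exp_le_exp.2 (by linarith)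
  have key : ∀ x, 0 ≤ x → a₀ * (1 - x / m) ≤ a₀ - x := fun x hx => by
    have : x ≤ a₀ * (x / m) := by
      rw [mul_div_assoc', le_div_iff₀ hm]
      nlinarith
    linarith
  have h4 : a₀ * (1 - d / m) ≤ a := by linarith [key d hd0]
  have h5 : a₀ * (1 - (d + e) / m) ≤ a + z := by
    have := (abs_le.1 hz).1
    linarith [key (d + e) (by linarith)]
  have h6 : 0 ≤ 1 - (d + e) / m := by rw [sub_nonneg, div_le_one hm]; exact hde
  have h7 : 0 ≤ a₀ * (1 - (d + e) / m) := mul_nonneg (by linarith) h6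
  rw [neg_modeEntropyDeriv_eq]
  calc _ = (a₀ * (1 - d / m)) * exp (-a₀) / (1 + exp (-m)) ^ 2 * (a₀ * (1 - (d + e) / m)) := by ring
    _ ≤ _ := by gcongr

theorem isEquivalent_of_squeeze {α : Type*} {l : Filter α} {P Q f g : α → ℝ}
    (hf : Tendsto f l (𝓝 1)) (hg : Tendsto g l (𝓝 1))
    (h : ∀ᶠ x in l, 0 ≤ Q x ∧ f x * Q x ≤ P x ∧ P x ≤ g x * Q x) : P ~[l] Q := by
  rw [IsEquivalent, isLittleO_iff]
  intro ε hε
  filter_upwards [h, hf.eventually (lt_mem_nhds (show 1 - ε < 1 by linarith)),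
    hg.eventually (gt_mem_nhds (show 1 < 1 + ε by linarith))] with x hx hfx hgx
  obtain ⟨h0, h1, h2⟩ := hx
  rw [Pi.sub_apply, Real.norm_of_nonneg h0, Real.norm_eq_abs, abs_le]
  constructor <;> nlinarith

end Squeeze

/-! ### Leading order asymptotics for symmetric potentials. -/

section Symmetric

variable {K : Type*} [TopologicalSpace K] [CompactSpace K]

namespace GapKernel.IsFamily

variable {D : GapKernel K} {u : ℝ → C(K, ℝ)} {T₀ c M : ℝ} (F : D.IsFamily u T₀ c M)
  {J : C(K, ℝ) →L[ℝ] ℝ} {N₀ : ℝ} {Ω : ℝ → ℝ}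
  (hΩ : ∀ T, 0 < T → T₀⁻¹ < T⁻¹ → Ω T = N₀ * J (D.potCurve (fun s => u s⁻¹) T⁻¹))
  (hsym : ∀ f g, J (D.L f * g) = J (f * D.L g))
include F hΩ hsym

/-- Since w = Lg and w' = Lg', symmetry gives J(w g') = J(g Lg') = J(w' g): the Wronskian integrates
to zero and only the mode entropy is left. -/
theorem entropy_of_symmetric {T : ℝ} (hT : T ∈ Ioo 0 T₀) :
    entropy Ω T = 4 * N₀ * J (modeEntropy.comp (T⁻¹ • D.energy (u T))) := by
  have hb := lt_inv hT
  have h1 : u T⁻¹⁻¹ = D.L (D.gapCurve (fun s => u s⁻¹) T⁻¹) := F.eqOn_map hb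
  have h2 : deriv (fun s => u s⁻¹) T⁻¹ = _ := F.eqOn_deriv hb
  rw [D.entropy_potential (inv_pos.2 F.T₀_pos).le F.contDiffOn hΩ hT.1 hb, entCurve, map_add,
    map_smul, map_smul, map_sub]
  have h3 : J (u T⁻¹⁻¹ * deriv (D.gapCurve fun s => u s⁻¹) T⁻¹) =
      J (deriv (fun s => u s⁻¹) T⁻¹ * D.gapCurve (fun s => u s⁻¹) T⁻¹) := by
    rw [h2, h1, hsym, mul_comm]
  rw [h3, sub_self, smul_zero, zero_add, inv_inv, smul_eq_mul]
  ring

theorem specificHeat_of_symmetric {T : ℝ} (hT : T ∈ Ioo 0 T₀) :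
    specificHeat Ω T = 4 * N₀ * J (-(modeEntropyDeriv.comp (T⁻¹ • D.energy (u T))) *
      (T⁻¹ • D.energy (u T) + T⁻¹ ^ 2 • (D.ratio (u T) * deriv (fun s => u s⁻¹) T⁻¹))) := by
  have hb := lt_inv hT
  have h1 : u T⁻¹⁻¹ = D.L (D.gapCurve (fun s => u s⁻¹) T⁻¹) := F.eqOn_map hb
  have h2 : deriv (fun s => u s⁻¹) T⁻¹ = _ := F.eqOn_deriv hb
  have h2' : deriv (deriv fun s => u s⁻¹) T⁻¹ = _ := F.eqOn_deriv_deriv hb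
  rw [D.specificHeat_potential (inv_pos.2 F.T₀_pos).le F.contDiffOn hΩ hT.1 hb, entCurveDeriv,
    map_add, map_add, map_smul, map_smul, map_sub, map_sub]
  have h3 : J (u T⁻¹⁻¹ * deriv (D.gapCurve fun s => u s⁻¹) T⁻¹) =
      J (deriv (fun s => u s⁻¹) T⁻¹ * D.gapCurve (fun s => u s⁻¹) T⁻¹) := by
    rw [h2, h1, hsym, mul_comm]
  have h4 : J (u T⁻¹⁻¹ * deriv (deriv (D.gapCurve fun s => u s⁻¹)) T⁻¹) =
      J (deriv (deriv fun s => u s⁻¹) T⁻¹ * D.gapCurve (fun s => u s⁻¹) T⁻¹) := by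
    rw [h2', h1, hsym, mul_comm]
  rw [h3, h4, sub_self, sub_self, smul_zero, smul_zero, zero_add, zero_add, inv_inv, map_smul]
  have h5 : -(modeEntropyDeriv.comp (T⁻¹ • D.energy (u T))) *
      (T⁻¹ • D.energy (u T) + T⁻¹ ^ 2 • (D.ratio (u T) * deriv (fun s => u s⁻¹) T⁻¹)) =
      (-T⁻¹) • (modeEntropyDeriv.comp (T⁻¹ • D.energy (u T)) *
        (D.energy (u T) + T⁻¹ • (D.ratio (u T) * deriv (fun s => u s⁻¹) T⁻¹))) := by
    ext k
    simp only [ContinuousMap.mul_apply, ContinuousMap.neg_apply, ContinuousMap.add_apply,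
      ContinuousMap.smul_apply, smul_eq_mul]
    ring
  rw [h5, map_smul, smul_eq_mul, smul_eq_mul]
  ring

variable (hJ : ∀ g, 0 ≤ g → 0 ≤ J g) (hN₀ : 0 < N₀)
include hJ hN₀

omit [CompactSpace K] F hΩ hsym hN₀ in
theorem map_le_map_of_nonneg {f g : C(K, ℝ)} (h : ∀ k, f k ≤ g k) : J f ≤ J g := by
  have := hJ (g - f) (ContinuousMap.le_def.2 fun k => by simpa using h k)
  rwa [map_sub, sub_nonneg] at this

/-- The exponential density `k ↦ (b E)ⁿ exp (-b E)` at zero temperature. -/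
noncomputable def _root_.ContinuousMap.powMulExpNeg (n : ℕ) : C(ℝ, ℝ) :=
  ⟨fun a => a ^ n * exp (-a), by fun_prop⟩

/-- The pointwise squeeze is used with m = b lo and d = C b exp(-b lo); its factors do not depend on
the point, so they pass through the positive functional J. -/
theorem isEquivalent_entropy :
    entropy Ω ~[𝓝[>] 0] fun T => 4 * N₀ *
      J ((ContinuousMap.powMulExpNeg 1).comp (T⁻¹ • D.energy (u 0))) := by
  obtain ⟨C, hC0, hC⟩ := F.exists_energy_sub_le
  have hlo := D.lo_pos
  have t0 := tendsto_pow_mul_exp_neg_mul hlo 0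
  have t1 := (tendsto_pow_mul_exp_neg_mul hlo 1).const_mul C
  have t2 : Tendsto (fun b : ℝ => 1 / (b * D.lo)) atTop (𝓝 0) :=
    tendsto_const_nhds.div_atTop (tendsto_id.atTop_mul_const hlo)
  simp only [pow_zero, one_mul, pow_one, mul_zero] at t0 t1
  have hf : Tendsto (fun b : ℝ => (1 - C * (b * exp (-(b * D.lo))) / (b * D.lo)) /
      (1 + exp (-(b * D.lo)))) atTop (𝓝 1) := by
    have := ((t1.mul t2).const_sub 1).div (t0.const_add 1) (by norm_num)
    simp only [mul_zero, sub_zero, add_zero, div_one] at this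
    exact this.congr fun b => by simp only [Pi.div_apply, mul_one_div]
  have hg : Tendsto (fun b : ℝ => exp (C * (b * exp (-(b * D.lo)))) * (1 + 1 / (b * D.lo)))
      atTop (𝓝 1) := by
    have := ((continuous_exp.tendsto 0).comp t1).mul (t2.const_add 1)
    simpa using this
  refine isEquivalent_of_squeeze (hf.comp tendsto_inv_nhdsGT_zero)
    (hg.comp tendsto_inv_nhdsGT_zero) ?_
  filter_upwards [Ioo_mem_nhdsGT F.T₀_pos] with T hT
  have hb := lt_inv hT
  have hb0 : 0 < T⁻¹ := inv_pos.2 hT.1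
  have hanti := F.anti le_rfl hT.1.le hT.2.le
  have hpt : ∀ k, T⁻¹ * D.lo ≤ T⁻¹ * qpEnergy (D.ξ k) (u T k) ∧
      T⁻¹ * qpEnergy (D.ξ k) (u T k) ≤ T⁻¹ * qpEnergy (D.ξ k) (u 0 k) ∧
      T⁻¹ * qpEnergy (D.ξ k) (u 0 k) - T⁻¹ * qpEnergy (D.ξ k) (u T k) ≤
        C * (T⁻¹ * exp (-(T⁻¹ * D.lo))) := fun k => by
    have h1 := hC _ hb.le k
    rw [inv_inv] at h1
    refine ⟨?_, ?_, ?_⟩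
    · have : D.lo ≤ qpEnergy (D.ξ k) (u T k) := (D.lo_le k).trans (le_qpEnergy _ _)
      gcongr
    · have := qpEnergy_mono (D.ξ k) (F.pos hT.1.le hT.2.le k).le (hanti k)
      gcongr
    · have := mul_le_mul_of_nonneg_left h1 hb0.le
      linarith
  have hm : 0 < T⁻¹ * D.lo := by positivity
  rw [F.entropy_of_symmetric hΩ hsym hT]
  simp only [Function.comp_apply]
  refine ⟨?_, ?_, ?_⟩
  · refine mul_nonneg (by positivity) (hJ _ (ContinuousMap.le_def.2 fun k => ?_))
    have := qpEnergy_pos (D.ξ_pos k) (u 0 k)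
    simp only [ContinuousMap.powMulExpNeg, ContinuousMap.comp_apply, ContinuousMap.coe_mk,
      ContinuousMap.smul_apply, smul_eq_mul, energy_apply, ContinuousMap.zero_apply]
    positivity
  · rw [mul_left_comm, ← smul_eq_mul (_ / _), ← map_smul]
    refine mul_le_mul_of_nonneg_left (map_le_map_of_nonneg hJ fun k => ?_) (by positivity)
    have := mul_le_modeEntropy hm (hpt k).1 (hpt k).2.1 (hpt k).2.2
    simpa [ContinuousMap.powMulExpNeg] using this
  · rw [mul_left_comm, ← smul_eq_mul (exp _ * _) (J _), ← map_smul]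
    refine mul_le_mul_of_nonneg_left (map_le_map_of_nonneg hJ fun k => ?_) (by positivity)
    have := modeEntropy_le_mul hm (hpt k).1 (hpt k).2.1 (hpt k).2.2
    simpa [ContinuousMap.powMulExpNeg] using this

theorem isEquivalent_specificHeat :
    specificHeat Ω ~[𝓝[>] 0] fun T => 4 * N₀ *
      J ((ContinuousMap.powMulExpNeg 2).comp (T⁻¹ • D.energy (u 0))) := by
  obtain ⟨C, hC0, hC⟩ := F.exists_energy_sub_le
  obtain ⟨C₁, hC₁0, hC₁⟩ := F.exists_bounds D.lo_pos lo_le_energy_zero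
  have hlo := D.lo_pos
  have t0 := tendsto_pow_mul_exp_neg_mul hlo 0
  have t1 := (tendsto_pow_mul_exp_neg_mul hlo 1).const_mul C
  have t3 := (tendsto_pow_mul_exp_neg_mul hlo 2).const_mul C₁
  have t4 : Tendsto (fun b : ℝ => b * D.lo) atTop atTop := tendsto_id.atTop_mul_const hlo
  have t2 : Tendsto (fun b : ℝ => 1 / (b * D.lo)) atTop (𝓝 0) :=
    tendsto_const_nhds.div_atTop t4
  simp only [pow_zero, one_mul, pow_one, mul_zero] at t0 t1 t3
  have hf : Tendsto (fun b : ℝ => (1 - C * (b * exp (-(b * D.lo))) / (b * D.lo)) *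
      (1 - (C * (b * exp (-(b * D.lo))) + C₁ * (b ^ 2 * exp (-(b * D.lo)))) / (b * D.lo)) /
      (1 + exp (-(b * D.lo))) ^ 2) atTop (𝓝 1) := by
    have := (((t1.mul t2).const_sub 1).mul (((t1.add t3).mul t2).const_sub 1)).div
      ((t0.const_add 1).pow 2) (by norm_num)
    simp only [mul_zero, sub_zero, add_zero, div_one, one_pow, mul_one] at this
    exact this.congr fun b => by simp only [Pi.div_apply, mul_one_div]
  have hg : Tendsto (fun b : ℝ => exp (C * (b * exp (-(b * D.lo)))) *
      (1 + C₁ * (b ^ 2 * exp (-(b * D.lo))) / (b * D.lo))) atTop (𝓝 1) := by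
    have := ((continuous_exp.tendsto 0).comp t1).mul ((t3.mul t2).const_add 1)
    simp only [mul_zero, add_zero, exp_zero, mul_one] at this
    exact this.congr fun b => by simp only [Function.comp_apply, mul_one_div]
  have hsmall : ∀ᶠ b in atTop,
      C * (b * exp (-(b * D.lo))) + C₁ * (b ^ 2 * exp (-(b * D.lo))) ≤ b * D.lo := by
    have h1 := (t1.add t3).eventually (gt_mem_nhds (show (0 : ℝ) + 0 < 1 by norm_num))
    filter_upwards [h1, t4.eventually_ge_atTop 1] with b h2 h3
    linarith
  refine isEquivalent_of_squeeze (hf.comp tendsto_inv_nhdsGT_zero)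
    (hg.comp tendsto_inv_nhdsGT_zero) ?_
  filter_upwards [Ioo_mem_nhdsGT F.T₀_pos, tendsto_inv_nhdsGT_zero.eventually hsmall] with T hT hsm
  have hb := lt_inv hT
  have hb0 : 0 < T⁻¹ := inv_pos.2 hT.1
  have hanti := F.anti le_rfl hT.1.le hT.2.le
  have hpt : ∀ k, T⁻¹ * D.lo ≤ T⁻¹ * qpEnergy (D.ξ k) (u T k) ∧
      T⁻¹ * qpEnergy (D.ξ k) (u T k) ≤ T⁻¹ * qpEnergy (D.ξ k) (u 0 k) ∧
      T⁻¹ * qpEnergy (D.ξ k) (u 0 k) - T⁻¹ * qpEnergy (D.ξ k) (u T k) ≤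
        C * (T⁻¹ * exp (-(T⁻¹ * D.lo))) ∧
      |T⁻¹ ^ 2 * (u T k / qpEnergy (D.ξ k) (u T k) * deriv (fun s => u s⁻¹) T⁻¹ k)| ≤
        C₁ * (T⁻¹ ^ 2 * exp (-(T⁻¹ * D.lo))) := fun k => by
    have h1 := hC _ hb.le k
    rw [inv_inv] at h1
    have hu := F.pos hT.1.le hT.2.le k
    have he := qpEnergy_pos (D.ξ_pos k) (u T k)
    refine ⟨?_, ?_, ?_, ?_⟩
    · have : D.lo ≤ qpEnergy (D.ξ k) (u T k) := (D.lo_le k).trans (le_qpEnergy _ _)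
      gcongr
    · have := qpEnergy_mono (D.ξ k) hu.le (hanti k)
      gcongr
    · have := mul_le_mul_of_nonneg_left h1 hb0.le
      linarith
    · have h2 := ((ContinuousMap.norm_coe_le_norm _ k).trans (hC₁ _ hb).2.2.1)
      rw [Real.norm_eq_abs] at h2
      have h3 := div_qpEnergy_le_one (D.ξ_pos k) (u T k)
      rw [abs_mul, abs_mul, abs_of_nonneg (by positivity : (0 : ℝ) ≤ T⁻¹ ^ 2),
        abs_of_nonneg (by positivity : 0 ≤ u T k / qpEnergy (D.ξ k) (u T k))]
      calc _ ≤ T⁻¹ ^ 2 * (1 * (C₁ * exp (-(T⁻¹ * D.lo)))) := by gcongr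
        _ = _ := by ring
  have hm : 0 < T⁻¹ * D.lo := by positivity
  rw [F.specificHeat_of_symmetric hΩ hsym hT]
  simp only [Function.comp_apply]
  refine ⟨?_, ?_, ?_⟩
  · refine mul_nonneg (by positivity) (hJ _ (ContinuousMap.le_def.2 fun k => ?_))
    have := qpEnergy_pos (D.ξ_pos k) (u 0 k)
    simp only [ContinuousMap.powMulExpNeg, ContinuousMap.comp_apply, ContinuousMap.coe_mk,
      ContinuousMap.smul_apply, smul_eq_mul, energy_apply, ContinuousMap.zero_apply]
    positivity
  · rw [mul_left_comm, ← smul_eq_mul (_ / _), ← map_smul]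
    refine mul_le_mul_of_nonneg_left (map_le_map_of_nonneg hJ fun k => ?_) (by positivity)
    have := mul_le_neg_modeEntropyDeriv_mul hm (hpt k).1 (hpt k).2.1 (hpt k).2.2.1 (hpt k).2.2.2 hsm
    simpa [ContinuousMap.powMulExpNeg] using this
  · rw [mul_left_comm, ← smul_eq_mul (exp _ * _) (J _), ← map_smul]
    refine mul_le_mul_of_nonneg_left (map_le_map_of_nonneg hJ fun k => ?_) (by positivity)
    have := neg_modeEntropyDeriv_mul_le hm (hpt k).1 (hpt k).2.1 (hpt k).2.2.1 (hpt k).2.2.2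
    simpa [ContinuousMap.powMulExpNeg] using this

end GapKernel.IsFamily

end Symmetric

/-! ### Existence of positive solutions at low temperature and triviality at high temperature. -/

section Existence

variable {K : Type*} [TopologicalSpace K] [CompactSpace K]

namespace GapKernel

variable (D : GapKernel K)

theorem gap_anti {s t : ℝ} (hs : 0 ≤ s) (hst : s ≤ t) {v : C(K, ℝ)} (hv : ∀ k, 0 ≤ v k) :
    D.gap t v ≤ D.gap s v := ContinuousMap.le_def.2 fun k => by
  rw [gap_apply, gap_apply]
  exact gapFunT_anti hs hst (D.ξ_pos k) (hv k)

theorem gap_mono {T : ℝ} (hT : 0 ≤ T) {v w : C(K, ℝ)} (hv : ∀ k, 0 ≤ v k) (h : v ≤ w) :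
    D.gap T v ≤ D.gap T w := ContinuousMap.le_def.2 fun k => by
  rw [gap_apply, gap_apply]
  exact gapFunT_mono hT (D.ξ_pos k) (hv k) (ContinuousMap.le_def.1 h k)

/-- Positive solutions of the gap equation decrease with the temperature. -/
theorem solution_anti {s t : ℝ} (hs : 0 ≤ s) (hst : s ≤ t) {v w : C(K, ℝ)} {c M : ℝ} (hc : 0 < c)
    (hvM : ∀ k, v k ≤ M) (hcw : ∀ k, c ≤ w k) (hwM : ∀ k, w k ≤ M) (hv0 : ∀ k, 0 ≤ v k)
    (hv : v = D.L (D.gap t v)) (hw : w = D.L (D.gap s w)) (k : K) : v k ≤ w k := by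
  have := D.le_mul_of_sub_super (T₀ := t + 1) (t := s) (by linarith) hc ((hcw k).trans (hwM k))
    (hs.trans hst) (by linarith) le_rfl (ContinuousMap.le_def.2 hv0) hvM hcw hwM hv.le hw.ge
    (fun k => by
      rw [add_zero, one_mul]
      exact gapFunT_anti hs hst (D.ξ_pos k) (hc.le.trans (hcw k))) k
  simpa using this

/-- At high temperature the gap equation has only the trivial solution. -/
theorem solution_eq_zero {T : ℝ} (hT : 0 < T) (hLT : ‖D.L‖ < 2 * T) {v : C(K, ℝ)}
    (hv0 : ∀ k, 0 ≤ v k) (hv : v = D.L (D.gap T v)) : v = 0 := by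
  have h1 : ‖D.gap T v‖ ≤ ‖v‖ / (2 * T) := by
    refine (ContinuousMap.norm_le _ (by positivity)).2 fun k => ?_
    have he := qpEnergy_pos (D.ξ_pos k) (v k)
    rw [gap_apply, Real.norm_of_nonneg (gapFunT_nonneg hT.le (D.ξ_pos k) (hv0 k)), gapFunT,
      thermalFactor, if_neg hT.ne']
    have h2 := tanh_le_self (x := qpEnergy (D.ξ k) (v k) / (2 * T)) (by positivity)
    have h3 := (le_abs_self _).trans (v.norm_coe_le_norm k)
    calc _ ≤ v k / qpEnergy (D.ξ k) (v k) * (qpEnergy (D.ξ k) (v k) / (2 * T)) :=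
          mul_le_mul_of_nonneg_left h2 (div_nonneg (hv0 k) he.le)
      _ = v k / (2 * T) := by field_simp
      _ ≤ _ := by gcongr
  have h2 : ‖v‖ ≤ ‖D.L‖ * (‖v‖ / (2 * T)) := by
    conv_lhs => rw [hv]
    exact (D.L.le_opNorm _).trans (by gcongr)
  by_contra hne
  have h3 : 0 < ‖v‖ := norm_pos_iff.2 hne
  have h4 : ‖D.L‖ * (‖v‖ / (2 * T)) < (2 * T) * (‖v‖ / (2 * T)) := by gcongr
  rw [mul_div_cancel₀ _ (by positivity)] at h4
  linarith

/-- Between a subsolution and a supersolution of the gap equation there is a solution. -/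
theorem exists_solution {T c M : ℝ} (hT : 0 < T) (hc : 0 < c) {z y : C(K, ℝ)}
    (hcz : ∀ k, c ≤ z k) (hzy : ∀ k, z k ≤ y k) (hy2 : ∀ k, y k ≤ 2 * z k) (hyM : ∀ k, y k ≤ M)
    (hz : z ≤ D.L (D.gap T z)) (hy : D.L (D.gap T y) ≤ y) :
    ∃ v : C(K, ℝ), (∀ k, c ≤ v k) ∧ v = D.L (D.gap T v) := by
  rcases isEmpty_or_nonempty K with hK | ⟨⟨k₀⟩⟩
  · exact ⟨0, fun k => hK.elim k, by ext k; exact hK.elim k⟩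
  have hcM : c ≤ M := (hcz k₀).trans ((hzy k₀).trans (hyM k₀))
  have hcM' : c ≤ 2 * M := by linarith
  have hd0 := sublinConst_pos D.lo_pos D.lo_le_hi hc hcM' (inv_pos.2 hT)
  have hd1 := sublinConst_lt_one D.lo_pos D.lo_le_hi hc hcM' (inv_pos.2 hT)
  have hsub : ∀ x k r, c ≤ x → 1 ≤ r → r * x ≤ 2 * M → gapFunT T (D.ξ k) (r * x) ≤
      (1 + (1 - sublinConst D.lo D.hi c (2 * M) T⁻¹) * (r - 1)) * gapFunT T (D.ξ k) x :=
    fun x k r hx hr hrx => gapFunT_mul_le D.lo_pos D.lo_le_hi hc hcM' hT hT.le le_rfl (D.lo_le k)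
      (D.le_hi k) hx hr hrx
  set δ := sublinConst D.lo D.hi c (2 * M) T⁻¹
  let A : C(K, ℝ) → C(K, ℝ) := fun v => D.L (D.gap T v)
  have hAmono : ∀ v w : C(K, ℝ), (∀ k, 0 ≤ v k) → v ≤ w → A v ≤ A w := fun v w hv h =>
    ContinuousMap.map_mono_of_nonneg D.L_nonneg (D.gap_mono hT.le hv h)
  have hAcont : Continuous A := by
    have : A = fun v => D.L (D.gapB T⁻¹ v) := by
      ext1 v; simp only [A, D.gap_of_pos hT]
    rw [this]
    exact D.L.continuous.comp (D.contDiff_gapB.continuous.comp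
      (continuous_const.prodMk continuous_id : Continuous fun v : C(K, ℝ) => (T⁻¹, v)))
  -- Iterates from the subsolution increase, those from the supersolution decrease. By sublinearity
  -- their ratio is at most 1 + (1 - δ)^n, which makes the lower sequence Cauchy in norm.
  let v : ℕ → C(K, ℝ) := fun n => A^[n] z
  let w : ℕ → C(K, ℝ) := fun n => A^[n] y
  have hv1 : ∀ n, v (n + 1) = A (v n) := fun n => Function.iterate_succ_apply' A n z
  have hw1 : ∀ n, w (n + 1) = A (w n) := fun n => Function.iterate_succ_apply' A n y
  have hq0 : 0 ≤ 1 - δ := by linarith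
  have inv : ∀ n, z ≤ v n ∧ v n ≤ A (v n) ∧ A (w n) ≤ w n ∧ w n ≤ y ∧ v n ≤ w n ∧
      w n ≤ (1 + (1 - δ) ^ n) • v n := fun n => by
    induction n with
    | zero =>
      refine ⟨le_rfl, hz, hy, le_rfl, ContinuousMap.le_def.2 hzy, ContinuousMap.le_def.2 fun k => ?_⟩
      show y k ≤ (1 + (1 - δ) ^ 0) * z k
      rw [pow_zero]
      linarith [hy2 k]
    | succ n ih =>
      obtain ⟨h1, h2, h3, h4, h5, h6⟩ := ih
      rw [hv1, hw1]
      have hvc : ∀ k, c ≤ v n k := fun k => (hcz k).trans (ContinuousMap.le_def.1 h1 k)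
      have hv0 : ∀ k, 0 ≤ v n k := fun k => hc.le.trans (hvc k)
      have hAv0 : ∀ k, 0 ≤ A (v n) k := fun k => (hv0 k).trans (ContinuousMap.le_def.1 h2 k)
      have hw0 : ∀ k, 0 ≤ w n k := fun k => (hv0 k).trans (ContinuousMap.le_def.1 h5 k)
      have h7 := hAmono _ _ hv0 h5
      refine ⟨h1.trans h2, hAmono _ _ hv0 h2, hAmono _ _ (fun k => (hAv0 k).trans
        (ContinuousMap.le_def.1 h7 k)) h3, h3.trans h4, h7, ?_⟩
      have h8 : D.gap T (w n) ≤ (1 + (1 - δ) ^ (n + 1)) • D.gap T (v n) :=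
        ContinuousMap.le_def.2 fun k => by
          have hp0 : 0 ≤ (1 - δ) ^ n := by positivity
          have hp1 : (1 - δ) ^ n ≤ 1 := pow_le_one₀ hq0 (by linarith)
          have hvM : v n k ≤ M := (ContinuousMap.le_def.1 h5 k).trans
            ((ContinuousMap.le_def.1 h4 k).trans (hyM k))
          have h9 := hsub (v n k) k (1 + (1 - δ) ^ n) (hvc k) (by linarith) (by
            have := hv0 k
            nlinarith)
          have h10 := gapFunT_mono hT.le (D.ξ_pos k) (hw0 k) (ContinuousMap.le_def.1 h6 k)
          rw [ContinuousMap.smul_apply, smul_eq_mul, gap_apply, gap_apply]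
          refine h10.trans (h9.trans (le_of_eq ?_))
          ring
      have h11 := ContinuousMap.map_mono_of_nonneg D.L_nonneg h8
      rwa [map_smul] at h11
  have hM0 : 0 ≤ M := hc.le.trans hcM
  have hdist : ∀ n, dist (v n) (v (n + 1)) ≤ M * (1 - δ) ^ n := fun n => by
    obtain ⟨h1, h2, h3, h4, h5, h6⟩ := inv n
    rw [dist_comm, dist_eq_norm, hv1]
    refine (ContinuousMap.norm_le _ (by positivity)).2 fun k => ?_
    have a0 : 0 ≤ v n k := hc.le.trans ((hcz k).trans (ContinuousMap.le_def.1 h1 k))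
    have a2 := ContinuousMap.le_def.1 h2 k
    have a3 := ContinuousMap.le_def.1 h3 k
    have a4 := (ContinuousMap.le_def.1 h4 k).trans (hyM k)
    have a5 := ContinuousMap.le_def.1 h5 k
    have a6 := ContinuousMap.le_def.1 h6 k
    have a7 := ContinuousMap.le_def.1 (inv (n + 1)).2.2.2.2.1 k
    rw [hv1, hw1] at a7
    rw [ContinuousMap.smul_apply, smul_eq_mul] at a6
    have hp0 : 0 ≤ (1 - δ) ^ n := by positivity
    rw [ContinuousMap.sub_apply, Real.norm_of_nonneg (by linarith)]
    nlinarith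
  have hcauchy : CauchySeq v := cauchySeq_of_le_geometric (1 - δ) M (by linarith) hdist
  obtain ⟨v₀, hv₀⟩ := cauchySeq_tendsto_of_complete hcauchy
  refine ⟨v₀, fun k => ?_, ?_⟩
  · have h1 : Tendsto (fun n => v n k) atTop (𝓝 (v₀ k)) :=
      ((ContinuousEvalConst.continuous_eval_const k).tendsto v₀).comp hv₀
    exact ge_of_tendsto' h1 fun n => (hcz k).trans (ContinuousMap.le_def.1 (inv n).1 k)
  · have h1 : Tendsto (fun n => v (n + 1)) atTop (𝓝 (A v₀)) := by
      simp only [hv1]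
      exact (hAcont.tendsto v₀).comp hv₀
    exact tendsto_nhds_unique ((tendsto_add_atTop_iff_nat 1).2 hv₀) h1

/-- A positive solution at zero temperature persists at low temperature. -/
theorem eventually_exists_solution {c M : ℝ} (hc : 0 < c) {y : C(K, ℝ)} (hcy : ∀ k, c ≤ y k)
    (hyM : ∀ k, y k ≤ M) (hy : y = D.L (D.gap 0 y)) :
    ∀ᶠ T in 𝓝[>] (0 : ℝ), ∃ v : C(K, ℝ), (∀ k, c / 2 ≤ v k) ∧ v = D.L (D.gap T v) := by
  rcases isEmpty_or_nonempty K with hK | ⟨⟨k₀⟩⟩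
  · exact Eventually.of_forall fun T => ⟨0, fun k => hK.elim k, by ext k; exact hK.elim k⟩
  have hcM : c / 2 ≤ M := by linarith [hcy k₀, hyM k₀]
  have hc2 : 0 < c / 2 := by positivity
  have hd0 := sublinConst_pos D.lo_pos D.lo_le_hi hc2 hcM (inv_pos.2 one_pos)
  have hd1 := sublinConst_lt_one D.lo_pos D.lo_le_hi hc2 hcM (inv_pos.2 one_pos)
  -- Strict sublinearity with r = 2 leaves a margin δ that makes y/2 a subsolution at small T > 0,
  -- once tanh(lo/(2T)) exceeds 1 - δ/2. The solution y at temperature 0 is a supersolution there.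
  have hsub : ∀ k, gapFunT 0 (D.ξ k) (y k) ≤
      (2 - sublinConst D.lo D.hi (c / 2) M 1⁻¹) * gapFunT 0 (D.ξ k) (y k / 2) := fun k => by
    have := gapFunT_mul_le (T := 0) (r := 2) (y := y k / 2) D.lo_pos D.lo_le_hi hc2 hcM one_pos
      le_rfl zero_le_one (D.lo_le k) (D.le_hi k) (by linarith [hcy k]) one_le_two
      (by linarith [hyM k])
    rw [mul_div_cancel₀ _ two_ne_zero] at this
    exact this.trans (le_of_eq (by ring))
  set δ := sublinConst D.lo D.hi (c / 2) M 1⁻¹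
  have hlim : Tendsto (fun T => tanh (T⁻¹ * D.lo / 2)) (𝓝[>] (0 : ℝ)) (𝓝 1) :=
    tendsto_tanh_atTop.comp ((tendsto_inv_nhdsGT_zero.atTop_mul_const D.lo_pos).atTop_div_const
      two_pos)
  filter_upwards [self_mem_nhdsWithin, hlim.eventually (lt_mem_nhds
    (show 1 - δ / 2 < 1 by linarith))] with T hT hτ
  have hT : 0 < T := hT
  refine D.exists_solution (z := (1 / 2 : ℝ) • y) (y := y) (M := M) hT hc2 (fun k => ?_)
    (fun k => ?_) (fun k => ?_) hyM ?_ ?_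
  · simp only [ContinuousMap.smul_apply, smul_eq_mul]
    linarith [hcy k]
  · simp only [ContinuousMap.smul_apply, smul_eq_mul]
    linarith [hcy k]
  · simp only [ContinuousMap.smul_apply, smul_eq_mul]
    linarith [hcy k]
  · have h1 : (1 / 2 : ℝ) • D.gap 0 y ≤ D.gap T ((1 / 2 : ℝ) • y) :=
      ContinuousMap.le_def.2 fun k => by
        have hx := D.ξ_pos k
        have hy0 : 0 < y k / 2 := by linarith [hcy k]
        have h2 : (1 / 2 : ℝ) * y k = y k / 2 := by ring
        rw [ContinuousMap.smul_apply, smul_eq_mul, gap_apply, gap_apply, ContinuousMap.smul_apply,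
          smul_eq_mul, h2]
        have h3 : tanh (T⁻¹ * D.lo / 2) ≤ thermalFactor T (qpEnergy (D.ξ k) (y k / 2)) := by
          rw [← thermalFactor_of_pos hT]
          exact thermalFactor_mono hT.le ((D.lo_le k).trans (le_qpEnergy _ _))
        have h4 := hsub k
        have h5 : gapFunT T (D.ξ k) (y k / 2) = gapFunT 0 (D.ξ k) (y k / 2) *
            thermalFactor T (qpEnergy (D.ξ k) (y k / 2)) := by
          rw [gapFunT_zero, gapFunT]
        have h6 := gapFunT_pos (T := 0) le_rfl hx hy0
        rw [h5]
        nlinarith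
    have h2 := ContinuousMap.map_mono_of_nonneg D.L_nonneg h1
    rwa [map_smul, ← hy] at h2
  · have h1 := ContinuousMap.map_mono_of_nonneg D.L_nonneg
      (D.gap_anti (v := y) le_rfl hT.le fun k => hc.le.trans (hcy k))
    rwa [← hy] at h1

end GapKernel

end Existence

/-! ### The integral operator with continuous kernel on a compact interval. -/

section IntervalKernel

variable {a b : ℝ}

/-- The integral over `[a, b]` as a continuous linear functional. -/
noncomputable def ContinuousMap.integralIcc (hab : a ≤ b) : C(Icc a b, ℝ) →L[ℝ] ℝ :=
  LinearMap.mkContinuous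
    { toFun := fun g => ∫ x in a..b, g (projIcc a b hab x)
      map_add' := fun f g => by
        simp only [ContinuousMap.add_apply]
        exact intervalIntegral.integral_add
          ((f.continuous.comp continuous_projIcc).intervalIntegrable _ _)
          ((g.continuous.comp continuous_projIcc).intervalIntegrable _ _)
      map_smul' := fun c f => by
        simp only [ContinuousMap.smul_apply, RingHom.id_apply]
        exact intervalIntegral.integral_smul _ _ } (b - a) fun g => by
    have := intervalIntegral.norm_integral_le_of_norm_le_const (a := a) (b := b) (C := ‖g‖)
      (f := fun x => g (projIcc a b hab x)) fun x _ => g.norm_coe_le_norm _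
    rw [abs_of_nonneg (sub_nonneg.2 hab), mul_comm] at this
    exact this

namespace ContinuousMap

theorem integralIcc_apply (hab : a ≤ b) (g : C(Icc a b, ℝ)) :
    integralIcc hab g = ∫ x in a..b, g (projIcc a b hab x) := rfl

theorem integralIcc_eq (hab : a ≤ b) {g : C(Icc a b, ℝ)} {f : ℝ → ℝ}
    (h : ∀ k : Icc a b, g k = f k) : integralIcc hab g = ∫ x in a..b, f x := by
  rw [integralIcc_apply]
  refine intervalIntegral.integral_congr fun x hx => ?_
  rw [uIcc_of_le hab] at hx
  simp only [h, projIcc_of_mem hab hx]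

theorem integralIcc_nonneg (hab : a ≤ b) (g : C(Icc a b, ℝ)) (hg : 0 ≤ g) :
    0 ≤ integralIcc hab g :=
  intervalIntegral.integral_nonneg hab fun _ _ => ContinuousMap.le_def.1 hg _

theorem integralIcc_pos (hab : a < b) {g : C(Icc a b, ℝ)} (hg : ∀ k, 0 ≤ g k) {k : Icc a b}
    (hk : 0 < g k) : 0 < integralIcc hab.le g := by
  refine intervalIntegral.integral_pos hab
    (g.continuous.comp continuous_projIcc).continuousOn (fun x _ => hg _) ⟨k, k.2, ?_⟩
  rwa [projIcc_val]

/-- The integral operator with the kernel `κ`. -/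
noncomputable def integralOpIcc (hab : a ≤ b) (κ : C(Icc a b × Icc a b, ℝ)) :
    C(Icc a b, ℝ) →L[ℝ] C(Icc a b, ℝ) :=
  LinearMap.mkContinuous
    { toFun := fun g => ⟨fun x => integralIcc hab (κ.curry x * g),
        (integralIcc hab).continuous.comp (κ.curry.continuous.mul continuous_const)⟩
      map_add' := fun f g => by
        ext x
        simp only [mul_add, map_add, coe_mk, add_apply]
      map_smul' := fun c f => by
        ext x
        simp only [mul_smul_comm, map_smul, coe_mk, smul_apply, RingHom.id_apply] }
    (‖integralIcc hab‖ * ‖κ.curry‖) fun g => by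
    refine (ContinuousMap.norm_le _ (by positivity)).2 fun x => ?_
    refine ((integralIcc hab).le_opNorm _).trans ?_
    rw [mul_assoc]
    refine mul_le_mul_of_nonneg_left ((norm_mul_le _ _).trans ?_) (norm_nonneg _)
    exact mul_le_mul_of_nonneg_right (κ.curry.norm_coe_le_norm x) (norm_nonneg _)

theorem integralOpIcc_apply (hab : a ≤ b) (κ : C(Icc a b × Icc a b, ℝ)) (g : C(Icc a b, ℝ))
    (x : Icc a b) : integralOpIcc hab κ g x = integralIcc hab (κ.curry x * g) := rfl

/-- Self-adjointness, by Fubini and the symmetry of the kernel. -/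
theorem integralIcc_integralOpIcc_mul (hab : a ≤ b) {κ : C(Icc a b × Icc a b, ℝ)}
    (hκ : ∀ x y, κ (x, y) = κ (y, x)) (f g : C(Icc a b, ℝ)) :
    integralIcc hab (integralOpIcc hab κ f * g) = integralIcc hab (f * integralOpIcc hab κ g) := by
  have key : ∀ f g : C(Icc a b, ℝ), integralIcc hab (integralOpIcc hab κ f * g) =
      ∫ x in Ioc a b, ∫ y in Ioc a b, κ (projIcc a b hab x, projIcc a b hab y) *
        (f (projIcc a b hab y) * g (projIcc a b hab x)) := fun f g => by
    rw [integralIcc_apply, intervalIntegral.integral_of_le hab]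
    congr 1
    ext x
    rw [ContinuousMap.mul_apply, integralOpIcc_apply, integralIcc_apply,
      intervalIntegral.integral_of_le hab, ← MeasureTheory.integral_mul_const]
    simp only [ContinuousMap.mul_apply, ContinuousMap.curry_apply, mul_assoc]
  rw [key, mul_comm f, key, MeasureTheory.integral_integral_swap]
  · congr 1
    ext x
    congr 1
    ext y
    rw [hκ, mul_comm (f _)]
  · rw [MeasureTheory.Measure.prod_restrict]
    refine MeasureTheory.IntegrableOn.mono_set (t := Icc a b ×ˢ Icc a b) ?_
      (prod_mono Ioc_subset_Icc_self Ioc_subset_Icc_self)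
    refine ContinuousOn.integrableOn_compact (isCompact_Icc.prod isCompact_Icc)
      (Continuous.continuousOn ?_)
    have h1 : Continuous fun p : ℝ × ℝ => projIcc a b hab p.1 :=
      continuous_projIcc.comp continuous_fst
    have h2 : Continuous fun p : ℝ × ℝ => projIcc a b hab p.2 :=
      continuous_projIcc.comp continuous_snd
    exact (κ.continuous.comp (h1.prodMk h2)).mul
      ((f.continuous.comp h2).mul (g.continuous.comp h1))

open Classical in
/-- The restriction to `[a, b]` of a function that is continuous there. -/
noncomputable def restrictIcc (a b : ℝ) (v : ℝ → ℝ) : C(Icc a b, ℝ) :=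
  -- The default 0 only makes the map total; a gap solution is continuous at each T ≥ 0.
  if h : ContinuousOn v (Icc a b) then ⟨_, h.domRestrict⟩ else 0

theorem restrictIcc_apply {v : ℝ → ℝ} (hv : ContinuousOn v (Icc a b)) (k : Icc a b) :
    restrictIcc a b v k = v k := by
  rw [restrictIcc, dif_pos hv]
  rfl

end ContinuousMap

open ContinuousMap

/-- The data of the gap equation with potential `κ` on the interval `[a, b]`. -/
noncomputable def intervalKernel (ha : 0 < a) (hab : a < b) {κ : C(Icc a b × Icc a b, ℝ)}
    (hκ : ∀ p, 0 < κ p) : GapKernel (Icc a b) where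
  ξ := ⟨Subtype.val, continuous_subtype_val⟩
  ζ := ⟨fun k => (k : ℝ)⁻¹, continuous_subtype_val.inv₀ fun k => (ha.trans_le k.2.1).ne'⟩
  lo := a
  hi := b
  lo_pos := ha
  lo_le k := k.2.1
  le_hi k := k.2.2
  lo_le_hi := hab.le
  ζ_eq _ := rfl
  L := integralOpIcc hab.le κ
  L_nonneg _ hg := ContinuousMap.le_def.2 fun _ => integralIcc_nonneg hab.le _
    (ContinuousMap.le_def.2 fun y => mul_nonneg (hκ _).le (ContinuousMap.le_def.1 hg y))

namespace intervalKernel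

variable (ha : 0 < a) (hab : a < b) {κ : C(Icc a b × Icc a b, ℝ)} (hκ : ∀ p, 0 < κ p)

@[simp] theorem ξ_apply (k : Icc a b) : (intervalKernel ha hab hκ).ξ k = k := rfl

/-- The kernel is strictly positive, so one point where the solution is nonzero makes the integral
positive everywhere. The lower bounds c > 0 come from this and compactness. -/
theorem pos_of_solution {T : ℝ} (hT : 0 ≤ T) {v : C(Icc a b, ℝ)} (hv0 : ∀ k, 0 ≤ v k)
    (hv : v = (intervalKernel ha hab hκ).L ((intervalKernel ha hab hκ).gap T v)) {k : Icc a b} (hk : v k ≠ 0) (l : Icc a b) : 0 < v l := by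
  rw [hv]
  refine integralIcc_pos hab (g := κ.curry l * (intervalKernel ha hab hκ).gap T v) (k := k) (fun m => ?_) ?_
  · rw [ContinuousMap.mul_apply, GapKernel.gap_apply]
    exact mul_nonneg (hκ _).le (gapFunT_nonneg hT ((intervalKernel ha hab hκ).ξ_pos m) (hv0 m))
  · rw [ContinuousMap.mul_apply, GapKernel.gap_apply]
    exact mul_pos (hκ _) (gapFunT_pos hT ((intervalKernel ha hab hκ).ξ_pos k) ((hv0 k).lt_of_ne' hk))

variable {U : ℝ → ℝ → ℝ} (hU : ∀ k l : Icc a b, κ (k, l) = U k l)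
include hU

theorem L_gap_apply {T : ℝ} {v : C(Icc a b, ℝ)} {w : ℝ → ℝ} (hw : ∀ k : Icc a b, v k = w k)
    (k : Icc a b) : (intervalKernel ha hab hκ).L ((intervalKernel ha hab hκ).gap T v) k = ∫ ξ in a..b,
      U k ξ * w ξ / qpEnergy ξ (w ξ) * thermalFactor T (qpEnergy ξ (w ξ)) := by
  refine integralIcc_eq hab.le (g := κ.curry k * (intervalKernel ha hab hκ).gap T v) fun l => ?_
  rw [ContinuousMap.mul_apply, GapKernel.gap_apply, ContinuousMap.curry_apply, hU, gapFunT, hw,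
    ξ_apply ha hab hκ]
  ring

theorem restrictIcc_eq {T : ℝ} {w : ℝ → ℝ} (hw : IsGapSolutionAt a b U T w) :
    restrictIcc a b w = (intervalKernel ha hab hκ).L ((intervalKernel ha hab hκ).gap T (restrictIcc a b w)) := by
  ext k
  rw [L_gap_apply ha hab hκ hU (restrictIcc_apply hw.1), restrictIcc_apply hw.1]
  exact hw.2.2 k k.2

theorem isGapSolutionAt {T : ℝ} {v : C(Icc a b, ℝ)} (hv0 : ∀ k, 0 ≤ v k)
    (hv : v = (intervalKernel ha hab hκ).L ((intervalKernel ha hab hκ).gap T v)) :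
    IsGapSolutionAt a b U T fun x => v (projIcc a b hab.le x) := by
  have h : ∀ k : Icc a b, v k = v (projIcc a b hab.le k) := fun k => by rw [projIcc_val]
  refine ⟨(v.continuous.comp continuous_projIcc).continuousOn, fun x _ => hv0 _, fun x hx => ?_⟩
  rw [← L_gap_apply ha hab hκ hU h ⟨x, hx⟩, ← hv, h ⟨x, hx⟩]

end intervalKernel

end IntervalKernel

/-! ### Positivity of the transition temperature and the solution family below it. -/

section Solution

theorem ContinuousMap.exists_pos_le {K : Type*} [TopologicalSpace K] [CompactSpace K] (v : C(K, ℝ))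
    (hv : ∀ k, 0 < v k) : ∃ c, 0 < c ∧ ∀ k, c ≤ v k := by
  rcases isEmpty_or_nonempty K with hK | hK
  · exact ⟨1, one_pos, fun k => hK.elim k⟩
  · obtain ⟨k, -, hk⟩ := isCompact_univ.exists_isMinOn univ_nonempty v.continuous.continuousOn
    exact ⟨v k, hv k, fun l => hk (mem_univ l)⟩

open ContinuousMap

namespace IsBCSSolution

variable {ε ω : ℝ} {U u : ℝ → ℝ → ℝ} (hε : 0 < ε) (hω : ε < ω)
  {κ : C(Icc ε ω × Icc ε ω, ℝ)} (hκ : ∀ p, 0 < κ p) (hU : ∀ k l : Icc ε ω, κ (k, l) = U k l)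
  (hu : IsBCSSolution ε ω U u)

section
include hu

theorem restrictIcc_apply {T : ℝ} (hT : 0 ≤ T) (k : Icc ε ω) : restrictIcc ε ω (u T) k = u T k :=
  ContinuousMap.restrictIcc_apply (hu T hT).1.1 k

theorem restrictIcc_nonneg {T : ℝ} (hT : 0 ≤ T) (k : Icc ε ω) : 0 ≤ restrictIcc ε ω (u T) k := by
  rw [hu.restrictIcc_apply hT]
  exact (hu T hT).1.2.1 k k.2

include hU in
theorem restrictIcc_eq {T : ℝ} (hT : 0 ≤ T) : restrictIcc ε ω (u T) =
    (intervalKernel hε hω hκ).L ((intervalKernel hε hω hκ).gap T (restrictIcc ε ω (u T))) :=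
  intervalKernel.restrictIcc_eq hε hω hκ hU (hu T hT).1

include hU hε hω hκ in
theorem restrictIcc_pos {T : ℝ} (hT : 0 ≤ T) (h : ∃ x ∈ Icc ε ω, u T x ≠ 0) (k : Icc ε ω) :
    0 < restrictIcc ε ω (u T) k := by
  obtain ⟨x, hx, hux⟩ := h
  refine intervalKernel.pos_of_solution hε hω hκ hT (hu.restrictIcc_nonneg hT)
    (hu.restrictIcc_eq hε hω hκ hU hT) (k := ⟨x, hx⟩) ?_ k
  rwa [hu.restrictIcc_apply hT]

include hU hε hω hκ in
theorem transitionTemp_pos (hsc : ∃ x ∈ Icc ε ω, u 0 x ≠ 0) : 0 < transitionTemp ε ω u := by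
  set D := intervalKernel hε hω hκ with hD
  obtain ⟨c, hc, hcu⟩ := exists_pos_le _ (hu.restrictIcc_pos hε hω hκ hU le_rfl hsc)
  have h1 := D.eventually_exists_solution hc hcu
    (apply_le_norm _)
    (hu.restrictIcc_eq hε hω hκ hU le_rfl)
  obtain ⟨δ, hδ, h2⟩ := mem_nhdsGT_iff_exists_Ioo_subset.1 h1
  -- The infimum must not be taken over the empty set, where it would be 0. At temperature ‖L‖ + 1
  -- only the trivial solution exists, as tanh z ≤ z.
  refine lt_of_lt_of_le hδ (le_csInf ⟨‖D.L‖ + 1, by positivity, fun x hx => ?_⟩ ?_)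
  · have hT : 0 ≤ ‖D.L‖ + 1 := by positivity
    have h3 := D.solution_eq_zero (T := ‖D.L‖ + 1) (by positivity)
      (by linarith [norm_nonneg D.L]) (hu.restrictIcc_nonneg hT)
      (hu.restrictIcc_eq hε hω hκ hU hT)
    rw [← hu.restrictIcc_apply hT ⟨x, hx⟩, h3, ContinuousMap.zero_apply]
  · rintro T ⟨hT, hT0⟩
    by_contra! hlt
    obtain ⟨v, hv, hveq⟩ := h2 ⟨hT, hlt⟩
    have hv0 : ∀ k, 0 < v k := fun k => (half_pos hc).trans_le (hv k)
    -- A positive solution exists at T, so the selection rule for u forbids u(T) = 0.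
    obtain ⟨x, hx, hux⟩ := (hu T hT.le).2 ⟨_, intervalKernel.isGapSolutionAt hε hω hκ hU
      (fun k => (hv0 k).le) hveq, ε, left_mem_Icc.2 hω.le, (hv0 _).ne'⟩
    exact hux (hT0 x hx)

include hU in
-- Below the infimum u(T) is nonzero, hence positive, hence decreasing in T. So the minimum at T₀
-- and the norm at 0 serve as uniform bounds.
theorem exists_isFamily (hsc : ∃ x ∈ Icc ε ω, u 0 x ≠ 0) {T₀ : ℝ} (hT₀ : 0 < T₀)
    (hT₀c : T₀ < transitionTemp ε ω u) : ∃ c M,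
      (intervalKernel hε hω hκ).IsFamily (fun T => restrictIcc ε ω (u T)) T₀ c M := by
  have hpos : ∀ T, 0 ≤ T → T ≤ T₀ → ∀ k, 0 < restrictIcc ε ω (u T) k := fun T h0 h => by
    refine hu.restrictIcc_pos hε hω hκ hU h0 ?_
    rcases h0.eq_or_lt with rfl | h0
    · exact hsc
    · have h1 := notMem_of_lt_csInf (h.trans_lt hT₀c) ⟨0, fun t ht => ht.1.le⟩
      simp only [mem_ofPred_eq, not_and, not_forall] at h1
      obtain ⟨x, hx, hux⟩ := h1 h0
      exact ⟨x, hx, hux⟩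
  have hanti : ∀ s t, 0 ≤ s → s ≤ t → t ≤ T₀ → ∀ k,
      restrictIcc ε ω (u t) k ≤ restrictIcc ε ω (u s) k := fun s t h0 hst ht k => by
    obtain ⟨c, hc, hcs⟩ := exists_pos_le _ (hpos s h0 (hst.trans ht))
    refine (intervalKernel hε hω hκ).solution_anti h0 hst hc
      (M := max ‖restrictIcc ε ω (u t)‖ ‖restrictIcc ε ω (u s)‖) (fun k => ?_) hcs (fun k => ?_)
      (hu.restrictIcc_nonneg (h0.trans hst)) (hu.restrictIcc_eq hε hω hκ hU (h0.trans hst))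
      (hu.restrictIcc_eq hε hω hκ hU h0) k
    · exact le_max_of_le_left (apply_le_norm _ k)
    · exact le_max_of_le_right (apply_le_norm _ k)
  obtain ⟨c, hc, hcT⟩ := exists_pos_le _ (hpos T₀ hT₀.le le_rfl)
  have hM : ∀ k, restrictIcc ε ω (u 0) k ≤ ‖restrictIcc ε ω (u 0)‖ := fun k =>
    apply_le_norm _ k
  have hk : ε ∈ Icc ε ω := left_mem_Icc.2 hω.le
  exact ⟨c, ‖restrictIcc ε ω (u 0)‖, hT₀, hc,
    (hcT ⟨ε, hk⟩).trans ((hanti 0 T₀ le_rfl hT₀.le le_rfl _).trans (hM _)),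
    fun T h0 _ => hu.restrictIcc_eq hε hω hκ hU h0,
    fun T h0 h k => (hcT k).trans (hanti T T₀ h0 h le_rfl k),
    fun T h0 h k => (hanti 0 T le_rfl h0 h k).trans (hM k)⟩

end

end IsBCSSolution

end Solution

/-! ### The potential as an integral of its density. -/

section ThermodynamicPotential

open ContinuousMap

variable {ε ω N₀ : ℝ} {u : ℝ → ℝ → ℝ} (hε : 0 < ε) (hω : ε < ω)
  {κ : C(Icc ε ω × Icc ε ω, ℝ)} (hκ : ∀ p, 0 < κ p)

theorem thermoPotential_of_pos {T : ℝ} (hT : 0 < T) {w : ℝ → C(Icc ε ω, ℝ)}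
    (hw : ∀ k, w T⁻¹ k = u T k) : thermoPotential N₀ ε ω u T =
      N₀ * integralIcc hω.le ((intervalKernel hε hω hκ).potCurve w T⁻¹) := by
  rw [GapKernel.potCurve, map_sub, map_add, map_smul, map_smul,
    integralIcc_eq hω.le (f := fun x => qpEnergy x (u T x)) fun k => by
      rw [GapKernel.energy_apply, hw, intervalKernel.ξ_apply],
    integralIcc_eq hω.le (f := fun x => u T x ^ 2 / qpEnergy x (u T x) *
      thermalFactor T (qpEnergy x (u T x))) fun k => by
      rw [GapKernel.gapCurve, ← GapKernel.gap_of_pos _ hT, mul_apply, GapKernel.gap_apply, hw,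
        intervalKernel.ξ_apply, gapFunT]
      ring,
    integralIcc_eq hω.le (f := fun x => log (1 + exp (-(qpEnergy x (u T x)) / T))) fun k => by
      rw [comp_apply, logOneAddExpNeg_apply, ContinuousMap.smul_apply, GapKernel.energy_apply, hw,
        intervalKernel.ξ_apply, smul_eq_mul]
      congr 3
      ring,
    thermoPotential, smul_eq_mul, smul_eq_mul, div_inv_eq_mul]
  ring

theorem thermoPotential_zero {v : C(Icc ε ω, ℝ)} (hv : ∀ k, v k = u 0 k) :
    thermoPotential N₀ ε ω u 0 = N₀ * integralIcc hω.le
      ((-2 : ℝ) • (intervalKernel hε hω hκ).energy v + v * (intervalKernel hε hω hκ).ratio v) := by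
  rw [map_add, map_smul,
    integralIcc_eq hω.le (f := fun x => qpEnergy x (u 0 x)) fun k => by
      rw [GapKernel.energy_apply, hv, intervalKernel.ξ_apply],
    integralIcc_eq hω.le (f := fun x => u 0 x ^ 2 / qpEnergy x (u 0 x) *
      thermalFactor 0 (qpEnergy x (u 0 x))) fun k => by
      rw [mul_apply, GapKernel.ratio_apply, hv, intervalKernel.ξ_apply, thermalFactor, if_pos rfl]
      ring,
    thermoPotential, smul_eq_mul]
  ring

end ThermodynamicPotential

/-! ### Specific heat of the normal state. -/

section NormalState

open ContinuousMap

/-- The potential density does not involve the kernel, so the constant kernel 1 serves wherever no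
gap equation enters. -/
theorem ContinuousMap.zero_lt_one_apply {K : Type*} [TopologicalSpace K] (p : K) :
    0 < (1 : C(K, ℝ)) p :=
  one_pos

variable {ε ω N₀ T : ℝ} (hε : 0 < ε) (hω : ε < ω) (hT : 0 < T)
include hε hω hT

theorem twiceDiffAt_normalPotential : TwiceDiffAt (normalPotential N₀ ε ω) T :=
  (intervalKernel hε hω zero_lt_one_apply).twiceDiffAt_potential (w := fun _ => 0) le_rfl
    contDiffOn_const (fun _ ht _ => thermoPotential_of_pos hε hω _ ht fun _ => rfl) hT
    (inv_pos.2 hT)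

theorem specificHeat_normalPotential : specificHeat (normalPotential N₀ ε ω) T =
    N₀ / T ^ 2 * ∫ x in ε..ω, x ^ 2 / cosh (x / (2 * T)) ^ 2 := by
  rw [(intervalKernel hε hω zero_lt_one_apply).specificHeat_potential
    (Ω := normalPotential N₀ ε ω) (w := fun _ => 0) le_rfl contDiffOn_const
    (fun _ ht _ => thermoPotential_of_pos hε hω _ ht fun _ => rfl) hT (inv_pos.2 hT),
    integralIcc_eq hω.le (f := fun x => (-T⁻¹) * (x ^ 2 / cosh (x / (2 * T)) ^ 2)) fun k => ?_,
    intervalIntegral.integral_const_mul]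
  · field_simp
  · have hk : 0 < (k : ℝ) := hε.trans_le k.2.1
    simp only [GapKernel.entCurveDeriv, deriv_const', zero_mul, mul_zero, sub_zero, smul_zero,
      add_zero, zero_add, ContinuousMap.smul_apply, ContinuousMap.mul_apply, comp_apply,
      GapKernel.energy_apply, intervalKernel.ξ_apply, ContinuousMap.zero_apply, smul_eq_mul,
      qpEnergy_zero hk.le, modeEntropyDeriv_apply]
    have h1 : exp (T⁻¹ * k) = exp (k / (2 * T)) ^ 2 := by
      rw [← exp_nat_mul]
      congr 1
      push_cast
      field_simp
    rw [h1, cosh_eq, exp_neg]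
    have h2 := exp_pos (k / (2 * T))
    field_simp
    ring

theorem specificHeat_normalPotential_eq : specificHeat (normalPotential N₀ ε ω) T =
    8 * N₀ * T * ∫ η in (ε / (2 * T))..(ω / (2 * T)), η ^ 2 / cosh η ^ 2 := by
  have h := intervalIntegral.mul_integral_comp_mul_left (a := ε / (2 * T)) (b := ω / (2 * T))
    (f := fun x => x ^ 2 / cosh (x / (2 * T)) ^ 2) (2 * T)
  rw [mul_div_cancel₀ _ (by positivity), mul_div_cancel₀ _ (by positivity)] at h
  have h2 : ∀ η, (2 * T * η) ^ 2 / cosh (2 * T * η / (2 * T)) ^ 2 =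
      (2 * T) ^ 2 * (η ^ 2 / cosh η ^ 2) := fun η => by
    rw [mul_div_cancel_left₀ _ (by positivity), mul_pow, mul_div_assoc]
  simp only [h2, intervalIntegral.integral_const_mul] at h
  rw [specificHeat_normalPotential hε hω hT, ← h]
  field_simp
  ring

theorem integral_sq_div_cosh_sq_pos :
    0 < ∫ η in (ε / (2 * T))..(ω / (2 * T)), η ^ 2 / cosh η ^ 2 := by
  have hlt : ε / (2 * T) < ω / (2 * T) := by gcongr
  have hc : Continuous fun η : ℝ => η ^ 2 / cosh η ^ 2 :=
    (continuous_id.pow 2).div (continuous_cosh.pow 2) fun η => (pow_pos (cosh_pos η) 2).ne'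
  refine intervalIntegral.intervalIntegral_pos_of_pos_on (hc.intervalIntegrable _ _)
    (fun η hη => ?_) hlt
  have h1 : 0 < η := lt_trans (by positivity) hη.1
  have h2 := cosh_pos η
  positivity

end NormalState

/-! ### The critical field at zero temperature. -/

section CriticalField

open ContinuousMap

variable {ε ω N₀ T : ℝ} {u : ℝ → ℝ → ℝ} (hε : 0 < ε) (hω : ε < ω)
include hε hω

/-- Pointwise, -2x + 2E - u²/E = (E - x)²/E because u² = E² - x². -/
theorem normalPotential_zero_sub (hu : ContinuousOn (u 0) (Icc ε ω)) :
    normalPotential N₀ ε ω 0 - thermoPotential N₀ ε ω u 0 =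
      N₀ * ∫ x in ε..ω, (qpEnergy x (u 0 x) - x) ^ 2 / qpEnergy x (u 0 x) := by
  rw [normalPotential, thermoPotential_zero hε hω zero_lt_one_apply (v := 0) fun _ => rfl,
    thermoPotential_zero hε hω zero_lt_one_apply (restrictIcc_apply hu), ← mul_sub,
    ← map_sub, integralIcc_eq]
  intro k
  have hk : 0 < (k : ℝ) := hε.trans_le k.2.1
  have hE := qpEnergy_pos hk (u 0 k)
  have hE2 := qpEnergy_sq k (u 0 k)
  simp only [ContinuousMap.sub_apply, ContinuousMap.add_apply, ContinuousMap.smul_apply,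
    ContinuousMap.mul_apply, GapKernel.energy_apply, GapKernel.ratio_apply,
    intervalKernel.ξ_apply, ContinuousMap.zero_apply, restrictIcc_apply hu, qpEnergy_zero hk.le,
    smul_eq_mul]
  field_simp
  linear_combination (k : ℝ) * hE2

theorem criticalField_zero_sq (hN₀ : 0 < N₀) (hu : ContinuousOn (u 0) (Icc ε ω)) :
    criticalField N₀ ε ω u 0 ^ 2 =
      8 * π * (N₀ * ∫ x in ε..ω, (qpEnergy x (u 0 x) - x) ^ 2 / qpEnergy x (u 0 x)) := by
  rw [criticalField, normalPotential_zero_sub hε hω hu, Real.sq_sqrt]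
  have : 0 ≤ ∫ x in ε..ω, (qpEnergy x (u 0 x) - x) ^ 2 / qpEnergy x (u 0 x) :=
    intervalIntegral.integral_nonneg hω.le fun x _ =>
      div_nonneg (sq_nonneg _) (Real.sqrt_nonneg _)
  positivity

omit hε hω in
theorem integral_qpEnergy_sub_sq_div (hT : 0 < T) (v : ℝ → ℝ) :
    ∫ x in ε..ω, (qpEnergy x (v x) - x) ^ 2 / qpEnergy x (v x) =
      (2 * T) ^ 2 * ∫ η in (ε / (2 * T))..(ω / (2 * T)),
        (√(η ^ 2 + (2 * T) ^ (-2 : ℤ) * v (2 * T * η) ^ 2) - η) ^ 2 /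
          √(η ^ 2 + (2 * T) ^ (-2 : ℤ) * v (2 * T * η) ^ 2) := by
  have h := intervalIntegral.mul_integral_comp_mul_left (a := ε / (2 * T)) (b := ω / (2 * T))
    (f := fun x => (qpEnergy x (v x) - x) ^ 2 / qpEnergy x (v x)) (2 * T)
  rw [mul_div_cancel₀ _ (by positivity), mul_div_cancel₀ _ (by positivity)] at h
  rw [← h, pow_two (2 * T), mul_assoc (2 * T) (2 * T)]
  refine congrArg _ ?_
  rw [← intervalIntegral.integral_const_mul]
  refine intervalIntegral.integral_congr fun η _ => ?_
  have h1 : qpEnergy (2 * T * η) (v (2 * T * η)) =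
      2 * T * √(η ^ 2 + (2 * T) ^ (-2 : ℤ) * v (2 * T * η) ^ 2) := by
    have h2 : (0 : ℝ) ≤ 2 * T := by positivity
    rw [qpEnergy, ← Real.sqrt_sq h2, ← Real.sqrt_mul (sq_nonneg _), Real.sqrt_sq h2]
    congr 1
    rw [zpow_neg, zpow_ofNat]
    field_simp
  rw [h1, ← mul_sub, mul_pow, pow_two (2 * T), mul_assoc, mul_div_mul_left _ _ (by positivity),
    mul_div_assoc]

end CriticalField

/-! ### The approximating expressions and the size of negligible terms. -/

section Approximation

open ContinuousMap

/-- This follows from cosh ≤ exp on [0, ∞). -/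
theorem inv_pow_mul_exp_le_negligible {G T : ℝ} (hG : 0 < G) (hT : 0 < T) (n : ℕ) :
    T⁻¹ ^ n * exp (-(T⁻¹ * G)) ≤ G⁻¹ ^ n * negligible G n T := by
  have h1 : 0 ≤ G / T := by positivity
  have h2 : cosh (G / T) ≤ exp (G / T) := by
    rw [cosh_eq]
    linarith [exp_le_exp.2 (by linarith : -(G / T) ≤ G / T)]
  have h3 : G⁻¹ ^ n * negligible G n T = T⁻¹ ^ n * (cosh (G / T))⁻¹ := by
    rw [negligible, mul_div_assoc', ← mul_pow, div_eq_mul_inv]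
    congr 2
    field_simp
  rw [h3, exp_neg, show T⁻¹ * G = G / T by ring]
  exact mul_le_mul_of_nonneg_left (inv_anti₀ (cosh_pos _) h2) (by positivity)

theorem negligible_nonneg {G T : ℝ} (hG : 0 < G) (hT : 0 < T) (n : ℕ) : 0 ≤ negligible G n T :=
  div_nonneg (by positivity) (cosh_pos _).le

theorem abs_map_powMulExpNeg_le {K : Type*} [TopologicalSpace K] [CompactSpace K]
    (J : C(K, ℝ) →L[ℝ] ℝ) {e : C(K, ℝ)} {G T : ℝ} (hG : 0 < G) (hT : 0 < T) (he : ∀ k, G ≤ e k)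
    (n : ℕ) : |J ((powMulExpNeg n).comp (T⁻¹ • e))| ≤
      ‖J‖ * ‖e‖ ^ n * (T⁻¹ ^ n * exp (-(T⁻¹ * G))) := by
  rw [mul_assoc]
  refine (J.le_opNorm _).trans (mul_le_mul_of_nonneg_left
    ((ContinuousMap.norm_le _ (by positivity)).2 fun k => ?_) (norm_nonneg _))
  have h0 : 0 < e k := hG.trans_le (he k)
  have h1 : (powMulExpNeg n).comp (T⁻¹ • e) k = (T⁻¹ * e k) ^ n * exp (-(T⁻¹ * e k)) := rfl
  rw [h1, Real.norm_of_nonneg (by positivity)]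
  calc (T⁻¹ * e k) ^ n * exp (-(T⁻¹ * e k)) ≤ (T⁻¹ * ‖e‖) ^ n * exp (-(T⁻¹ * G)) := by
        gcongr
        · exact apply_le_norm e k
        · exact he k
    _ = _ := by ring

variable {ε ω N₀ : ℝ} {U u : ℝ → ℝ → ℝ} (hε : 0 < ε) (hω : ε < ω)
  {κ : C(Icc ε ω × Icc ε ω, ℝ)} (hκ : ∀ p, 0 < κ p) {v : C(Icc ε ω, ℝ)} (hv : ∀ k, v k = u 0 k)
include hv

theorem entropyApprox_eq (T : ℝ) : entropyApprox N₀ ε ω u T = 4 * N₀ * integralIcc hω.le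
    ((powMulExpNeg 1).comp (T⁻¹ • (intervalKernel hε hω hκ).energy v)) := by
  rw [integralIcc_eq hω.le (f := fun x => T⁻¹ * (qpEnergy x (u 0 x) *
    exp (-(qpEnergy x (u 0 x)) / T))) fun k => ?_, intervalIntegral.integral_const_mul,
    entropyApprox]
  · ring
  · rw [comp_apply, ContinuousMap.smul_apply, GapKernel.energy_apply, hv, intervalKernel.ξ_apply,
      powMulExpNeg, coe_mk, smul_eq_mul, pow_one, mul_assoc, neg_div, div_eq_inv_mul]

theorem specificHeatApprox_eq (T : ℝ) : specificHeatApprox N₀ ε ω u T = 4 * N₀ *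
    integralIcc hω.le
      ((powMulExpNeg 2).comp (T⁻¹ • (intervalKernel hε hω hκ).energy v)) := by
  rw [integralIcc_eq hω.le (f := fun x => T⁻¹ ^ 2 * ((x ^ 2 + u 0 x ^ 2) *
    exp (-(qpEnergy x (u 0 x)) / T))) fun k => ?_, intervalIntegral.integral_const_mul,
    specificHeatApprox]
  · ring
  · rw [comp_apply, ContinuousMap.smul_apply, GapKernel.energy_apply, hv, intervalKernel.ξ_apply,
      powMulExpNeg, coe_mk, smul_eq_mul, mul_pow, qpEnergy_sq, mul_assoc, neg_div, div_eq_inv_mul]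

theorem solutionApprox_eq (hU : ∀ k l : Icc ε ω, κ (k, l) = U k l) (T : ℝ) (k : Icc ε ω) :
    solutionApprox ε ω U u T k = v k - 2 * integralOpIcc hω.le κ
      ((powMulExpNeg 0).comp (T⁻¹ • (intervalKernel hε hω hκ).energy v)) k := by
  rw [integralOpIcc_apply, integralIcc_eq hω.le (f := fun x => U k x *
    exp (-(qpEnergy x (u 0 x)) / T)) fun l => ?_, solutionApprox, hv]
  rw [ContinuousMap.mul_apply, comp_apply, ContinuousMap.smul_apply, GapKernel.energy_apply, hv,
    intervalKernel.ξ_apply, curry_apply, hU, powMulExpNeg, coe_mk, smul_eq_mul, pow_zero, one_mul,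
    neg_div, div_eq_inv_mul]

end Approximation

/-! ### Low temperature estimates on the interval. -/

section LowTemperature

open ContinuousMap

variable {ε ω N₀ : ℝ} {U u : ℝ → ℝ → ℝ} (hε : 0 < ε) (hω : ε < ω)

include hε in
theorem energyGap_le {x : ℝ} (hx : x ∈ Icc ε ω) : energyGap ε ω u ≤ qpEnergy x (u 0 x) := by
  refine csInf_le ⟨0, ?_⟩ (mem_image_of_mem _ hx)
  rintro _ ⟨y, hy, rfl⟩
  exact (qpEnergy_pos (hε.trans_le hy.1) _).le

include hε hω in
theorem energyGap_pos : 0 < energyGap ε ω u := by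
  refine hε.trans_le (le_csInf ((nonempty_Icc.2 hω.le).image _) ?_)
  rintro _ ⟨y, hy, rfl⟩
  exact hy.1.trans (le_qpEnergy _ _)

variable {κ : C(Icc ε ω × Icc ε ω, ℝ)} (hκ : ∀ p, 0 < κ p)
  (hU : ∀ k l : Icc ε ω, κ (k, l) = U k l) {v : ℝ → C(Icc ε ω, ℝ)}
  {T₁ c M : ℝ} (F : (intervalKernel hε hω hκ).IsFamily v T₁ c M)
  (hv : ∀ T, 0 ≤ T → ∀ k, v T k = u T k)
include hU F hv

/-- No cancellation is involved: S and its approximation are separately within the allowed error,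
likewise C_V, and for the solution both u(T) - u(0) and the correction integral are. The
approximations of S and C_V are better by one power of 1/T, raised by 1 ≤ T₀/T. -/
theorem exists_low_temperature_estimates {T₀ : ℝ} (hT₀ : 0 < T₀) (hT₀₁ : T₀ < T₁) :
    ∃ C : ℝ, ∀ T ∈ Ioc 0 T₀,
      |entropy (thermoPotential N₀ ε ω u) T - entropyApprox N₀ ε ω u T| ≤
        C * negligible (energyGap ε ω u) 2 T ∧
      |specificHeat (thermoPotential N₀ ε ω u) T - specificHeatApprox N₀ ε ω u T| ≤
        C * negligible (energyGap ε ω u) 3 T ∧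
      ∀ x ∈ Icc ε ω, |u T x - solutionApprox ε ω U u T x| ≤
        C * negligible (energyGap ε ω u) 0 T := by
  set G := energyGap ε ω u
  have hG0 : 0 < G := energyGap_pos hε hω
  set D := intervalKernel hε hω hκ
  set e := D.energy (v 0)
  set L := integralOpIcc hω.le κ
  set J := integralIcc hω.le
  have hG : ∀ k : Icc ε ω, G ≤ qpEnergy (D.ξ k) (v 0 k) := fun k => by
    rw [hv 0 le_rfl]
    exact energyGap_le hε k.2
  have he : ∀ k, G ≤ e k := fun k => by
    rw [GapKernel.energy_apply]
    exact hG k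
  obtain ⟨C₁, hC₁0, hC₁⟩ := F.exists_abs_entropy_le (Ω := thermoPotential N₀ ε ω u)
    (fun T hT _ => thermoPotential_of_pos hε hω hκ hT
      fun k => by simp only [inv_inv]; exact hv T hT.le k) hG0 hG
  obtain ⟨C₂, hC₂0, hC₂⟩ := F.exists_bounds hG0 hG
  have bound : ∀ {a A B X Y P : ℝ}, |a| ≤ A * X → |B| ≤ P * X → X ≤ Y → 0 ≤ A → 0 ≤ P →
      |a - B| ≤ (A + P) * Y := fun {a A B X Y P} h1 h2 h3 hA hP =>
    (abs_sub _ _).trans (by nlinarith [mul_le_mul_of_nonneg_left h3 (add_nonneg hA hP)])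
  set B₂ := C₁ + |4 * N₀| * (‖J‖ * ‖e‖ ^ 1 * T₀)
  set B₃ := C₁ + |4 * N₀| * (‖J‖ * ‖e‖ ^ 2 * T₀)
  set B₀ := C₂ + 2 * ‖L‖
  have hB₂ : 0 ≤ B₂ * G⁻¹ ^ 2 := by positivity
  have hB₃ : 0 ≤ B₃ * G⁻¹ ^ 3 := by positivity
  have hB₀ : 0 ≤ B₀ * G⁻¹ ^ 0 := by positivity
  refine ⟨B₂ * G⁻¹ ^ 2 + B₃ * G⁻¹ ^ 3 + B₀ * G⁻¹ ^ 0, fun T ⟨hT, hTT₀⟩ => ?_⟩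
  obtain ⟨h1, h2⟩ := hC₁ T ⟨hT, hTT₀.trans_lt hT₀₁⟩
  have hX := exp_pos (-(T⁻¹ * G))
  have hTi : 0 < T⁻¹ := inv_pos.2 hT
  have hTT : 1 ≤ T₀ * T⁻¹ := by rwa [← div_eq_mul_inv, le_div_iff₀ hT, one_mul]
  have hn := negligible_nonneg hG0 hT
  have key : ∀ n : ℕ, |4 * N₀ * J ((powMulExpNeg n).comp (T⁻¹ • e))| ≤
      |4 * N₀| * (‖J‖ * ‖e‖ ^ n * T₀) * (T⁻¹ ^ (n + 1) * exp (-(T⁻¹ * G))) := fun n => by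
    rw [abs_mul, mul_assoc |4 * N₀|]
    refine mul_le_mul_of_nonneg_left ((abs_map_powMulExpNeg_le J hG0 hT he n).trans ?_)
      (abs_nonneg _)
    rw [pow_succ T⁻¹]
    calc _ = ‖J‖ * ‖e‖ ^ n * (T⁻¹ ^ n * exp (-(T⁻¹ * G))) * 1 := by ring
      _ ≤ ‖J‖ * ‖e‖ ^ n * (T⁻¹ ^ n * exp (-(T⁻¹ * G))) * (T₀ * T⁻¹) := by gcongr
      _ = _ := by ring
  refine ⟨?_, ?_, fun x hx => ?_⟩
  · rw [entropyApprox_eq hε hω hκ (hv 0 le_rfl)]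
    have h3 := bound h1 (key 1) (inv_pow_mul_exp_le_negligible hG0 hT 2) hC₁0 (by positivity)
    nlinarith [mul_nonneg hB₃ (hn 2), mul_nonneg hB₀ (hn 2)]
  · rw [specificHeatApprox_eq hε hω hκ (hv 0 le_rfl)]
    have h3 := bound h2 (key 2) (inv_pow_mul_exp_le_negligible hG0 hT 3) hC₁0 (by positivity)
    nlinarith [mul_nonneg hB₂ (hn 3), mul_nonneg hB₀ (hn 3)]
  · have h3 := (hC₂ T⁻¹ (inv_strictAnti₀ hT (hTT₀.trans_lt hT₀₁))).2.1
    rw [inv_inv] at h3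
    have h4 := ((v 0 - v T).norm_coe_le_norm ⟨x, hx⟩).trans h3
    have h5 : |2 * L ((powMulExpNeg 0).comp (T⁻¹ • e)) ⟨x, hx⟩| ≤
        2 * ‖L‖ * exp (-(T⁻¹ * G)) := by
      rw [abs_mul, abs_two, mul_assoc]
      refine mul_le_mul_of_nonneg_left (((L _).norm_coe_le_norm _).trans ((L.le_opNorm _).trans
        (mul_le_mul_of_nonneg_left ((ContinuousMap.norm_le _ hX.le).2 fun k => ?_)
          (norm_nonneg _)))) two_pos.le
      have h1 : (powMulExpNeg 0).comp (T⁻¹ • e) k = (T⁻¹ * e k) ^ 0 * exp (-(T⁻¹ * e k)) := rfl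
      rw [h1, pow_zero, one_mul, Real.norm_of_nonneg (exp_pos _).le]
      gcongr
      exact he k
    have h6 := solutionApprox_eq hε hω hκ (hv 0 le_rfl) hU T ⟨x, hx⟩
    have h7 := inv_pow_mul_exp_le_negligible hG0 hT 0
    rw [pow_zero, one_mul] at h7
    rw [ContinuousMap.sub_apply, norm_sub_rev, Real.norm_eq_abs] at h4
    have h8 := bound h4 (by rwa [abs_neg] : |-(2 * L ((powMulExpNeg 0).comp (T⁻¹ • e)) ⟨x, hx⟩)| ≤ _)
      h7 hC₂0 (by positivity)
    simp only at h6
    rw [h6, ← hv T hT.le ⟨x, hx⟩]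
    have h9 : v T ⟨x, hx⟩ - (v 0 ⟨x, hx⟩ - 2 * L ((powMulExpNeg 0).comp (T⁻¹ • e)) ⟨x, hx⟩) =
      v T ⟨x, hx⟩ - v 0 ⟨x, hx⟩ - -(2 * L ((powMulExpNeg 0).comp (T⁻¹ • e)) ⟨x, hx⟩) := by ring
    rw [h9]
    nlinarith [mul_nonneg hB₂ (hn 0), mul_nonneg hB₃ (hn 0)]

end LowTemperature

/-! ### The main theorem. -/

theorem theorem1 (ε ω N₀ : ℝ) (hε : 0 < ε) (hω : ε < ω) (hN₀ : 0 < N₀)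
    (U : ℝ → ℝ → ℝ)
    (hUcont : ContinuousOn (fun p : ℝ × ℝ => U p.1 p.2) (Icc ε ω ×ˢ Icc ε ω))
    (hUpos : ∀ x ∈ Icc ε ω, ∀ ξ ∈ Icc ε ω, 0 < U x ξ)
    (u : ℝ → ℝ → ℝ) (hu : IsBCSSolution ε ω U u)
    (hsc : ∃ x ∈ Icc ε ω, u 0 x ≠ 0)
    (Tc : ℝ) (hTc : Tc = transitionTemp ε ω u)
    (Ω : ℝ → ℝ) (hΩ : Ω = thermoPotential N₀ ε ω u)
    (Eg : ℝ) (hEg : Eg = energyGap ε ω u) :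
    -- the transition temperature is positive, and below it the entropy and specific heat exist
    0 < Tc ∧
    (∀ T ∈ Ico 0 Tc, TwiceDiffAt Ω T) ∧
    -- the low temperature approximations, up to negligible terms; at `T = 0` their limits
    entropy Ω 0 = 0 ∧ specificHeat Ω 0 = 0 ∧
    (0 < Eg ∧ ∀ T₀ ∈ Ioo 0 Tc, ∃ C : ℝ, ∀ T ∈ Ioc 0 T₀,
      |entropy Ω T - entropyApprox N₀ ε ω u T| ≤ C * negligible Eg 2 T ∧
      |specificHeat Ω T - specificHeatApprox N₀ ε ω u T| ≤ C * negligible Eg 3 T ∧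
      ∀ x ∈ Icc ε ω, |u T x - solutionApprox ε ω U u T x| ≤ C * negligible Eg 0 T) ∧
    -- for symmetric potentials, the first two hold to leading order
    ((∀ x ∈ Icc ε ω, ∀ ξ ∈ Icc ε ω, U x ξ = U ξ x) →
      entropy Ω ~[𝓝[>] 0] entropyApprox N₀ ε ω u ∧
      specificHeat Ω ~[𝓝[>] 0] specificHeatApprox N₀ ε ω u) ∧
    -- the critical magnetic field at zero temperature and the specific heat at `Tc`
    TwiceDiffAt (normalPotential N₀ ε ω) Tc ∧
    0 < specificHeat (normalPotential N₀ ε ω) Tc ∧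
    criticalField N₀ ε ω u 0 ^ 2 / (Tc * specificHeat (normalPotential N₀ ε ω) Tc) =
      4 * π / (∫ η in (ε / (2 * Tc))..(ω / (2 * Tc)), η ^ 2 / cosh η ^ 2) *
        ∫ η in (ε / (2 * Tc))..(ω / (2 * Tc)),
          (√(η ^ 2 + (2 * Tc) ^ (-2 : ℤ) * u 0 (2 * Tc * η) ^ 2) - η) ^ 2 /
            √(η ^ 2 + (2 * Tc) ^ (-2 : ℤ) * u 0 (2 * Tc * η) ^ 2) := by
  let κ : C(Icc ε ω × Icc ε ω, ℝ) := ⟨fun p => U p.1 p.2, hUcont.comp_continuous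
    (by fun_prop : Continuous fun p : Icc ε ω × Icc ε ω => ((p.1 : ℝ), (p.2 : ℝ)))
    fun p => ⟨p.1.2, p.2.2⟩⟩
  have hκ : ∀ p, 0 < κ p := fun p => hUpos _ p.1.2 _ p.2.2
  have hU : ∀ k l : Icc ε ω, κ (k, l) = U k l := fun _ _ => rfl
  have hTc0 : 0 < Tc := hTc ▸ hu.transitionTemp_pos hε hω hκ hU hsc
  have hfam : ∀ T₁, 0 < T₁ → T₁ < Tc → ∃ c M, (intervalKernel hε hω hκ).IsFamily
      (fun T => ContinuousMap.restrictIcc ε ω (u T)) T₁ c M := fun T₁ h0 h1 =>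
    hu.exists_isFamily hε hω hκ hU hsc h0 (hTc ▸ h1)
  have hΩpos : ∀ T, 0 < T → Ω T = N₀ * ContinuousMap.integralIcc hω.le
      ((intervalKernel hε hω hκ).potCurve
        (fun s => ContinuousMap.restrictIcc ε ω (u s⁻¹)) T⁻¹) := fun T hT => by
    rw [hΩ]
    exact thermoPotential_of_pos hε hω hκ hT
      fun k => by rw [inv_inv, hu.restrictIcc_apply hT.le]
  have hΩ0 := thermoPotential_zero (N₀ := N₀) hε hω hκ (hu.restrictIcc_apply le_rfl)
  rw [← hΩ] at hΩ0
  -- Any temperature strictly between 0 and Tc would do for the assertions at T = 0 and in the limit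
  -- T ↓ 0.
  obtain ⟨c, M, F⟩ := hfam (Tc / 2) (by linarith) (by linarith)
  have hCV := specificHeat_normalPotential_eq (N₀ := N₀) hε hω hTc0
  have hI := integral_sq_div_cosh_sq_pos hε hω hTc0
  -- At T = 0 the specific heat vanishes by its prefactor T; the existence of the second derivative
  -- there is part of the second assertion.
  refine ⟨hTc0, fun T hT => ?_, F.entropy_zero (fun T hT _ => hΩpos T hT) hΩ0,
    by simp [specificHeat], ⟨hEg ▸ energyGap_pos hε hω, fun T₀ hT₀ => ?_⟩, fun hsym => ?_,
    twiceDiffAt_normalPotential hε hω hTc0, by rw [hCV]; positivity, ?_⟩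
  · rcases hT.1.eq_or_lt with rfl | hT0
    · exact F.twiceDiffAt_zero (fun T hT _ => hΩpos T hT) hΩ0
    · obtain ⟨c, M, F⟩ := hfam ((T + Tc) / 2) (by linarith) (by linarith [hT.2])
      exact (intervalKernel hε hω hκ).twiceDiffAt_potential (inv_pos.2 F.T₀_pos).le F.contDiffOn
        (fun T hT _ => hΩpos T hT) hT0 (inv_strictAnti₀ hT0 (by linarith [hT.2]))
  · obtain ⟨c, M, F⟩ := hfam ((T₀ + Tc) / 2) (by linarith [hT₀.1]) (by linarith [hT₀.2])
    rw [hΩ, hEg]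
    exact exists_low_temperature_estimates hε hω hκ hU F
      (fun T hT k => hu.restrictIcc_apply hT k) hT₀.1 (by linarith [hT₀.2])
  · have hself := ContinuousMap.integralIcc_integralOpIcc_mul hω.le (κ := κ)
      fun x y => hsym x x.2 y y.2
    have hJ := ContinuousMap.integralIcc_nonneg hω.le
    have h1 := F.isEquivalent_entropy (fun T hT _ => hΩpos T hT) hself hJ hN₀
    have h2 := F.isEquivalent_specificHeat (fun T hT _ => hΩpos T hT) hself hJ hN₀
    simp only [← entropyApprox_eq hε hω hκ (hu.restrictIcc_apply le_rfl)] at h1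
    simp only [← specificHeatApprox_eq hε hω hκ (hu.restrictIcc_apply le_rfl)] at h2
    exact ⟨h1, h2⟩
  · rw [criticalField_zero_sq hε hω hN₀ (hu 0 le_rfl).1.1, hCV,
      integral_qpEnergy_sub_sq_div hTc0 (u 0)]
    field_simp
    ring
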